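/- **Strict convexity of the coarse-grained Hamiltonian $\bar H_{Y_M^{DG}}$.** Fix an integer $L\ge 0$ and a single-site potential $\psi(z)=\tfrac12 z^2+az+\delta\psi(z)$ on $\mathbb{R}$, where $a\in\mathbb{R}$ and $\delta\psi\in C^2(\mathbb{R})$ satisfies $|\delta\psi|<C$ and $|\delta\psi''|<C$ on $\mathbb{R}$ for some constant $C<\infty$, and where $a$ is such that $\int_{\mathbb{R}} z\,e^{-\psi(z)}\,dz\big/\int_{\mathbb{R}} e^{-\psi(z)}\,dz=0$. For integers $K,M\ge 1$ put $N=KM$ and $H_N(x)=\sum_{n=1}^N\psi(x_n)$ for $x\in\mathbb{R}^N$. Identify $x\in\mathbb{R}^N$ with the step function in $L^2(\mathbb{T})$, $\mathbb{T}=[0,1)$, that equals $x_j$ on $[\frac{j-1}{N},\frac jN)$. Let $$Y_M^{DG}=\Big\{y\in L^2(\mathbb{T}) : y|_{(\frac{m-1}{M},\frac mM)}\text{ is a polynomial of degree}\le L\text{ for each } m=1,\dots,M\Big\},$$ with the inner product of $L^2(\mathbb{T})$, let $Q_M:L^2(\mathbb{T})\to Y_M^{DG}$ be the $L^2$-orthogonal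 projection, and let $$\bar H_{Y_M^{DG}}(y)=-\frac1N\ln\int_{\{x\in\mathbb{R}^N:\,Q_Mx=y\}}e^{-H_N(x)}\,dx,\qquad y\in Y_M^{DG},$$ where $dx$ is the Hausdorff measure on the affine space $\{x\in\mathbb{R}^N:Q_Mx=y\}$ (of the dimension of that space) for the Euclidean structure of $\mathbb{R}^N$, normalized to agree with Lebesgue measure. Then there are constants $0<\lambda,\Lambda,K^*<\infty$, independent of $K$, $M$ and $y$, such that for all $K\ge K^*$ and all $M\ge 1$ the integral above is finite and positive for every $y\in Y_M^{DG}$, the function $\bar H_{Y_M^{DG}}$ is twice continuously differentiable on $Y_M^{DG}$, and for all $y\in Y_M^{DG}$ $$2\lambda\,\mathrm{Id}_{Y_M^{DG}}\le \mathrm{Hess}_{Y_M^{DG}}\bar H_{Y_M^{DG}}(y)\le 2\Lambda\,\mathrm{Id}_{Y_M^{DG}}$$ in the sense of quadratic forms with respect to the $L^2$ inner product. -/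

import Mathlib

open MeasureTheory Set Polynomial
open scoped ENNReal

noncomputable section

namespace CoarseGraining

/-- The space `L²(𝕋)`, where the torus `𝕋` is identified with `[0, 1)` with Lebesgue measure. -/
abbrev L2Torus : Type := Lp ℝ 2 (volume.restrict (Ico (0 : ℝ) 1))

/-- The half-open mesh interval `[i/n, (i+1)/n)`, with `i` counted from `0`. -/
def cell (n : ℕ) (i : Fin n) : Set ℝ := Ico ((i : ℝ) / n) (((i : ℝ) + 1) / n)

theorem measurableSet_cell (n : ℕ) (i : Fin n) : MeasurableSet (cell n i) := measurableSet_Ico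

/-- The identification of `x ∈ ℝᴺ` with the step function equal to `x j` on the `j`-th interval
of length `1/N`, as an element of `L²(𝕋)`. The source carries the Euclidean structure. -/
def stepEmbed (N : ℕ) : EuclideanSpace ℝ (Fin N) →ₗ[ℝ] L2Torus where
  toFun x := ∑ j : Fin N,
    x j • indicatorConstLp 2 (measurableSet_cell N j) (measure_ne_top _ _) (1 : ℝ)
  map_add' x y := by simp [add_smul, Finset.sum_add_distrib]
  map_smul' c x := by simp [mul_smul, Finset.smul_sum]

theorem Ioo_mesh_subset {M : ℕ} (m : Fin M) :
    Ioo ((m : ℝ) / M) (((m : ℝ) + 1) / M) ⊆ Ico (0 : ℝ) 1 := by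
  have hM : (0 : ℝ) < M := by exact_mod_cast m.pos
  have hm : (m : ℝ) + 1 ≤ M := by exact_mod_cast m.isLt
  intro θ hθ
  exact ⟨le_trans (by positivity) hθ.1.le, hθ.2.trans_le ((div_le_one hM).2 hm)⟩

/-- The discontinuous Galerkin space: functions in `L²(𝕋)` that agree on each open interval
`(m/M, (m+1)/M)` with a polynomial of degree at most `L`. It carries the inner product of
`L²(𝕋)`. -/
def dgSpace (L M : ℕ) : Submodule ℝ L2Torus where
  carrier := {y | ∀ m : Fin M, ∃ p : ℝ[X], p.natDegree ≤ L ∧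
    ∀ᵐ θ ∂(volume.restrict (Ioo ((m : ℝ) / M) (((m : ℝ) + 1) / M))), y θ = p.eval θ}
  zero_mem' := by
    intro m
    refine ⟨0, by simp, ?_⟩
    have h := Lp.coeFn_zero ℝ 2 (volume.restrict (Ico (0 : ℝ) 1))
    filter_upwards [ae_restrict_of_ae_restrict_of_subset (Ioo_mesh_subset m) h] with θ hθ
    simpa using hθ
  add_mem' := by
    intro y z hy hz m
    obtain ⟨p, hp, hyp⟩ := hy m
    obtain ⟨q, hq, hzq⟩ := hz m
    refine ⟨p + q, natDegree_add_le_of_degree_le hp hq, ?_⟩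
    have h := Lp.coeFn_add y z
    filter_upwards [ae_restrict_of_ae_restrict_of_subset (Ioo_mesh_subset m) h, hyp, hzq] with θ h1 h2 h3
    rw [h1, Pi.add_apply, h2, h3, eval_add]
  smul_mem' := by
    intro c y hy m
    obtain ⟨p, hp, hyp⟩ := hy m
    refine ⟨c • p, (natDegree_smul_le c p).trans hp, ?_⟩
    have h := Lp.coeFn_smul c y
    filter_upwards [ae_restrict_of_ae_restrict_of_subset (Ioo_mesh_subset m) h, hyp] with θ h1 h2
    simp [h1, h2]

theorem memLp_monomial_cell (n : ℕ) (i : Fin n) (l : ℕ) :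
    MemLp ((cell n i).indicator fun θ : ℝ => θ ^ l) 2 (volume.restrict (Ico (0 : ℝ) 1)) := by
  refine MemLp.of_bound (C := 1) ?_ ?_
  · exact ((by fun_prop : Measurable fun θ : ℝ => θ ^ l).indicator
      (measurableSet_cell n i)).aestronglyMeasurable
  · filter_upwards [ae_restrict_mem measurableSet_Ico] with θ hθ
    by_cases h : θ ∈ cell n i
    · rw [indicator_of_mem h, Real.norm_eq_abs, abs_pow, abs_of_nonneg hθ.1]
      exact pow_le_one₀ hθ.1 hθ.2.le
    · simp [indicator_of_notMem h]

theorem exists_mem_cell {M : ℕ} (hM : 0 < M) {θ : ℝ} (hθ : θ ∈ Ico (0 : ℝ) 1) :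
    ∃ m : Fin M, θ ∈ cell M m := by
  have hM' : (0 : ℝ) < M := by exact_mod_cast hM
  have h0 : 0 ≤ θ * M := mul_nonneg hθ.1 hM'.le
  refine ⟨⟨⌊θ * M⌋₊, (Nat.floor_lt h0).2 ?_⟩, ?_, ?_⟩
  · nlinarith [hθ.2]
  · exact (div_le_iff₀ hM').2 (Nat.floor_le h0)
  · exact (lt_div_iff₀ hM').2 (Nat.lt_floor_add_one _)

theorem cell_eq_of_mem {M : ℕ} {i j : Fin M} {θ : ℝ} (hi : θ ∈ cell M i) (hj : θ ∈ cell M j) :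
    i = j := by
  have hM' : (0 : ℝ) < M := by exact_mod_cast i.pos
  have h1 := (div_le_iff₀ hM').1 hi.1
  have h2 := (lt_div_iff₀ hM').1 hi.2
  have h3 := (div_le_iff₀ hM').1 hj.1
  have h4 := (lt_div_iff₀ hM').1 hj.2
  have h5 : (i : ℝ) < (j : ℝ) + 1 := h1.trans_lt h4
  have h6 : (j : ℝ) < (i : ℝ) + 1 := h3.trans_lt h2
  have h7 : (i : ℕ) < (j : ℕ) + 1 := by exact_mod_cast h5
  have h8 : (j : ℕ) < (i : ℕ) + 1 := by exact_mod_cast h6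
  exact Fin.ext (by omega)

theorem dgSpace_le_span (L M : ℕ) (hM : 0 < M) :
    dgSpace L M ≤ Submodule.span ℝ (range fun k : Fin M × Fin (L + 1) =>
      (memLp_monomial_cell M k.1 k.2).toLp _) := by
  intro y hy
  choose p hp hyp using hy
  have key : y = ∑ k : Fin M × Fin (L + 1),
      (p k.1).coeff k.2 • (memLp_monomial_cell M k.1 k.2).toLp _ := by
    apply Lp.ext
    have h1 : ∀ᵐ θ ∂(volume.restrict (Ico (0 : ℝ) 1)), ∀ m : Fin M,
        θ ∈ cell M m → y θ = (p m).eval θ := by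
      refine ae_restrict_of_ae (ae_all_iff.2 fun m => ?_)
      rw [← ae_restrict_iff' (measurableSet_cell M m), cell]
      have hae := Measure.restrict_congr_set
        (Ioo_ae_eq_Ico (μ := (volume : Measure ℝ)) (a := (m : ℝ) / M) (b := ((m : ℝ) + 1) / M))
      exact hae ▸ hyp m
    have h2 := Lp.coeFn_finsetSum (Finset.univ : Finset (Fin M × Fin (L + 1)))
      (fun k => (p k.1).coeff k.2 • (memLp_monomial_cell M k.1 k.2).toLp _)
    have h3 : ∀ᵐ θ ∂(volume.restrict (Ico (0 : ℝ) 1)), ∀ k : Fin M × Fin (L + 1),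
        ((p k.1).coeff k.2 • (memLp_monomial_cell M k.1 k.2).toLp _ : L2Torus) θ =
          (p k.1).coeff k.2 * (cell M k.1).indicator (fun θ : ℝ => θ ^ (k.2 : ℕ)) θ := by
      refine ae_all_iff.2 fun k => ?_
      filter_upwards [Lp.coeFn_smul ((p k.1).coeff k.2)
        ((memLp_monomial_cell M k.1 k.2).toLp _),
        (memLp_monomial_cell M k.1 k.2).coeFn_toLp] with θ ha hb
      rw [ha, Pi.smul_apply, hb, smul_eq_mul]
    filter_upwards [h1, h2, h3, ae_restrict_mem measurableSet_Ico] with θ h1 h2 h3 hθ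
    obtain ⟨m, hm⟩ := exists_mem_cell hM hθ
    rw [h2, h1 m hm, Finset.sum_apply]
    simp_rw [h3]
    rw [Fintype.sum_prod_type, Finset.sum_eq_single m]
    · rw [eval_eq_sum_range' (Nat.lt_succ_of_le (hp m)), Finset.sum_range]
      exact Finset.sum_congr rfl fun l _ => by rw [indicator_of_mem hm]
    · intro m' _ hne
      refine Finset.sum_eq_zero fun l _ => ?_
      rw [indicator_of_notMem fun h => hne (cell_eq_of_mem h hm), mul_zero]
    · simp
  rw [key]
  exact Submodule.sum_mem _ fun k _ => Submodule.smul_mem _ _ (Submodule.subset_span ⟨k, rfl⟩)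

instance finiteDimensional_dgSpace (L M : ℕ) [NeZero M] : FiniteDimensional ℝ (dgSpace L M) :=
  have : FiniteDimensional ℝ (Submodule.span ℝ (range fun k : Fin M × Fin (L + 1) =>
      (memLp_monomial_cell M k.1 k.2).toLp _)) :=
    FiniteDimensional.span_of_finite ℝ (finite_range _)
  Submodule.finiteDimensional_of_le (dgSpace_le_span L M (NeZero.pos M))

/-- The orthogonal projection `Q_M` of `L²(𝕋)` onto the discontinuous Galerkin space. -/
def dgProj (L M : ℕ) [NeZero M] : L2Torus →L[ℝ] dgSpace L M :=
  (dgSpace L M).orthogonalProjectionOnto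

/-- The restriction of `Q_M` to `ℝᴺ`, viewed as the space of step functions. -/
def coarseMap (L M N : ℕ) [NeZero M] : EuclideanSpace ℝ (Fin N) →ₗ[ℝ] dgSpace L M :=
  (dgProj L M).toLinearMap ∘ₗ stepEmbed N

/-- The fibre `{x ∈ ℝᴺ : Q_M x = y}`. -/
def fibre (L M N : ℕ) [NeZero M] (y : dgSpace L M) : Set (EuclideanSpace ℝ (Fin N)) :=
  {x | coarseMap L M N x = y}

/-- The microscopic Hamiltonian `H_N(x) = ∑ ψ(x_n)`. -/
def hamiltonian (ψ : ℝ → ℝ) (N : ℕ) (x : EuclideanSpace ℝ (Fin N)) : ℝ := ∑ n, ψ (x n)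

/-- The integral of `exp(-H_N)` over the fibre of `y` with respect to the Hausdorff measure whose
dimension is that of the fibre (the dimension of the kernel of `Q_M` on `ℝᴺ`), in the
normalization that agrees with Lebesgue measure on Euclidean subspaces. -/
def fibreIntegral (ψ : ℝ → ℝ) (L M N : ℕ) [NeZero M] (y : dgSpace L M) : ℝ :=
  ∫ x in fibre L M N y, Real.exp (-hamiltonian ψ N x)
    ∂(Measure.euclideanHausdorffMeasure (Module.finrank ℝ (LinearMap.ker (coarseMap L M N))))

/-- The coarse-grained Hamiltonian `y ↦ -(1/N) log ∫_{Q_M x = y} exp(-H_N(x)) dx`. -/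
def coarseHamiltonian (ψ : ℝ → ℝ) (L M N : ℕ) [NeZero M] (y : dgSpace L M) : ℝ :=
  -(1 / (N : ℝ)) * Real.log (fibreIntegral ψ L M N y)

/-- The single-site potential `ψ(z) = z²/2 + a z + δψ(z)`. -/
def singleSite (a : ℝ) (δψ : ℝ → ℝ) (z : ℝ) : ℝ := z ^ 2 / 2 + a * z + δψ z

end CoarseGraining

end

/-!
The constraint `Q_M x = y` decouples over the cells of the coarse mesh, because the functions of
the discontinuous Galerkin space are unconstrained across cell boundaries. With polynomials `p i`
that are orthonormal on `[0, 1]` and their transplants to the cells as an orthonormal basis of the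
space, the coordinates of `Q_M x` on the cell `m` are, up to the factor `1 / √N`, the vector
`∑ k, x k • v k`, where `x k` runs through the `K` sites of the cell and `v k` consists of the
averages of the `p i` over the `k`-th of `K` subintervals (`IsOrthonormalPoly.cellCoord_coarseMap`).
Hence the fibre integral is a constant times the product over the cells of one function `f` on
`ℝ^d`, evaluated at `√N` times the coordinates of `y` on the cell
(`IsOrthonormalPoly.exists_fibreIntegral_eq_prod`), and the Hessian of the coarse-grained
Hamiltonian is a sum over the cells of Hessians of `-log f`. The powers of `N` cancel, and it
remains to bound the Hessian of `-log f` above and below by constants that depend neither on `K`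
nor on the point.

This is a local Cramér theorem (`exists_block_hessian_bounds`). Given a point `u`, an external
field `σ` is chosen so that the product of the single-site measures tilted by `⟪v k, σ⟫` gives
`∑ k, x k • v k` the mean `u` (`exists_sum_siteMean_smul_eq`). Tilting multiplies `f` by the
exponential of an affine function (`kerIntegral_gibbsWeight_add`) and so does not change the
Hessian of `-log f`, which may therefore be computed for the density `P` of a sum of independent
centred variables, at the origin. There `P` is the inverse Fourier transform of the product
`X ξ = ∏ k, χ k ⟪v k, ξ⟫` of the single-site transforms `χ k`, and the Hessian is expressed by
moments of `X` (`hessian_neg_log_fourierInv`). The tilted and recentred single-site densities are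
all comparable to Gaussians of variance `1` with the same constants, because `δψ` and its
derivative are bounded (`isSiteDensity_siteDensity`). Consequently the `χ k` decay algebraically and
agree with a Gaussian to third order at the origin, both uniformly. For fine meshes the `v k` are
of length `O(1 / √K)` and form a frame with a lower bound independent of `K`
(`IsOrthonormalPoly.exists_isUniformFrame`), so that `X` is dominated by a fixed function with
finite second moment, and its real part is at least a fixed Gaussian up to an error `O(1 / √K)` on
bounded sets. This gives the uniform moment bounds (`exists_moment_bounds`).
-/

namespace CoarseGraining

open ProbabilityTheory FourierTransform

/-! ### Single-site densities and their Fourier transforms -/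

/-- A centred probability density on `ℝ` comparable, up to the factor `A`, to the Gaussian
density of mean `b` and variance `1`, and with logarithmic derivative at most `|z - b| + B`.
All tilted and centred single-site measures are of this kind, with the same `A` and `B`. -/
structure IsSiteDensity (A B b : ℝ) (ρ : ℝ → ℝ) : Prop where
  contDiff : ContDiff ℝ 1 ρ
  lower : ∀ z, A⁻¹ * gaussianPDFReal b 1 z ≤ ρ z
  upper : ∀ z, ρ z ≤ A * gaussianPDFReal b 1 z
  abs_deriv_le : ∀ z, |deriv ρ z| ≤ (|z - b| + B) * ρ z
  integral_eq_one : ∫ z, ρ z = 1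
  mean_zero : ∫ z, z * ρ z = 0

/-- The absolute moments of the standard Gaussian. -/
noncomputable def gaussianAbsMoment (n : ℕ) : ℝ := ∫ z, |z| ^ n * gaussianPDFReal 0 1 z

theorem gaussianAbsMoment_nonneg (n : ℕ) : 0 ≤ gaussianAbsMoment n :=
  integral_nonneg fun z => mul_nonneg (by positivity) (gaussianPDFReal_nonneg _ _ _)

theorem integrable_abs_pow_mul_gaussianPDFReal (n : ℕ) (b : ℝ) :
    Integrable fun z => |z - b| ^ n * gaussianPDFReal b 1 z := by
  have h0 : Integrable fun z : ℝ => |z| ^ n * gaussianPDFReal 0 1 z := by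
    have h := (integrable_rpow_mul_exp_neg_mul_sq (b := 1 / 2) (by norm_num) (s := n)
      (lt_of_lt_of_le (by norm_num) n.cast_nonneg)).norm.const_mul (√(2 * Real.pi * 1))⁻¹
    refine h.congr (ae_of_all _ fun z => ?_)
    simp only [gaussianPDFReal, Real.rpow_natCast, norm_mul, norm_pow, Real.norm_eq_abs,
      Real.abs_exp, NNReal.coe_one, sub_zero]
    rw [show -(1 / 2) * z ^ 2 = -z ^ 2 / (2 * 1) by ring]
    ring
  refine (h0.comp_sub_right b).congr (ae_of_all _ fun z => ?_)
  simp [gaussianPDFReal]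

theorem integral_abs_pow_mul_gaussianPDFReal (n : ℕ) (b : ℝ) :
    ∫ z, |z - b| ^ n * gaussianPDFReal b 1 z = gaussianAbsMoment n := by
  have h := integral_sub_right_eq_self (μ := volume)
    (fun z => |z| ^ n * gaussianPDFReal 0 1 z) b
  rw [gaussianAbsMoment, ← h]
  simp [gaussianPDFReal]

theorem norm_fourier_gaussianPDFReal (b t : ℝ) :
    ‖𝓕 (fun z => (gaussianPDFReal b 1 z : ℂ)) t‖ = Real.exp (-2 * Real.pi ^ 2 * t ^ 2) := by
  have h : 𝓕 (fun z => (gaussianPDFReal b 1 z : ℂ)) t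
      = charFun (gaussianReal b 1) (-2 * Real.pi * t) := by
    rw [charFun_apply, integral_gaussianReal_eq_integral_smul one_ne_zero,
      Real.fourier_real_eq_integral_exp_smul]
    refine integral_congr_ae (ae_of_all _ fun z => ?_)
    simp only [smul_eq_mul, RCLike.inner_apply, conj_trivial, Complex.real_smul]
    rw [mul_comm]
    congr 3
    push_cast
    ring
  rw [h, charFun_gaussianReal, Complex.norm_exp]
  congr 1
  simp [pow_two]
  ring

namespace IsSiteDensity

variable {A B b : ℝ} {ρ : ℝ → ℝ}

theorem pos (h : IsSiteDensity A B b ρ) (hA : 0 < A) (z : ℝ) : 0 < ρ z :=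
  lt_of_lt_of_le (mul_pos (inv_pos.2 hA) (gaussianPDFReal_pos _ _ _ one_ne_zero)) (h.lower z)

theorem integrable_abs_pow (h : IsSiteDensity A B b ρ) (hA : 0 < A) (n : ℕ) :
    Integrable fun z => |z - b| ^ n * ρ z := by
  refine ((integrable_abs_pow_mul_gaussianPDFReal n b).const_mul A).mono'
    (Continuous.aestronglyMeasurable (by have := h.contDiff.continuous; fun_prop))
    (ae_of_all _ fun z => ?_)
  rw [Real.norm_eq_abs, abs_of_nonneg (mul_nonneg (by positivity) (h.pos hA z).le)]
  have := mul_le_mul_of_nonneg_left (h.upper z) (by positivity : 0 ≤ |z - b| ^ n)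
  linarith

theorem integral_abs_pow_le (h : IsSiteDensity A B b ρ) (hA : 0 < A) (n : ℕ) :
    ∫ z, |z - b| ^ n * ρ z ≤ A * gaussianAbsMoment n := by
  rw [← integral_abs_pow_mul_gaussianPDFReal n b, ← integral_const_mul]
  refine integral_mono (h.integrable_abs_pow hA n)
    ((integrable_abs_pow_mul_gaussianPDFReal n b).const_mul A) fun z => ?_
  have := mul_le_mul_of_nonneg_left (h.upper z) (by positivity : 0 ≤ |z - b| ^ n)
  dsimp only
  linarith

theorem integrable (h : IsSiteDensity A B b ρ) (hA : 0 < A) : Integrable ρ := by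
  simpa using h.integrable_abs_pow hA 0

/-- The mean of the comparison Gaussian is bounded, since `ρ` itself is centred. -/
theorem abs_mean_le (h : IsSiteDensity A B b ρ) (hA : 0 < A) : |b| ≤ A * gaussianAbsMoment 1 := by
  have h1 := h.integrable_abs_pow hA 1
  simp only [pow_one] at h1
  have h2 : Integrable fun z => (z - b) * ρ z := by
    refine h1.mono' (Continuous.aestronglyMeasurable
      (by have := h.contDiff.continuous; fun_prop)) (ae_of_all _ fun z => ?_)
    rw [norm_mul, Real.norm_eq_abs, Real.norm_eq_abs, abs_of_pos (h.pos hA z)]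
  have h3 : ∫ z, (z - b) * ρ z = -b := by
    have : (fun z => z * ρ z) = fun z => (z - b) * ρ z + b * ρ z := by ext z; ring
    have h4 := h.mean_zero
    rw [this, integral_add h2 ((h.integrable hA).const_mul b), integral_const_mul,
      h.integral_eq_one] at h4
    linarith
  calc |b| = ‖∫ z, (z - b) * ρ z‖ := by rw [h3, Real.norm_eq_abs, abs_neg]
    _ ≤ ∫ z, ‖(z - b) * ρ z‖ := norm_integral_le_integral_norm _
    _ = ∫ z, |z - b| ^ 1 * ρ z := by
        simp only [norm_mul, Real.norm_eq_abs, abs_of_pos (h.pos hA _), pow_one]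
    _ ≤ _ := h.integral_abs_pow_le hA 1

/-- Writing `ρ` as the mixture of a Gaussian with weight `A⁻¹` and a remainder bounds its Fourier
transform away from `1` outside every neighbourhood of the origin. -/
theorem norm_fourier_le_of_lower (h : IsSiteDensity A B b ρ) (hA : 0 < A) (t : ℝ) :
    ‖𝓕 (fun z => (ρ z : ℂ)) t‖ ≤ 1 - A⁻¹ * (1 - Real.exp (-2 * Real.pi ^ 2 * t ^ 2)) := by
  have hγ := integrable_gaussianPDFReal b 1
  have hsub : Integrable fun z => ρ z - A⁻¹ * gaussianPDFReal b 1 z :=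
    (h.integrable hA).sub (hγ.const_mul _)
  have hsplit : 𝓕 (fun z => (ρ z : ℂ)) t
      = 𝓕 (fun z => ((ρ z - A⁻¹ * gaussianPDFReal b 1 z : ℝ) : ℂ)) t
        + (A⁻¹ : ℂ) * 𝓕 (fun z => (gaussianPDFReal b 1 z : ℂ)) t := by
    have h1 : Integrable fun z => Real.fourierChar (-inner ℝ z t) •
        ((ρ z - A⁻¹ * gaussianPDFReal b 1 z : ℝ) : ℂ) :=
      (Real.fourierIntegral_convergent_iff (μ := volume) t).2 (hsub.ofReal (𝕜 := ℂ))
    have h2 : Integrable fun z => (A⁻¹ : ℂ) * Real.fourierChar (-inner ℝ z t) •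
        (gaussianPDFReal b 1 z : ℂ) :=
      ((Real.fourierIntegral_convergent_iff (μ := volume) t).2 (hγ.ofReal (𝕜 := ℂ))).const_mul _
    simp only [Real.fourier_eq]
    rw [← integral_const_mul, ← integral_add h1 h2]
    refine integral_congr_ae (ae_of_all _ fun z => ?_)
    simp only [Circle.smul_def, smul_eq_mul]
    push_cast
    ring
  have hbound : ‖𝓕 (fun z => ((ρ z - A⁻¹ * gaussianPDFReal b 1 z : ℝ) : ℂ)) t‖ ≤ 1 - A⁻¹ := by
    rw [Real.fourier_eq]
    refine (norm_integral_le_integral_norm _).trans (le_of_eq ?_)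
    have : ∀ z, ‖Real.fourierChar (-inner ℝ z t) • ((ρ z - A⁻¹ * gaussianPDFReal b 1 z : ℝ) : ℂ)‖
        = ρ z - A⁻¹ * gaussianPDFReal b 1 z := fun z => by
      rw [Circle.norm_smul, Complex.norm_real, Real.norm_eq_abs,
        abs_of_nonneg (sub_nonneg.2 (h.lower z))]
    simp_rw [this]
    rw [integral_sub (h.integrable hA) (hγ.const_mul _), integral_const_mul, h.integral_eq_one,
      integral_gaussianPDFReal_eq_one _ one_ne_zero, mul_one]
  rw [hsplit]
  refine (norm_add_le _ _).trans ?_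
  rw [norm_mul, norm_fourier_gaussianPDFReal, norm_inv, Complex.norm_real, Real.norm_eq_abs,
    abs_of_pos hA]
  linarith

/-- Integrability of the derivative of `ρ` makes its Fourier transform decay like `1 / |t|`. -/
theorem norm_fourier_mul_le (h : IsSiteDensity A B b ρ) (hA : 0 < A) (t : ℝ) :
    2 * Real.pi * |t| * ‖𝓕 (fun z => (ρ z : ℂ)) t‖ ≤ A * gaussianAbsMoment 1 + B := by
  have hd : Differentiable ℝ ρ := h.contDiff.differentiable one_ne_zero
  have hder : ∀ z, HasDerivAt (fun z => (ρ z : ℂ)) ((deriv ρ z : ℝ) : ℂ) z := fun z =>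
    (hd z).hasDerivAt.ofReal_comp
  have h1 := h.integrable_abs_pow hA 1
  simp only [pow_one] at h1
  have hi : Integrable fun z => (|z - b| + B) * ρ z := by
    simp_rw [add_mul]
    exact h1.add ((h.integrable hA).const_mul B)
  have hdi : Integrable (deriv ρ) :=
    hi.mono' ((h.contDiff.continuous_deriv le_rfl).aestronglyMeasurable)
      (ae_of_all _ fun z => h.abs_deriv_le z)
  have hde : deriv (fun z => (ρ z : ℂ)) = fun z => ((deriv ρ z : ℝ) : ℂ) :=
    funext fun z => (hder z).deriv
  have key := congrFun (Real.fourier_deriv (f := fun z => (ρ z : ℂ)) (h.integrable hA).ofReal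
    (fun z => (hder z).differentiableAt) (by rw [hde]; exact hdi.ofReal)) t
  have hn := congrArg norm key
  rw [norm_smul] at hn
  have hc : ‖(2 * Real.pi * Complex.I * t : ℂ)‖ = 2 * Real.pi * |t| := by
    simp [abs_of_pos Real.pi_pos]
  rw [hc] at hn
  rw [← hn, hde, Real.fourier_eq]
  calc _ ≤ ∫ z, ‖Real.fourierChar (-inner ℝ z t) • ((deriv ρ z : ℝ) : ℂ)‖ :=
        norm_integral_le_integral_norm _
    _ = ∫ z, |deriv ρ z| := by simp [Circle.norm_smul]
    _ ≤ ∫ z, (|z - b| + B) * ρ z := integral_mono hdi.abs hi h.abs_deriv_le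
    _ = (∫ z, |z - b| ^ 1 * ρ z) + B := by
        simp_rw [add_mul, pow_one]
        rw [integral_add h1 ((h.integrable hA).const_mul B), integral_const_mul,
          h.integral_eq_one, mul_one]
    _ ≤ _ := by have := h.integral_abs_pow_le hA 1; linarith

end IsSiteDensity

/-! ### Uniform decay and Gaussian approximation of the Fourier transforms -/

namespace IsSiteDensity

/-- Uniform algebraic decay of the Fourier transform of a single-site density, in a form whose
product over many sites is integrable. -/
theorem exists_norm_fourier_le (A B : ℝ) (hA : 0 < A) :
    ∃ β : ℝ, 0 < β ∧ ∀ (b : ℝ) (ρ : ℝ → ℝ), IsSiteDensity A B b ρ → ∀ t : ℝ,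
      ‖𝓕 (fun z => (ρ z : ℂ)) t‖ ≤ (1 + t ^ 2) ^ (-β) := by
  set D : ℝ := A * gaussianAbsMoment 1 + B with hD
  set T : ℝ := max 1 (D ^ 2) with hT
  have hT1 : 1 ≤ T := le_max_left _ _
  have hTD : D ^ 2 ≤ T := le_max_right _ _
  refine ⟨min (1 / 4) (A⁻¹ / (1 + T ^ 2)), by positivity, fun b ρ h t => ?_⟩
  set β := min (1 / 4) (A⁻¹ / (1 + T ^ 2)) with hβ
  have hβ0 : 0 ≤ β := by positivity
  have hb1 := h.norm_fourier_le_of_lower hA t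
  have hb2 := h.norm_fourier_mul_le hA t
  set f := ‖𝓕 (fun z => (ρ z : ℂ)) t‖ with hf
  have hf0 : 0 ≤ f := norm_nonneg _
  have ht1 : (1 : ℝ) ≤ 1 + t ^ 2 := by nlinarith [sq_nonneg t]
  -- for `|t| ≤ T` the Gaussian component of `ρ` gives the decay, beyond `T` the derivative of `ρ`
  rcases le_total |t| T with ht | ht
  · have hx : t ^ 2 / (1 + T ^ 2) ≤ 1 - Real.exp (-2 * Real.pi ^ 2 * t ^ 2) := by
      have ht2 : t ^ 2 ≤ T ^ 2 := sq_le_sq' (by linarith [abs_le.1 ht]) (by linarith [abs_le.1 ht])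
      have hpi : t ^ 2 ≤ 2 * Real.pi ^ 2 * t ^ 2 := by
        have : (1 : ℝ) ≤ 2 * Real.pi ^ 2 := by nlinarith [Real.pi_gt_three]
        nlinarith [sq_nonneg t]
      have he : Real.exp (-2 * Real.pi ^ 2 * t ^ 2) ≤ (1 + t ^ 2)⁻¹ := by
        rw [show -2 * Real.pi ^ 2 * t ^ 2 = -(2 * Real.pi ^ 2 * t ^ 2) by ring, Real.exp_neg]
        refine inv_anti₀ (by positivity) ?_
        linarith [Real.add_one_le_exp (2 * Real.pi ^ 2 * t ^ 2)]
      have h3 : t ^ 2 / (1 + T ^ 2) ≤ t ^ 2 / (1 + t ^ 2) := by gcongr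
      have h4 : t ^ 2 / (1 + t ^ 2) = 1 - (1 + t ^ 2)⁻¹ := by field_simp; ring
      linarith
    have h5 : f ≤ 1 - β * t ^ 2 := by
      have h6 : β * t ^ 2 ≤ A⁻¹ / (1 + T ^ 2) * t ^ 2 := by gcongr; exact min_le_right _ _
      have h7 : A⁻¹ / (1 + T ^ 2) * t ^ 2 = A⁻¹ * (t ^ 2 / (1 + T ^ 2)) := by ring
      have h8 := mul_le_mul_of_nonneg_left hx (inv_pos.2 hA).le
      linarith
    calc f ≤ Real.exp (-(β * t ^ 2)) := by linarith [Real.add_one_le_exp (-(β * t ^ 2))]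
      _ ≤ Real.exp (Real.log (1 + t ^ 2) * -β) := by
          refine Real.exp_le_exp.2 ?_
          have := Real.log_le_sub_one_of_pos (by linarith : 0 < 1 + t ^ 2)
          nlinarith
      _ = _ := (Real.rpow_def_of_pos (by linarith) _).symm
  · have h1 : f ≤ (1 + t ^ 2) ^ (-(1 / 4 : ℝ)) := by
      rw [Real.rpow_neg (by linarith)]
      set s := (1 + t ^ 2) ^ (1 / 4 : ℝ) with hs
      have hs0 : 0 < s := by positivity
      have hs4 : s ^ 4 = 1 + t ^ 2 := by
        rw [hs, ← Real.rpow_natCast, ← Real.rpow_mul (by positivity)]; norm_num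
      rw [← one_div, le_div_iff₀ hs0]
      have hta : 1 ≤ |t| := hT1.trans ht
      have hss : s ^ 2 ≤ 2 * |t| := by
        refine abs_le_of_sq_le_sq' ?_ (by positivity) |>.2
        rw [← pow_mul, hs4, mul_pow, sq_abs]
        nlinarith [sq_abs t]
      have hDs : D * s ≤ 2 * Real.pi * |t| := by
        refine abs_le_of_sq_le_sq' ?_ (by positivity) |>.2
        calc (D * s) ^ 2 = D ^ 2 * s ^ 2 := by ring
          _ ≤ |t| * (2 * |t|) := by gcongr; exact hTD.trans ht
          _ = 2 * |t| ^ 2 := by ring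
          _ ≤ (2 * Real.pi) ^ 2 * |t| ^ 2 := by
              gcongr
              nlinarith [Real.pi_gt_three]
          _ = _ := by ring
      have hpos : 0 < 2 * Real.pi * |t| := by positivity
      have h9 : 2 * Real.pi * |t| * (f * s) ≤ 2 * Real.pi * |t| * 1 := by
        calc 2 * Real.pi * |t| * (f * s) = 2 * Real.pi * |t| * f * s := by ring
          _ ≤ D * s := by gcongr
          _ ≤ _ := by linarith
      exact le_of_mul_le_mul_left h9 hpos
    exact h1.trans (Real.rpow_le_rpow_of_exponent_le ht1 (neg_le_neg (min_le_left _ _)))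

end IsSiteDensity

/-- Second-order Taylor expansion of `exp (i x)` with a remainder valid for all real `x`. -/
theorem norm_cexp_mul_I_sub_le (x : ℝ) :
    ‖Complex.exp (x * Complex.I) - (1 + x * Complex.I - (x : ℂ) ^ 2 / 2)‖ ≤ 4 * |x| ^ 3 := by
  have hx : ‖(x * Complex.I : ℂ)‖ = |x| := by simp
  rcases le_total |x| 1 with h | h
  · have h1 := Complex.norm_exp_sub_sum_le_norm_mul_exp (x * Complex.I) 3
    rw [hx] at h1
    have h2 : ∑ m ∈ Finset.range 3, (x * Complex.I : ℂ) ^ m / (m.factorial : ℂ)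
        = 1 + x * Complex.I - (x : ℂ) ^ 2 / 2 := by
      simp [Finset.sum_range_succ, mul_pow]
      ring
    rw [h2] at h1
    refine h1.trans ?_
    have h3 : Real.exp |x| ≤ 4 := (Real.exp_le_exp.2 h).trans (by
      linarith [Real.exp_one_lt_d9])
    rw [mul_comm]
    gcongr
  · have h1 : ‖(1 + x * Complex.I - (x : ℂ) ^ 2 / 2)‖ ≤ 1 + |x| + |x| ^ 2 / 2 := by
      refine (norm_sub_le _ _).trans ?_
      refine add_le_add ((norm_add_le _ _).trans ?_) ?_
      · simp
      · simp
    refine (norm_sub_le _ _).trans ?_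
    rw [Complex.norm_exp_ofReal_mul_I]
    have h2 : |x| ≤ |x| ^ 3 := le_self_pow₀ h (by norm_num)
    have h3 : |x| ^ 2 ≤ |x| ^ 3 := pow_le_pow_right₀ h (by norm_num)
    linarith

namespace IsSiteDensity

/-- The Fourier transform of a single-site density agrees near the origin with that of the
Gaussian of the same variance, up to an error of third order with a uniform constant. -/
theorem exists_norm_fourier_sub_exp_le (A B : ℝ) (hA : 0 < A) :
    ∃ D : ℝ, 0 < D ∧ ∀ (b : ℝ) (ρ : ℝ → ℝ), IsSiteDensity A B b ρ →
      ∃ s : ℝ, 0 ≤ s ∧ s ≤ D ∧ ∀ t : ℝ,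
        ‖𝓕 (fun z => (ρ z : ℂ)) t - (Real.exp (-(s * t ^ 2)) : ℝ)‖ ≤ D * (|t| ^ 3 + t ^ 4) := by
  set b₀ := A * gaussianAbsMoment 1 with hb₀
  have hb₀' : 0 ≤ b₀ := mul_nonneg hA.le (gaussianAbsMoment_nonneg 1)
  set M2 := 2 * (A * gaussianAbsMoment 2 + b₀ ^ 2) with hM2
  set M3 := 4 * (A * gaussianAbsMoment 3 + b₀ ^ 3) with hM3
  have hM2' : 0 ≤ M2 := by have := gaussianAbsMoment_nonneg 2; positivity
  have hM3' : 0 ≤ M3 := by have := gaussianAbsMoment_nonneg 3; positivity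
  set D := 1 + 2 * Real.pi ^ 2 * M2 + (2 * Real.pi ^ 2 * M2) ^ 2 + 4 * (2 * Real.pi) ^ 3 * M3
    with hD
  refine ⟨D, by positivity, fun b ρ h => ?_⟩
  have hb : |b| ≤ b₀ := h.abs_mean_le hA
  have hc := h.contDiff.continuous
  have hρ := h.pos hA
  have i0 := h.integrable hA
  have i1 := h.integrable_abs_pow hA 1
  have i2 := h.integrable_abs_pow hA 2
  have i3 := h.integrable_abs_pow hA 3
  have d2 : ∀ z, |z| ^ 2 * ρ z ≤ 2 * (|z - b| ^ 2 * ρ z + b₀ ^ 2 * ρ z) := fun z => by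
    have h1 : |z| ^ 2 ≤ 2 * (|z - b| ^ 2 + b₀ ^ 2) := by
      have : b ^ 2 ≤ b₀ ^ 2 := by rw [← sq_abs b]; gcongr
      simp only [sq_abs]
      nlinarith [sq_nonneg (z - b - b)]
    nlinarith [mul_le_mul_of_nonneg_right h1 (hρ z).le]
  have d3 : ∀ z, |z| ^ 3 * ρ z ≤ 4 * (|z - b| ^ 3 * ρ z + b₀ ^ 3 * ρ z) := fun z => by
    have h1 : |z| ^ 3 ≤ 4 * (|z - b| ^ 3 + b₀ ^ 3) := by
      have h2 : |z| ≤ |z - b| + b₀ := by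
        have := abs_add_le (z - b) b
        rw [sub_add_cancel] at this
        linarith
      have h3 : |z| ^ 3 ≤ (|z - b| + b₀) ^ 3 := by gcongr
      have := abs_nonneg (z - b)
      nlinarith [mul_nonneg (add_nonneg this hb₀') (sq_nonneg (|z - b| - b₀))]
    nlinarith [mul_le_mul_of_nonneg_right h1 (hρ z).le]
  have j2' : Integrable fun z => 2 * (|z - b| ^ 2 * ρ z + b₀ ^ 2 * ρ z) :=
    (i2.add (i0.const_mul _)).const_mul 2
  have j3' : Integrable fun z => 4 * (|z - b| ^ 3 * ρ z + b₀ ^ 3 * ρ z) :=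
    (i3.add (i0.const_mul _)).const_mul 4
  have j2 : Integrable fun z => |z| ^ 2 * ρ z :=
    j2'.mono' (Continuous.aestronglyMeasurable (by fun_prop)) (ae_of_all _ fun z => by
      rw [Real.norm_eq_abs, abs_of_nonneg (mul_nonneg (by positivity) (hρ z).le)]; exact d2 z)
  have j3 : Integrable fun z => |z| ^ 3 * ρ z :=
    j3'.mono' (Continuous.aestronglyMeasurable (by fun_prop)) (ae_of_all _ fun z => by
      rw [Real.norm_eq_abs, abs_of_nonneg (mul_nonneg (by positivity) (hρ z).le)]; exact d3 z)
  have j1 : Integrable fun z => z * ρ z := by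
    have : Integrable fun z => |z - b| ^ 1 * ρ z + |b| * ρ z := i1.add (i0.const_mul _)
    refine this.mono' (Continuous.aestronglyMeasurable (by fun_prop)) (ae_of_all _ fun z => ?_)
    rw [norm_mul, Real.norm_eq_abs, Real.norm_eq_abs, abs_of_pos (hρ z), ← add_mul, pow_one]
    refine mul_le_mul_of_nonneg_right ?_ (hρ z).le
    have := abs_add_le (z - b) b
    rwa [sub_add_cancel] at this
  have k2 : ∫ z, |z| ^ 2 * ρ z ≤ M2 := by
    refine (integral_mono j2 j2' d2).trans ?_
    rw [integral_const_mul, integral_add i2 (i0.const_mul _), integral_const_mul,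
      h.integral_eq_one]
    have := h.integral_abs_pow_le hA 2
    linarith
  have k3 : ∫ z, |z| ^ 3 * ρ z ≤ M3 := by
    refine (integral_mono j3 j3' d3).trans ?_
    rw [integral_const_mul, integral_add i3 (i0.const_mul _), integral_const_mul,
      h.integral_eq_one]
    have := h.integral_abs_pow_le hA 3
    linarith
  set v := ∫ z, |z| ^ 2 * ρ z with hv
  have hv0 : 0 ≤ v := integral_nonneg fun z => mul_nonneg (by positivity) (hρ z).le
  have hs0 : 0 ≤ 2 * Real.pi ^ 2 * v := by positivity
  have hsM : 2 * Real.pi ^ 2 * v ≤ 2 * Real.pi ^ 2 * M2 := by gcongr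
  have e1 : 0 ≤ (2 * Real.pi ^ 2 * M2) ^ 2 := by positivity
  have e2 : 0 ≤ 4 * (2 * Real.pi) ^ 3 * M3 := by positivity
  refine ⟨2 * Real.pi ^ 2 * v, hs0, by rw [hD]; linarith, fun t => ?_⟩
  -- second-order Taylor expansion under the integral sign
  have hexp : ‖𝓕 (fun z => (ρ z : ℂ)) t - (1 - 2 * Real.pi ^ 2 * v * t ^ 2 : ℝ)‖
      ≤ 4 * (2 * Real.pi) ^ 3 * M3 * |t| ^ 3 := by
    have hfi : Integrable fun z : ℝ =>
        Complex.exp (((-2 * Real.pi * t * z : ℝ) : ℂ) * Complex.I) * (ρ z : ℂ) := by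
      refine (i0.ofReal (𝕜 := ℂ)).mono (Continuous.aestronglyMeasurable (by fun_prop))
        (ae_of_all _ fun z => ?_)
      rw [norm_mul, Complex.norm_exp_ofReal_mul_I, one_mul]
      rfl
    have a0 : Integrable fun z : ℝ => (ρ z : ℂ) := i0.ofReal
    have a1 : Integrable fun z : ℝ => (((-2 * Real.pi * t : ℝ) : ℂ) * Complex.I) *
      ((z * ρ z : ℝ) : ℂ) := Integrable.const_mul j1.ofReal _
    have a2 : Integrable fun z : ℝ => ((2 * Real.pi ^ 2 * t ^ 2 : ℝ) : ℂ) *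
      ((|z| ^ 2 * ρ z : ℝ) : ℂ) := Integrable.const_mul j2.ofReal _
    have a01 : Integrable fun z : ℝ => (ρ z : ℂ) + (((-2 * Real.pi * t : ℝ) : ℂ) * Complex.I) *
      ((z * ρ z : ℝ) : ℂ) := a0.add a1
    have a3 : (fun z : ℝ => (1 + ((-2 * Real.pi * t * z : ℝ) : ℂ) * Complex.I
        - ((-2 * Real.pi * t * z : ℝ) : ℂ) ^ 2 / 2) * (ρ z : ℂ))
        = fun z => (ρ z : ℂ) + (((-2 * Real.pi * t : ℝ) : ℂ) * Complex.I) * ((z * ρ z : ℝ) : ℂ)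
          - ((2 * Real.pi ^ 2 * t ^ 2 : ℝ) : ℂ) * ((|z| ^ 2 * ρ z : ℝ) : ℂ) := by
      ext z
      simp only [sq_abs]
      push_cast
      ring
    have hti : Integrable fun z : ℝ => (1 + ((-2 * Real.pi * t * z : ℝ) : ℂ) * Complex.I
        - ((-2 * Real.pi * t * z : ℝ) : ℂ) ^ 2 / 2) * (ρ z : ℂ) := by
      rw [a3]
      exact a01.sub a2
    have hti' : (∫ z : ℝ, (1 + ((-2 * Real.pi * t * z : ℝ) : ℂ) * Complex.I
        - ((-2 * Real.pi * t * z : ℝ) : ℂ) ^ 2 / 2) * (ρ z : ℂ))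
          = ((1 - 2 * Real.pi ^ 2 * v * t ^ 2 : ℝ) : ℂ) := by
      rw [a3, integral_sub a01 a2,
        integral_add a0 a1, integral_const_mul, integral_const_mul,
        integral_complex_ofReal, integral_complex_ofReal, integral_complex_ofReal,
        h.integral_eq_one, h.mean_zero, ← hv]
      push_cast
      ring
    have hF : 𝓕 (fun z => (ρ z : ℂ)) t = ∫ z : ℝ,
        Complex.exp (((-2 * Real.pi * t * z : ℝ) : ℂ) * Complex.I) * (ρ z : ℂ) := by
      rw [Real.fourier_real_eq_integral_exp_smul]
      refine integral_congr_ae (ae_of_all _ fun z => ?_)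
      simp only [smul_eq_mul]
      congr 4
      ring
    rw [hF, ← hti', ← integral_sub hfi hti]
    refine (norm_integral_le_integral_norm _).trans ?_
    have hle : ∀ z : ℝ, ‖Complex.exp (((-2 * Real.pi * t * z : ℝ) : ℂ) * Complex.I) * (ρ z : ℂ)
        - (1 + ((-2 * Real.pi * t * z : ℝ) : ℂ) * Complex.I
          - ((-2 * Real.pi * t * z : ℝ) : ℂ) ^ 2 / 2) * (ρ z : ℂ)‖
        ≤ 4 * (2 * Real.pi) ^ 3 * |t| ^ 3 * (|z| ^ 3 * ρ z) := fun z => by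
      rw [← sub_mul, norm_mul, Complex.norm_real, Real.norm_eq_abs, abs_of_pos (hρ z)]
      refine (mul_le_mul_of_nonneg_right (norm_cexp_mul_I_sub_le _) (hρ z).le).trans (le_of_eq ?_)
      simp only [abs_mul, abs_neg, abs_two, abs_of_pos Real.pi_pos]
      ring
    refine (integral_mono (hfi.sub hti).norm (j3.const_mul _) hle).trans ?_
    rw [integral_const_mul]
    calc _ ≤ 4 * (2 * Real.pi) ^ 3 * |t| ^ 3 * M3 := by gcongr
      _ = _ := by ring
  have hgauss : ‖((1 - 2 * Real.pi ^ 2 * v * t ^ 2 : ℝ) : ℂ)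
      - (Real.exp (-(2 * Real.pi ^ 2 * v * t ^ 2)) : ℝ)‖ ≤ (2 * Real.pi ^ 2 * M2) ^ 2 * t ^ 4 := by
    rw [← Complex.ofReal_sub, Complex.norm_real, Real.norm_eq_abs, abs_sub_comm]
    set x := 2 * Real.pi ^ 2 * v * t ^ 2 with hx
    have hx0 : 0 ≤ x := by positivity
    have hl := Real.add_one_le_exp (-x)
    have hu : Real.exp (-x) ≤ 1 - x + x ^ 2 := by
      rw [Real.exp_neg]
      have hp : 0 < 1 - x + x ^ 2 := by nlinarith [sq_nonneg (x - 1)]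
      refine inv_le_of_inv_le₀ hp (le_trans ?_ (Real.add_one_le_exp x))
      rw [inv_le_iff_one_le_mul₀ hp]
      nlinarith [pow_nonneg hx0 3]
    rw [abs_of_nonneg (by linarith)]
    calc _ ≤ x ^ 2 := by linarith
      _ = (2 * Real.pi ^ 2 * v) ^ 2 * t ^ 4 := by rw [hx]; ring
      _ ≤ _ := by gcongr
  calc _ ≤ 4 * (2 * Real.pi) ^ 3 * M3 * |t| ^ 3 + (2 * Real.pi ^ 2 * M2) ^ 2 * t ^ 4 :=
        (norm_sub_le_norm_sub_add_norm_sub _ _ _).trans (add_le_add hexp hgauss)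
    _ ≤ D * |t| ^ 3 + D * t ^ 4 := by
        have hp : 0 ≤ 2 * Real.pi ^ 2 * M2 := by positivity
        gcongr
        · rw [hD]; linarith
        · rw [hD]; linarith
    _ = _ := by ring

end IsSiteDensity

/-! ### Tilted single-site measures -/

/-- A bound on a function and on its second derivative bounds its first derivative. -/
theorem abs_deriv_le_of_abs_le_of_abs_iteratedDeriv_two_le {f : ℝ → ℝ} {C : ℝ}
    (hf : ContDiff ℝ 2 f) (h0 : ∀ z, |f z| ≤ C) (h2 : ∀ z, |iteratedDeriv 2 f z| ≤ C) (z : ℝ) :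
    |deriv f z| ≤ 3 * C := by
  have hd : Differentiable ℝ f := hf.differentiable two_ne_zero
  have hd' : Differentiable ℝ (deriv f) := by
    simpa using hf.differentiable_iteratedDeriv 1 (by norm_num)
  obtain ⟨c, hc, hfc⟩ := exists_deriv_eq_slope f (lt_add_one z) hd.continuous.continuousOn
    hd.differentiableOn
  have h3 : |deriv f z - deriv f c| ≤ C * |z - c| := by
    have := Convex.norm_image_sub_le_of_norm_deriv_le (f := deriv f) (s := univ) (x := c) (y := z)
      (fun x _ => hd' x) (C := C) (fun x _ => by
        have := h2 x
        rw [iteratedDeriv_succ, iteratedDeriv_one] at this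
        exact this) convex_univ (mem_univ _) (mem_univ _)
    simpa using this
  have hC : 0 ≤ C := (abs_nonneg _).trans (h0 0)
  have h4 : |z - c| ≤ 1 := by rw [abs_le]; constructor <;> linarith [hc.1, hc.2]
  have h5 : |deriv f c| ≤ 2 * C := by
    rw [hfc, add_sub_cancel_left, div_one]
    linarith [abs_sub (f (z + 1)) (f z), h0 (z + 1), h0 z]
  have h6 := abs_add_le (deriv f z - deriv f c) (deriv f c)
  rw [sub_add_cancel] at h6
  nlinarith

/-- The single-site Gibbs weight with external field `s`. -/
noncomputable def siteWeight (a : ℝ) (δψ : ℝ → ℝ) (s z : ℝ) : ℝ :=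
  Real.exp (-singleSite a δψ z + s * z)

/-- The single-site partition function as a function of the external field. -/
noncomputable def sitePartition (a : ℝ) (δψ : ℝ → ℝ) (s : ℝ) : ℝ := ∫ z, siteWeight a δψ s z

/-- The mean of the single-site measure with external field `s`. -/
noncomputable def siteMean (a : ℝ) (δψ : ℝ → ℝ) (s : ℝ) : ℝ :=
  (∫ z, z * siteWeight a δψ s z) / sitePartition a δψ s

/-- The single-site probability density with external field `s`, recentred at its mean. -/
noncomputable def siteDensity (a : ℝ) (δψ : ℝ → ℝ) (s z : ℝ) : ℝ :=
  siteWeight a δψ s (z + siteMean a δψ s) / sitePartition a δψ s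

section Site

variable {a C B : ℝ} {δψ : ℝ → ℝ}

theorem siteWeight_pos (a : ℝ) (δψ : ℝ → ℝ) (s z : ℝ) : 0 < siteWeight a δψ s z := Real.exp_pos _

theorem siteWeight_eq (a : ℝ) (δψ : ℝ → ℝ) (s z : ℝ) :
    siteWeight a δψ s z = √(2 * Real.pi) * Real.exp ((s - a) ^ 2 / 2) *
      (Real.exp (-δψ z) * gaussianPDFReal (s - a) 1 z) := by
  have h : √(2 * Real.pi) ≠ 0 := by positivity
  have h2 : siteWeight a δψ s z = Real.exp ((s - a) ^ 2 / 2) *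
      (Real.exp (-δψ z) * Real.exp (-(z - (s - a)) ^ 2 / 2)) := by
    rw [← Real.exp_add, ← Real.exp_add, siteWeight, singleSite]
    congr 1
    ring
  rw [h2, gaussianPDFReal]
  simp only [NNReal.coe_one, mul_one]
  field_simp

theorem siteWeight_le (hb : ∀ z, |δψ z| ≤ C) (s z : ℝ) :
    siteWeight a δψ s z ≤ √(2 * Real.pi) * Real.exp ((s - a) ^ 2 / 2) *
      (Real.exp C * gaussianPDFReal (s - a) 1 z) := by
  rw [siteWeight_eq]
  have := gaussianPDFReal_nonneg (s - a) 1 z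
  gcongr
  linarith [abs_le.1 (hb z)]

theorem le_siteWeight (hb : ∀ z, |δψ z| ≤ C) (s z : ℝ) :
    √(2 * Real.pi) * Real.exp ((s - a) ^ 2 / 2) *
      (Real.exp (-C) * gaussianPDFReal (s - a) 1 z) ≤ siteWeight a δψ s z := by
  rw [siteWeight_eq]
  have := gaussianPDFReal_nonneg (s - a) 1 z
  gcongr
  linarith [abs_le.1 (hb z)]

theorem continuous_siteWeight (hc : Continuous δψ) (s : ℝ) : Continuous (siteWeight a δψ s) := by
  unfold siteWeight singleSite
  fun_prop

theorem integrable_siteWeight (hc : Continuous δψ) (hb : ∀ z, |δψ z| ≤ C) (s : ℝ) :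
    Integrable (siteWeight a δψ s) :=
  (((integrable_gaussianPDFReal (s - a) 1).const_mul _).const_mul _).mono'
    (continuous_siteWeight hc s).aestronglyMeasurable (ae_of_all _ fun z => by
      rw [Real.norm_eq_abs, abs_of_pos (siteWeight_pos _ _ _ _)]
      exact siteWeight_le hb s z)

theorem sitePartition_le (hc : Continuous δψ) (hb : ∀ z, |δψ z| ≤ C) (s : ℝ) :
    sitePartition a δψ s ≤ √(2 * Real.pi) * Real.exp ((s - a) ^ 2 / 2) * Real.exp C := by
  have h := integral_mono (integrable_siteWeight (a := a) hc hb s)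
    (((integrable_gaussianPDFReal (s - a) 1).const_mul _).const_mul _) (siteWeight_le hb s)
  simpa [sitePartition, integral_const_mul, integral_gaussianPDFReal_eq_one] using h

theorem le_sitePartition (hc : Continuous δψ) (hb : ∀ z, |δψ z| ≤ C) (s : ℝ) :
    √(2 * Real.pi) * Real.exp ((s - a) ^ 2 / 2) * Real.exp (-C) ≤ sitePartition a δψ s := by
  have h := integral_mono (((integrable_gaussianPDFReal (s - a) 1).const_mul _).const_mul _)
    (integrable_siteWeight (a := a) hc hb s) (le_siteWeight hb s)
  simpa [sitePartition, integral_const_mul, integral_gaussianPDFReal_eq_one] using h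

theorem sitePartition_pos (hc : Continuous δψ) (hb : ∀ z, |δψ z| ≤ C) (s : ℝ) :
    0 < sitePartition a δψ s :=
  lt_of_lt_of_le (by positivity) (le_sitePartition hc hb s)

theorem hasDerivAt_sitePartition (hc : Continuous δψ) (hb : ∀ z, |δψ z| ≤ C) (s : ℝ) :
    HasDerivAt (sitePartition a δψ) (∫ z, z * siteWeight a δψ s z) s := by
  set μ : Measure ℝ := volume.withDensity fun z => ENNReal.ofReal (Real.exp (-singleSite a δψ z))
    with hμ
  have hmeas : Measurable fun z => ENNReal.ofReal (Real.exp (-singleSite a δψ z)) := by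
    have : Continuous fun z => Real.exp (-singleSite a δψ z) := by unfold singleSite; fun_prop
    exact this.measurable.ennreal_ofReal
  have hint : ∀ f : ℝ → ℝ, ∫ z, f z ∂μ = ∫ z, f z * Real.exp (-singleSite a δψ z) := fun f => by
    rw [hμ, integral_withDensity_eq_integral_toReal_smul hmeas
      (ae_of_all _ fun z => ENNReal.ofReal_lt_top)]
    simp [ENNReal.toReal_ofReal (Real.exp_pos _).le, mul_comm]
  have hw : ∀ s z, Real.exp (s * z) * Real.exp (-singleSite a δψ z) = siteWeight a δψ s z :=
    fun s z => by rw [siteWeight, ← Real.exp_add, add_comm]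
  have hset : integrableExpSet id μ = univ := by
    refine eq_univ_of_forall fun t => ?_
    change Integrable (fun z => Real.exp (t * id z)) μ
    rw [hμ, integrable_withDensity_iff hmeas (ae_of_all _ fun z => ENNReal.ofReal_lt_top)]
    simp only [ENNReal.toReal_ofReal (Real.exp_pos _).le, id, hw]
    exact integrable_siteWeight hc hb t
  have h := hasDerivAt_mgf (X := id) (μ := μ) (t := s) (by rw [hset, interior_univ]; trivial)
  have h1 : mgf id μ = sitePartition a δψ := by
    ext t
    rw [mgf, hint, sitePartition]
    simp only [id, hw]
  rw [h1, hint] at h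
  simpa only [id, mul_assoc, hw] using h

theorem hasDerivAt_log_sitePartition (hc : Continuous δψ) (hb : ∀ z, |δψ z| ≤ C) (s : ℝ) :
    HasDerivAt (fun s => Real.log (sitePartition a δψ s)) (siteMean a δψ s) s :=
  (hasDerivAt_sitePartition hc hb s).log (sitePartition_pos hc hb s).ne'

theorem isSiteDensity_siteDensity (hc : ContDiff ℝ 1 δψ) (hb : ∀ z, |δψ z| ≤ C)
    (hd : ∀ z, |deriv δψ z| ≤ B) (s : ℝ) :
    IsSiteDensity (Real.exp (2 * C)) B (s - a - siteMean a δψ s) (siteDensity a δψ s) := by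
  have hcc := hc.continuous
  have hZ := sitePartition_pos (a := a) hcc hb s
  have hZl := le_sitePartition (a := a) hcc hb s
  have hZu := sitePartition_le (a := a) hcc hb s
  set m := siteMean a δψ s with hm
  set Z := sitePartition a δψ s with hZdef
  set q := √(2 * Real.pi) * Real.exp ((s - a) ^ 2 / 2) with hq
  have hq0 : 0 < q := by positivity
  have hγ : ∀ z, gaussianPDFReal (s - a) 1 (z + m) = gaussianPDFReal (s - a - m) 1 z := fun z => by
    simp only [gaussianPDFReal]
    congr 3
    ring
  have hγ0 := fun z => gaussianPDFReal_nonneg (s - a - m) 1 z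
  have hw := integrable_siteWeight (a := a) hcc hb s
  have hder : ∀ z, HasDerivAt (siteDensity a δψ s)
      ((-(z - (s - a - m)) - deriv δψ (z + m)) * siteDensity a δψ s z) z := fun z => by
    have h1 : HasDerivAt (fun z => z + m) 1 z := (hasDerivAt_id z).add_const m
    have h2 : HasDerivAt δψ (deriv δψ (z + m)) (z + m) :=
      (hc.differentiable one_ne_zero _).hasDerivAt
    have h3 : HasDerivAt (fun z => -singleSite a δψ z + s * z)
        (-((z + m) + a + deriv δψ (z + m)) + s) (z + m) := by
      have h4 : HasDerivAt (singleSite a δψ) ((z + m) + a + deriv δψ (z + m)) (z + m) := by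
        unfold singleSite
        convert! (((hasDerivAt_pow 2 (z + m)).div_const 2).add
          ((hasDerivAt_id (z + m)).const_mul a)).add h2 using 1
        simp
      convert! h4.neg.add ((hasDerivAt_id (z + m)).const_mul s) using 1
      simp
    convert! ((h3.exp.comp z h1).div_const Z) using 1
    rw [siteDensity, siteWeight, ← hm, ← hZdef]
    ring
  refine ⟨?_, fun z => ?_, fun z => ?_, fun z => ?_, ?_, ?_⟩
  · unfold siteDensity siteWeight singleSite
    fun_prop
  · rw [siteDensity, ← hm, ← hZdef, le_div_iff₀ hZ]
    refine le_trans ?_ (le_siteWeight hb s (z + m))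
    rw [hγ, ← Real.exp_neg]
    calc Real.exp (-(2 * C)) * gaussianPDFReal (s - a - m) 1 z * Z
        ≤ Real.exp (-(2 * C)) * gaussianPDFReal (s - a - m) 1 z * (q * Real.exp C) := by
          have := hγ0 z
          gcongr
      _ = q * ((Real.exp (-(2 * C)) * Real.exp C) * gaussianPDFReal (s - a - m) 1 z) := by ring
      _ = _ := by rw [← Real.exp_add]; congr 4; ring
  · rw [siteDensity, ← hm, ← hZdef, div_le_iff₀ hZ]
    refine (siteWeight_le hb s (z + m)).trans ?_
    rw [hγ]
    calc _ = q * ((Real.exp (2 * C) * Real.exp (-C)) * gaussianPDFReal (s - a - m) 1 z) := by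
          rw [← Real.exp_add]; congr 4; ring
      _ = Real.exp (2 * C) * gaussianPDFReal (s - a - m) 1 z * (q * Real.exp (-C)) := by ring
      _ ≤ _ := by
          have := hγ0 z
          gcongr
  · have hpos : 0 < siteDensity a δψ s z := div_pos (siteWeight_pos _ _ _ _) hZ
    rw [(hder z).deriv, abs_mul, abs_of_pos hpos]
    refine mul_le_mul_of_nonneg_right ?_ hpos.le
    refine (abs_sub _ _).trans ?_
    rw [abs_neg]
    exact add_le_add_right (hd _) _
  · simp only [siteDensity, ← hm, ← hZdef]
    rw [integral_div, integral_add_right_eq_self (fun z => siteWeight a δψ s z)]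
    exact div_self hZ.ne'
  · have hzw : Integrable fun z => z * siteWeight a δψ s z := by
      have h1 := (integrable_abs_pow_mul_gaussianPDFReal 1 (s - a)).add
        ((integrable_gaussianPDFReal (s - a) 1).const_mul |s - a|)
      refine (h1.const_mul (q * Real.exp C)).mono' (Continuous.aestronglyMeasurable
        (continuous_id.mul (continuous_siteWeight hcc s))) (ae_of_all _ fun z => ?_)
      rw [norm_mul, Real.norm_eq_abs, Real.norm_eq_abs, abs_of_pos (siteWeight_pos _ _ _ _)]
      have h2 := abs_add_le (z - (s - a)) (s - a)
      rw [sub_add_cancel] at h2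
      calc |z| * siteWeight a δψ s z ≤ (|z - (s - a)| + |s - a|) *
            (q * (Real.exp C * gaussianPDFReal (s - a) 1 z)) :=
            mul_le_mul h2 (siteWeight_le hb s z) (siteWeight_pos _ _ _ _).le (by positivity)
        _ = _ := by simp only [Pi.add_apply, pow_one]; ring
    have h1 : ∀ z, z * siteDensity a δψ s z
        = (fun z => (z * siteWeight a δψ s z - m * siteWeight a δψ s z) / Z) (z + m) := fun z => by
      simp only [siteDensity, ← hm, ← hZdef]
      ring
    simp_rw [h1]
    rw [integral_add_right_eq_self
      (fun z => (z * siteWeight a δψ s z - m * siteWeight a δψ s z) / Z) m, integral_div,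
      integral_sub hzw (hw.const_mul m), integral_const_mul]
    have h2 : ∫ z, siteWeight a δψ s z = Z := rfl
    have h3 : ∫ z, z * siteWeight a δψ s z = m * Z := by
      rw [hm, siteMean, ← hZdef, div_mul_cancel₀ _ hZ.ne']
    rw [h2, h3, sub_self, zero_div]

variable {ι V : Type*} [Fintype ι] [NormedAddCommGroup V] [InnerProductSpace ℝ V]
  [FiniteDimensional ℝ V]

/-- Every vector is the mean of `∑ k, x k • v k` under a suitable product of tilted single-site
measures: the field is a minimiser of the coercive function
`σ ↦ ∑ k, log Z ⟪v k, σ⟫ - ⟪u, σ⟫`. -/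
theorem exists_sum_siteMean_smul_eq (hc : Continuous δψ) (hb : ∀ z, |δψ z| ≤ C) {v : ι → V}
    {c₀ : ℝ} (hc₀ : 0 < c₀) (hv : ∀ ξ, c₀ * ‖ξ‖ ^ 2 ≤ ∑ k, inner ℝ (v k) ξ ^ 2) (u : V) :
    ∃ σ : V, ∑ k, siteMean a δψ (inner ℝ (v k) σ) • v k = u := by
  set J : V → ℝ := fun σ => ∑ k, Real.log (sitePartition a δψ (inner ℝ (v k) σ)) - inner ℝ u σ
    with hJ
  have hder : ∀ σ, HasFDerivAt J
      (∑ k, siteMean a δψ (inner ℝ (v k) σ) • innerSL ℝ (v k) - innerSL ℝ u) σ := fun σ => by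
    refine HasFDerivAt.sub (HasFDerivAt.fun_sum fun k _ => ?_) (innerSL ℝ u).hasFDerivAt
    exact (hasDerivAt_log_sitePartition hc hb _).comp_hasFDerivAt σ (innerSL ℝ (v k)).hasFDerivAt
  have hcont : Continuous J := continuous_iff_continuousAt.2 fun σ => (hder σ).continuousAt
  have hlog : ∀ s, s ^ 2 / 4 - (a ^ 2 / 2 + C) ≤ Real.log (sitePartition a δψ s) := fun s => by
    have h1 : Real.exp ((s - a) ^ 2 / 2 - C) ≤ sitePartition a δψ s := by
      refine le_trans ?_ (le_sitePartition hc hb s)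
      rw [sub_eq_add_neg, Real.exp_add]
      have h2 : 1 ≤ √(2 * Real.pi) := Real.one_le_sqrt.2 (by linarith [Real.pi_gt_three])
      have : 0 < Real.exp ((s - a) ^ 2 / 2) * Real.exp (-C) := by positivity
      nlinarith
    have h3 := Real.log_le_log (Real.exp_pos _) h1
    rw [Real.log_exp] at h3
    nlinarith [sq_nonneg (s - 2 * a)]
  have hlow : ∀ σ, ‖σ‖ * (c₀ / 4 * ‖σ‖ - ‖u‖) + -(Fintype.card ι * (a ^ 2 / 2 + C)) ≤ J σ :=
    fun σ => by
    have h1 : ∑ k, (inner ℝ (v k) σ ^ 2 / 4 - (a ^ 2 / 2 + C))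
        ≤ ∑ k, Real.log (sitePartition a δψ (inner ℝ (v k) σ)) :=
      Finset.sum_le_sum fun k _ => hlog _
    rw [Finset.sum_sub_distrib, ← Finset.sum_div, Finset.sum_const, Finset.card_univ,
      nsmul_eq_mul] at h1
    have h2 := real_inner_le_norm u σ
    have h3 := hv σ
    simp only [hJ]
    nlinarith
  have hlim : Filter.Tendsto J (Filter.cocompact V) Filter.atTop := by
    refine Filter.tendsto_atTop_mono hlow ?_
    have hn := tendsto_norm_cocompact_atTop (E := V)
    refine Filter.tendsto_atTop_add_const_right _ _ (hn.atTop_mul_atTop₀ ?_)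
    simp_rw [sub_eq_add_neg]
    exact Filter.tendsto_atTop_add_const_right _ _ (hn.const_mul_atTop (by positivity))
  obtain ⟨σ, hσ⟩ := hcont.exists_forall_le hlim
  refine ⟨σ, ?_⟩
  have hz := IsLocalMin.hasFDerivAt_eq_zero (Filter.Eventually.of_forall hσ) (hder σ)
  refine ext_inner_right ℝ fun w => ?_
  have hw := congrArg (fun f => f w) hz
  simp only [sub_apply, sum_apply, smul_apply,
    innerSL_apply_apply, zero_apply, smul_eq_mul] at hw
  rw [sum_inner]
  simp only [inner_smul_left, conj_trivial]
  linarith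

end Site

/-! ### Products of Fourier transforms over many sites -/

section Product

theorem norm_prod_sub_prod_le_sum {ι : Type*} (s : Finset ι) {f g : ι → ℂ}
    (hf : ∀ i ∈ s, ‖f i‖ ≤ 1) (hg : ∀ i ∈ s, ‖g i‖ ≤ 1) :
    ‖∏ i ∈ s, f i - ∏ i ∈ s, g i‖ ≤ ∑ i ∈ s, ‖f i - g i‖ := by
  classical
  induction s using Finset.induction_on with
  | empty => simp
  | insert i s hi ih =>
    rw [Finset.prod_insert hi, Finset.prod_insert hi, Finset.sum_insert hi]
    have ih' := ih (fun j hj => hf j (Finset.mem_insert_of_mem hj))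
      fun j hj => hg j (Finset.mem_insert_of_mem hj)
    have h1 : ‖∏ j ∈ s, f j‖ ≤ 1 := by
      rw [norm_prod]
      exact Finset.prod_le_one (fun _ _ => norm_nonneg _)
        fun j hj => hf j (Finset.mem_insert_of_mem hj)
    have h2 := hg i (Finset.mem_insert_self i s)
    calc _ = ‖(f i - g i) * ∏ j ∈ s, f j + g i * (∏ j ∈ s, f j - ∏ j ∈ s, g j)‖ := by
          congr 1; ring
      _ ≤ ‖f i - g i‖ * 1 + 1 * ∑ j ∈ s, ‖f j - g j‖ := by
          refine (norm_add_le _ _).trans ?_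
          rw [norm_mul, norm_mul]
          gcongr
      _ = _ := by ring

variable {ι V : Type*} [Fintype ι] [NormedAddCommGroup V] [InnerProductSpace ℝ V]

/-- The product of algebraically decaying functions of many linear forms of comparable size decays
like `(1 + x / K) ^ (-b K)`, hence faster than any fixed power. -/
theorem prod_one_add_inner_sq_rpow_le {v : ι → V} {W c₀ β : ℝ} (hW : 0 < W) (hc₀ : 0 < c₀)
    (hβ : 0 < β) {K : ℝ} (hK : 0 < K) (hvW : ∀ k, ‖v k‖ ^ 2 ≤ W ^ 2 / K)
    (hv : ∀ ξ, c₀ * ‖ξ‖ ^ 2 ≤ ∑ k, inner ℝ (v k) ξ ^ 2) (ξ : V) :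
    ∏ k, (1 + inner ℝ (v k) ξ ^ 2) ^ (-β)
      ≤ (1 + W ^ 2 * ‖ξ‖ ^ 2 / K) ^ (-(β * c₀ / W ^ 2 * K)) := by
  rcases eq_or_ne ξ 0 with rfl | hξ
  · simp
  set S := W ^ 2 * ‖ξ‖ ^ 2 / K with hS
  have hξ' : 0 < ‖ξ‖ := norm_pos_iff.2 hξ
  have hS0 : 0 < S := by positivity
  have htS : ∀ k, inner ℝ (v k) ξ ^ 2 ≤ S := fun k => by
    have h1 : inner ℝ (v k) ξ ^ 2 ≤ (‖v k‖ * ‖ξ‖) ^ 2 := by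
      rw [← sq_abs]
      gcongr
      exact abs_real_inner_le_norm _ _
    calc _ ≤ ‖v k‖ ^ 2 * ‖ξ‖ ^ 2 := by rw [← mul_pow]; exact h1
      _ ≤ W ^ 2 / K * ‖ξ‖ ^ 2 := by gcongr; exact hvW k
      _ = S := by rw [hS]; ring
  have h1 : ∀ k, (1 + inner ℝ (v k) ξ ^ 2) ^ (-β)
      ≤ (1 + S) ^ (inner ℝ (v k) ξ ^ 2 * (-β / S)) := fun k => by
    -- concavity: `(1 + S) ^ p ≤ 1 + p S` for `p = t ^ 2 / S ∈ [0, 1]`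
    have h2 := rpow_one_add_le_one_add_mul_self (s := S) (by linarith)
      (p := inner ℝ (v k) ξ ^ 2 / S) (by positivity) ((div_le_one hS0).2 (htS k))
    rw [div_mul_cancel₀ _ hS0.ne'] at h2
    calc _ ≤ ((1 + S) ^ (inner ℝ (v k) ξ ^ 2 / S)) ^ (-β) :=
          Real.rpow_le_rpow_of_nonpos (by positivity) h2 (by linarith)
      _ = _ := by rw [← Real.rpow_mul (by positivity)]; congr 1; ring
  calc _ ≤ ∏ k, (1 + S) ^ (inner ℝ (v k) ξ ^ 2 * (-β / S)) :=
        Finset.prod_le_prod (fun _ _ => by positivity) fun k _ => h1 k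
    _ = (1 + S) ^ ((∑ k, inner ℝ (v k) ξ ^ 2) * (-β / S)) := by
        rw [Finset.sum_mul, ← Real.rpow_sum_of_pos (by positivity)]
    _ ≤ _ := by
        refine Real.rpow_le_rpow_of_exponent_le (by linarith) ?_
        have h3 : (∑ k, inner ℝ (v k) ξ ^ 2) * (-β / S) ≤ (c₀ * ‖ξ‖ ^ 2) * (-β / S) :=
          mul_le_mul_of_nonpos_right (hv ξ)
            (div_nonpos_of_nonpos_of_nonneg (by linarith) hS0.le)
        refine h3.trans (le_of_eq ?_)
        rw [hS]
        field_simp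

theorem one_add_div_rpow_le {x b K₀ K : ℝ} (hx : 0 ≤ x) (hb : 0 ≤ b) (hK₀ : 0 < K₀)
    (hK : K₀ ≤ K) : (1 + x / K) ^ (-(b * K)) ≤ (1 + x / K₀) ^ (-(b * K₀)) := by
  have hK0 : 0 < K := hK₀.trans_le hK
  have h1 := one_add_mul_self_le_rpow_one_add (s := x / K) (by
    have : 0 ≤ x / K := by positivity
    linarith) (p := K / K₀) ((one_le_div hK₀).2 hK)
  have h2 : K / K₀ * (x / K) = x / K₀ := by field_simp
  rw [h2] at h1
  have h3 := Real.rpow_le_rpow_of_nonpos (by positivity) h1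
    (z := -(b * K₀)) (by have := mul_nonneg hb hK₀.le; linarith)
  rw [← Real.rpow_mul (by positivity)] at h3
  have h4 : K / K₀ * -(b * K₀) = -(b * K) := by field_simp
  rwa [h4] at h3

/-- Hypotheses on the Fourier transforms of the site densities: uniform algebraic decay, and
agreement with a Gaussian to third order at the origin. -/
structure IsSiteTransform (β D : ℝ) (χ : ℝ → ℂ) : Prop where
  continuous : Continuous χ
  norm_le : ∀ t, ‖χ t‖ ≤ (1 + t ^ 2) ^ (-β)
  norm_sub_le : ∃ s : ℝ, 0 ≤ s ∧ s ≤ D ∧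
    ∀ t : ℝ, ‖χ t - (Real.exp (-(s * t ^ 2)) : ℝ)‖ ≤ D * (|t| ^ 3 + t ^ 4)

/-- A family of `K` vectors is a frame with bounds `c₀` and `W` if each has length at most
`W / √K` and their quadratic form is bounded below by `c₀`. -/
structure IsUniformFrame (W c₀ : ℝ) {K : ℕ} (v : Fin K → V) : Prop where
  norm_le : ∀ k, ‖v k‖ ^ 2 ≤ W ^ 2 / K
  le_sum : ∀ ξ, c₀ * ‖ξ‖ ^ 2 ≤ ∑ k, inner ℝ (v k) ξ ^ 2

/-- Comparison of the product of transforms with a Gaussian: each factor has an argument of size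
`‖ξ‖ / √K`, so that the `K` errors of third order add up to `O(1 / √K)`. -/
theorem exp_sub_le_re_prod {β D W c₀ : ℝ} (hβ : 0 < β) {K : ℕ} (hK : 0 < K)
    (hW : 0 < W)
    {v : Fin K → V} (hv : IsUniformFrame W c₀ v) {χ : Fin K → ℝ → ℂ}
    (hχ : ∀ k, IsSiteTransform β D (χ k)) (ξ : V) :
    Real.exp (-(D * W ^ 2 * ‖ξ‖ ^ 2)) - D * (W ^ 3 * ‖ξ‖ ^ 3 + W ^ 4 * ‖ξ‖ ^ 4) / √K
      ≤ (∏ k, χ k (inner ℝ (v k) ξ)).re := by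
  choose s hs0 hsD hs using fun k => (hχ k).norm_sub_le
  have hKr : (1 : ℝ) ≤ K := by exact_mod_cast hK
  have hD : 0 ≤ D := (hs0 ⟨0, hK⟩).trans (hsD ⟨0, hK⟩)
  have hsq : √(K : ℝ) ^ 2 = K := Real.sq_sqrt (by linarith)
  have hsq1 : 1 ≤ √(K : ℝ) := Real.one_le_sqrt.2 hKr
  set τ := W * ‖ξ‖ / √K with hτ
  have hτ0 : 0 ≤ τ := by positivity
  have ht : ∀ k, |inner ℝ (v k) ξ| ≤ τ := fun k => by
    refine (abs_real_inner_le_norm _ _).trans ?_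
    have h1 : ‖v k‖ ≤ W / √K := by
      refine abs_le_of_sq_le_sq' ?_ (by positivity) |>.2
      rw [div_pow, hsq]
      exact hv.norm_le k
    calc _ ≤ W / √K * ‖ξ‖ := by gcongr
      _ = τ := by rw [hτ]; ring
  set g : Fin K → ℂ := fun k => (Real.exp (-(s k * inner ℝ (v k) ξ ^ 2)) : ℝ) with hg
  have hg1 : ∀ k, ‖g k‖ ≤ 1 := fun k => by
    rw [hg, Complex.norm_real, Real.norm_eq_abs, Real.abs_exp, Real.exp_le_one_iff]
    have := mul_nonneg (hs0 k) (sq_nonneg (inner ℝ (v k) ξ))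
    linarith
  have hχ1 : ∀ k, ‖χ k (inner ℝ (v k) ξ)‖ ≤ 1 := fun k =>
    ((hχ k).norm_le _).trans (Real.rpow_le_one_of_one_le_of_nonpos
      (by nlinarith [sq_nonneg (inner ℝ (v k) ξ)]) (by linarith))
  have herr : ‖∏ k, χ k (inner ℝ (v k) ξ) - ∏ k, g k‖
      ≤ D * (W ^ 3 * ‖ξ‖ ^ 3 + W ^ 4 * ‖ξ‖ ^ 4) / √K := by
    refine (norm_prod_sub_prod_le_sum _ (fun k _ => hχ1 k) fun k _ => hg1 k).trans ?_
    calc _ ≤ ∑ _k : Fin K, D * (τ ^ 3 + τ ^ 4) := by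
          refine Finset.sum_le_sum fun k _ => (hs k _).trans ?_
          have h4 : inner ℝ (v k) ξ ^ 4 ≤ τ ^ 4 := by
            rw [← Even.pow_abs (by decide : Even 4)]
            gcongr
            exact ht k
          have h3 : |inner ℝ (v k) ξ| ^ 3 ≤ τ ^ 3 := by gcongr; exact ht k
          gcongr
      _ = K * (D * (τ ^ 3 + τ ^ 4)) := by simp
      _ = D * (W ^ 3 * ‖ξ‖ ^ 3 / √K + W ^ 4 * ‖ξ‖ ^ 4 / (√K * √K)) := by
          rw [hτ]
          nth_rewrite 1 [← hsq]
          field_simp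
      _ ≤ D * (W ^ 3 * ‖ξ‖ ^ 3 / √K + W ^ 4 * ‖ξ‖ ^ 4 / √K) := by
          gcongr
          nlinarith
      _ = _ := by ring
  have hprod : ∏ k, g k = ((Real.exp (-∑ k, s k * inner ℝ (v k) ξ ^ 2) : ℝ) : ℂ) := by
    rw [hg, ← Complex.ofReal_prod, ← Real.exp_sum, Finset.sum_neg_distrib]
  have hsum : ∑ k, s k * inner ℝ (v k) ξ ^ 2 ≤ D * W ^ 2 * ‖ξ‖ ^ 2 := by
    calc _ ≤ ∑ _k : Fin K, D * τ ^ 2 := by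
          refine Finset.sum_le_sum fun k _ => mul_le_mul (hsD k) ?_ (sq_nonneg _) hD
          rw [← sq_abs]
          gcongr
          exact ht k
      _ = K * (D * τ ^ 2) := by simp
      _ = _ := by rw [hτ, div_pow, hsq]; field_simp
  have h5 := (Complex.abs_re_le_norm (∏ k, χ k (inner ℝ (v k) ξ) - ∏ k, g k)).trans herr
  rw [Complex.sub_re, hprod, Complex.ofReal_re] at h5
  have h6 := Real.exp_le_exp.2 (neg_le_neg hsum)
  linarith [(abs_le.1 h5).1]

variable [FiniteDimensional ℝ V] [MeasurableSpace V] [BorelSpace V]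

/-- A dominating function for all sufficiently long products, integrable against
`1 + ‖ξ‖ ^ 2`. -/
theorem exists_dominating (V : Type*) [NormedAddCommGroup V] [InnerProductSpace ℝ V]
    [FiniteDimensional ℝ V] [MeasurableSpace V] [BorelSpace V]
    {β D W c₀ : ℝ} (hβ : 0 < β) (hW : 0 < W) (hc₀ : 0 < c₀) :
    ∃ (K₀ : ℕ) (G : V → ℝ), 0 < K₀ ∧ Continuous G ∧ (∀ ξ, 0 ≤ G ξ) ∧
      Integrable (fun ξ => (1 + ‖ξ‖ ^ 2) * G ξ) ∧
      ∀ K : ℕ, K₀ ≤ K → ∀ v : Fin K → V, IsUniformFrame W c₀ v → ∀ χ : Fin K → ℝ → ℂ,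
        (∀ k, IsSiteTransform β D (χ k)) → ∀ ξ, ‖∏ k, χ k (inner ℝ (v k) ξ)‖ ≤ G ξ := by
  set b := β * c₀ / W ^ 2 with hb
  have hb0 : 0 < b := by positivity
  set d : ℝ := (Module.finrank ℝ V : ℝ) with hd
  have hd0 : 0 ≤ d := by positivity
  obtain ⟨K₀, hK₀⟩ := exists_nat_gt ((d + 3) / (2 * b))
  have hK₀0 : (0 : ℝ) < K₀ := lt_trans (by positivity) hK₀
  have hK₀d : d + 3 < 2 * b * K₀ := by
    rw [div_lt_iff₀ (by positivity)] at hK₀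
    linarith
  set η := min 1 (W ^ 2 / K₀) with hη
  have hη0 : 0 < η := by positivity
  refine ⟨K₀, fun ξ => η ^ (-(b * K₀)) * (1 + ‖ξ‖ ^ 2) ^ (-(b * K₀)), by exact_mod_cast hK₀0,
    ?_, fun ξ => by positivity, ?_, fun K hK v hv χ hχ ξ => ?_⟩
  · refine continuous_const.mul (Continuous.rpow_const (by fun_prop) fun ξ => Or.inl ?_)
    positivity
  · have h1 := (integrable_rpow_neg_one_add_norm_sq (E := V) (μ := volume)
      (r := 2 * b * K₀ - 2) (by rw [← hd]; linarith)).const_mul (η ^ (-(b * K₀)))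
    refine h1.congr (ae_of_all _ fun ξ => ?_)
    have hp : 0 < 1 + ‖ξ‖ ^ 2 := by positivity
    have h2 : (1 + ‖ξ‖ ^ 2) ^ (-(2 * b * K₀ - 2) / 2)
        = (1 + ‖ξ‖ ^ 2) * (1 + ‖ξ‖ ^ 2) ^ (-(b * K₀)) := by
      nth_rewrite 2 [← Real.rpow_one (1 + ‖ξ‖ ^ 2)]
      rw [← Real.rpow_add hp]
      congr 1
      ring
    dsimp only
    rw [h2]
    ring
  · have hKK : (K₀ : ℝ) ≤ K := by exact_mod_cast hK
    rw [norm_prod]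
    calc _ ≤ ∏ k, (1 + inner ℝ (v k) ξ ^ 2) ^ (-β) :=
          Finset.prod_le_prod (fun _ _ => norm_nonneg _) fun k _ => (hχ k).norm_le _
      _ ≤ (1 + W ^ 2 * ‖ξ‖ ^ 2 / K) ^ (-(b * K)) :=
          prod_one_add_inner_sq_rpow_le hW hc₀ hβ (hK₀0.trans_le hKK) hv.norm_le hv.le_sum ξ
      _ ≤ (1 + W ^ 2 * ‖ξ‖ ^ 2 / K₀) ^ (-(b * K₀)) :=
          one_add_div_rpow_le (by positivity) hb0.le hK₀0 hKK
      _ ≤ (η * (1 + ‖ξ‖ ^ 2)) ^ (-(b * K₀)) := by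
          refine Real.rpow_le_rpow_of_nonpos (by positivity) ?_ (by
            have := mul_pos hb0 hK₀0
            linarith)
          have h1 : η ≤ 1 := min_le_left _ _
          have h2 : η ≤ W ^ 2 / K₀ := min_le_right _ _
          have h3 := mul_le_mul_of_nonneg_right h2 (sq_nonneg ‖ξ‖)
          have h4 : W ^ 2 / K₀ * ‖ξ‖ ^ 2 = W ^ 2 * ‖ξ‖ ^ 2 / K₀ := by ring
          linarith
      _ = _ := Real.mul_rpow hη0.le (by positivity)

/-- Nondegeneracy of the second moments of the unit ball: it contains a ball of radius `1/4` on
which `⟪ξ, u⟫` is at least `‖u‖ / 2`. -/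
theorem le_setIntegral_inner_sq (u : V) :
    volume.real (Metric.ball (0 : V) (1 / 4)) / 4 * ‖u‖ ^ 2
      ≤ ∫ ξ in Metric.closedBall (0 : V) 1, inner ℝ ξ u ^ 2 := by
  rcases eq_or_ne u 0 with rfl | hu
  · simp
  have hu' : 0 < ‖u‖ := norm_pos_iff.2 hu
  set p : V := (3 / 4 * ‖u‖⁻¹) • u with hp
  have hpn : ‖p‖ = 3 / 4 := by
    rw [hp, norm_smul, Real.norm_eq_abs, abs_of_pos (by positivity)]
    field_simp
  have hsub : Metric.ball p (1 / 4) ⊆ Metric.closedBall (0 : V) 1 := fun ξ hξ => by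
    rw [mem_closedBall_zero_iff]
    have h1 := norm_add_le (ξ - p) p
    rw [sub_add_cancel, hpn, ← dist_eq_norm] at h1
    linarith [Metric.mem_ball.1 hξ]
  have hint : IntegrableOn (fun ξ : V => inner ℝ ξ u ^ 2) (Metric.closedBall (0 : V) 1) :=
    ContinuousOn.integrableOn_compact (isCompact_closedBall _ _)
      (Continuous.continuousOn (by fun_prop))
  calc _ = ∫ _ξ in Metric.ball p (1 / 4), ‖u‖ ^ 2 / 4 := by
        rw [setIntegral_const, smul_eq_mul, measureReal_def, measureReal_def,
          Measure.addHaar_ball_center volume p]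
        ring
    _ ≤ ∫ ξ in Metric.ball p (1 / 4), inner ℝ ξ u ^ 2 := by
        refine setIntegral_mono_on (integrableOn_const (measure_ball_lt_top.ne))
          (hint.mono_set hsub) measurableSet_ball fun ξ hξ => ?_
        have h1 : inner ℝ ξ u = inner ℝ (ξ - p) u + 3 / 4 * ‖u‖ := by
          rw [inner_sub_left, hp, inner_smul_left, real_inner_self_eq_norm_sq]
          simp only [conj_trivial]
          field_simp
          ring
        have h2 := (abs_le.1 (abs_real_inner_le_norm (ξ - p) u)).1
        have h3 : ‖ξ - p‖ ≤ 1 / 4 := by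
          rw [← dist_eq_norm]; exact (Metric.mem_ball.1 hξ).le
        have h4 : ‖u‖ / 2 ≤ inner ℝ ξ u := by nlinarith
        nlinarith
    _ ≤ _ := setIntegral_mono_set hint (ae_of_all _ fun ξ => sq_nonneg _)
        (LE.le.eventuallyLE hsub)

/-- Bounds on the zeroth and second moments of the product of site transforms, uniform in the
number of sites. The upper bound comes from the dominating function. For the lower bounds the real
part of the product is at least a positive constant on the unit ball and nonnegative outside it, up
to an error that tends to zero in weighted `L¹` norm as the number of sites grows. -/
theorem exists_moment_bounds (V : Type*) [NormedAddCommGroup V] [InnerProductSpace ℝ V]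
    [FiniteDimensional ℝ V] [MeasurableSpace V] [BorelSpace V]
    {β D W c₀ : ℝ} (hβ : 0 < β) (hW : 0 < W) (hc₀ : 0 < c₀) :
    ∃ (K₀ : ℕ) (m I : ℝ), 0 < K₀ ∧ 0 < m ∧ 0 < I ∧
      ∀ K : ℕ, K₀ ≤ K → ∀ v : Fin K → V, IsUniformFrame W c₀ v → ∀ χ : Fin K → ℝ → ℂ,
        (∀ k, IsSiteTransform β D (χ k)) →
        Integrable (fun ξ => (1 + ‖ξ‖ ^ 2) * ‖∏ k, χ k (inner ℝ (v k) ξ)‖) ∧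
        ∫ ξ, (1 + ‖ξ‖ ^ 2) * ‖∏ k, χ k (inner ℝ (v k) ξ)‖ ≤ I ∧
        m ≤ ∫ ξ, (∏ k, χ k (inner ℝ (v k) ξ)).re ∧
        ∀ u : V, m * ‖u‖ ^ 2 ≤ ∫ ξ, inner ℝ ξ u ^ 2 * (∏ k, χ k (inner ℝ (v k) ξ)).re := by
  obtain ⟨K₀, G, hK₀, hGc, hG0, hGi, hG⟩ := exists_dominating V (D := D) hβ hW hc₀
  set U : Set V := Metric.closedBall 0 1 with hU
  have hUm : MeasurableSet U := measurableSet_closedBall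
  set c₁ := Real.exp (-(D * W ^ 2)) with hc₁
  have hc₁0 : 0 < c₁ := Real.exp_pos _
  set h : V → ℝ := U.indicator fun _ => c₁ with hh
  have hh0 : ∀ ξ, 0 ≤ h ξ := fun ξ => indicator_nonneg (fun _ _ => hc₁0.le) ξ
  have hhm : Measurable h := measurable_const.indicator hUm
  set err : ℕ → V → ℝ := fun K ξ => |D| * (W ^ 3 * ‖ξ‖ ^ 3 + W ^ 4 * ‖ξ‖ ^ 4) / √K with herr
  have herr0 : ∀ K ξ, 0 ≤ err K ξ := fun K ξ => by positivity
  -- the cubic comparison error is useless for large `ξ`, where the trivial bound takes over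
  set e : ℕ → V → ℝ := fun K ξ => min (err K ξ) (G ξ + h ξ) with he
  have he0 : ∀ K ξ, 0 ≤ e K ξ := fun K ξ => le_min (herr0 K ξ) (add_nonneg (hG0 ξ) (hh0 ξ))
  have hem : ∀ K, Measurable (e K) := fun K => by
    have : Measurable (err K) := Continuous.measurable (by fun_prop)
    exact this.min (hGc.measurable.add hhm)
  have hhi : ∀ w : V → ℝ, Continuous w → Integrable fun ξ => w ξ * h ξ := fun w hw => by
    have h1 : IntegrableOn (fun ξ => w ξ * c₁) U :=
      ContinuousOn.integrableOn_compact (isCompact_closedBall _ _)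
        (Continuous.continuousOn (by fun_prop))
    refine (h1.integrable_indicator hUm).congr (ae_of_all _ fun ξ => ?_)
    by_cases hξ : ξ ∈ U <;> simp [hh, hξ]
  have hGhi : Integrable fun ξ => (1 + ‖ξ‖ ^ 2) * (G ξ + h ξ) := by
    simp_rw [mul_add]
    exact hGi.add (hhi _ (by fun_prop))
  have hei : ∀ K, Integrable fun ξ => (1 + ‖ξ‖ ^ 2) * e K ξ := fun K => by
    refine hGhi.mono' ((Measurable.mul (by fun_prop) (hem K)).aestronglyMeasurable)
      (ae_of_all _ fun ξ => ?_)
    rw [Real.norm_eq_abs, abs_of_nonneg (mul_nonneg (by positivity) (he0 K ξ))]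
    gcongr
    exact min_le_right _ _
  -- the integrated error tends to zero by dominated convergence
  have hlim : Filter.Tendsto (fun K => ∫ ξ, (1 + ‖ξ‖ ^ 2) * e K ξ) Filter.atTop (nhds 0) := by
    have h1 := tendsto_integral_of_dominated_convergence
      (F := fun K ξ => (1 + ‖ξ‖ ^ 2) * e K ξ) (f := fun _ => (0 : ℝ)) (μ := (volume : Measure V))
      _ (fun K => (hei K).aestronglyMeasurable) hGhi
      (fun K => ae_of_all _ fun ξ => by
        rw [Real.norm_eq_abs, abs_of_nonneg (mul_nonneg (by positivity) (he0 K ξ))]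
        gcongr
        exact min_le_right _ _)
      (ae_of_all _ fun ξ => by
        have h2 : Filter.Tendsto (fun K : ℕ => err K ξ) Filter.atTop (nhds 0) :=
          Filter.Tendsto.const_div_atTop
            (Real.tendsto_sqrt_atTop.comp tendsto_natCast_atTop_atTop) _
        have h3 : Filter.Tendsto (fun K : ℕ => e K ξ) Filter.atTop (nhds 0) :=
          squeeze_zero (fun K => he0 K ξ) (fun K => min_le_left _ _) h2
        simpa using h3.const_mul (1 + ‖ξ‖ ^ 2))
    simpa using h1
  set κ := volume.real (Metric.ball (0 : V) (1 / 4)) / 4 with hκ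
  have hκ0 : 0 < κ := by
    have : 0 < volume.real (Metric.ball (0 : V) (1 / 4)) :=
      ENNReal.toReal_pos (Metric.measure_ball_pos volume _ (by norm_num)).ne'
        measure_ball_lt_top.ne
    positivity
  have hm0 : 0 < c₁ * κ / 2 := by positivity
  obtain ⟨K₁, hK₁⟩ := Filter.eventually_atTop.1 (hlim.eventually (gt_mem_nhds hm0))
  refine ⟨max K₀ K₁, c₁ * κ / 2, (∫ ξ, (1 + ‖ξ‖ ^ 2) * G ξ) + 1, lt_max_of_lt_left hK₀, hm0,
    by have : 0 ≤ ∫ ξ, (1 + ‖ξ‖ ^ 2) * G ξ := integral_nonneg fun ξ =>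
        mul_nonneg (by positivity) (hG0 ξ)
       linarith, fun K hK v hv χ hχ => ?_⟩
  have hKK₀ : K₀ ≤ K := (le_max_left _ _).trans hK
  have hKpos : 0 < K := hK₀.trans_le hKK₀
  set X : V → ℂ := fun ξ => ∏ k, χ k (inner ℝ (v k) ξ) with hX
  have hXc : Continuous X := continuous_finsetProd _ fun k _ =>
    (hχ k).continuous.comp (by fun_prop)
  have hXG : ∀ ξ, ‖X ξ‖ ≤ G ξ := hG K hKK₀ v hv χ hχ
  have hXi : Integrable fun ξ => (1 + ‖ξ‖ ^ 2) * ‖X ξ‖ := by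
    refine hGi.mono' (Continuous.aestronglyMeasurable (by fun_prop)) (ae_of_all _ fun ξ => ?_)
    rw [Real.norm_eq_abs, abs_of_nonneg (by positivity)]
    gcongr
    exact hXG ξ
  have hXre : ∀ ξ, h ξ - e K ξ ≤ (X ξ).re := fun ξ => by
    have hre := (abs_le.1 ((Complex.abs_re_le_norm (X ξ)).trans (hXG ξ))).1
    rcases min_choice (err K ξ) (G ξ + h ξ) with h1 | h1
    · have h2 := exp_sub_le_re_prod hβ hKpos hW hv hχ ξ
      have h3 : h ξ ≤ Real.exp (-(D * W ^ 2 * ‖ξ‖ ^ 2)) := by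
        have hD : 0 ≤ D := by
          obtain ⟨s, hs0, hsD, -⟩ := (hχ ⟨0, hKpos⟩).norm_sub_le
          exact hs0.trans hsD
        by_cases hξ : ξ ∈ U
        · rw [hh, indicator_of_mem hξ, hc₁]
          refine Real.exp_le_exp.2 (neg_le_neg ?_)
          have h4 : ‖ξ‖ ≤ 1 := mem_closedBall_zero_iff.1 hξ
          have h5 : ‖ξ‖ ^ 2 ≤ 1 := pow_le_one₀ (norm_nonneg _) h4
          exact mul_le_of_le_one_right (by positivity) h5
        · rw [hh, indicator_of_notMem hξ]
          positivity
      have h6 : D * (W ^ 3 * ‖ξ‖ ^ 3 + W ^ 4 * ‖ξ‖ ^ 4) / √K ≤ err K ξ := by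
        simp only [herr]
        gcongr
        exact le_abs_self D
      have h7 : e K ξ = err K ξ := h1
      have h8 : (∏ k, χ k (inner ℝ (v k) ξ)).re = (X ξ).re := rfl
      linarith
    · have h7 : e K ξ = G ξ + h ξ := h1
      linarith
  have key : ∀ (w : V → ℝ) (c : ℝ), Continuous w → (∀ ξ, 0 ≤ w ξ) → 0 ≤ c →
      (∀ ξ, w ξ ≤ c * (1 + ‖ξ‖ ^ 2)) →
      c₁ * (∫ ξ in U, w ξ) - c * (c₁ * κ / 2) ≤ ∫ ξ, w ξ * (X ξ).re := by
    intro w c hwc hw0 hc hwle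
    have i1 : Integrable fun ξ => w ξ * h ξ := hhi w hwc
    have i2 : Integrable fun ξ => c * ((1 + ‖ξ‖ ^ 2) * e K ξ) := (hei K).const_mul c
    have i3 : Integrable fun ξ => w ξ * (X ξ).re := by
      refine (hXi.const_mul c).mono' (Continuous.aestronglyMeasurable (by fun_prop))
        (ae_of_all _ fun ξ => ?_)
      rw [norm_mul, Real.norm_eq_abs, Real.norm_eq_abs, abs_of_nonneg (hw0 ξ), ← mul_assoc]
      exact mul_le_mul (hwle ξ) (Complex.abs_re_le_norm _) (abs_nonneg _) (by positivity)
    have h1 : ∫ ξ, (w ξ * h ξ - c * ((1 + ‖ξ‖ ^ 2) * e K ξ)) ≤ ∫ ξ, w ξ * (X ξ).re := by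
      refine integral_mono (i1.sub i2) i3 fun ξ => ?_
      have h2 := mul_le_mul_of_nonneg_left (hXre ξ) (hw0 ξ)
      have h3 := mul_le_mul_of_nonneg_right (hwle ξ) (he0 K ξ)
      dsimp only
      linarith
    rw [integral_sub i1 i2, integral_const_mul] at h1
    have h4 : ∫ ξ, w ξ * h ξ = c₁ * ∫ ξ in U, w ξ := by
      rw [← integral_const_mul, ← integral_indicator hUm]
      refine integral_congr_ae (ae_of_all _ fun ξ => ?_)
      by_cases hξ : ξ ∈ U <;> simp [hh, hξ, mul_comm]
    have h5 := mul_le_mul_of_nonneg_left (hK₁ K ((le_max_right _ _).trans hK)).le hc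
    linarith
  refine ⟨hXi, ?_, ?_, fun u => ?_⟩
  · have h1 : ∫ ξ, (1 + ‖ξ‖ ^ 2) * ‖X ξ‖ ≤ ∫ ξ, (1 + ‖ξ‖ ^ 2) * G ξ :=
      integral_mono hXi hGi fun ξ => by
        have := hXG ξ
        dsimp only
        gcongr
    linarith
  · have h1 := key (fun _ => 1) 1 continuous_const (fun _ => zero_le_one) zero_le_one
      fun ξ => by nlinarith [sq_nonneg ‖ξ‖]
    simp only [one_mul, setIntegral_const, smul_eq_mul, mul_one] at h1
    have h2 : κ ≤ volume.real U := by
      have h3 : volume.real (Metric.ball (0 : V) (1 / 4)) ≤ volume.real U :=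
        measureReal_mono
          ((Metric.ball_subset_ball (by norm_num)).trans Metric.ball_subset_closedBall)
          measure_closedBall_lt_top.ne
      have h4 : 0 ≤ volume.real (Metric.ball (0 : V) (1 / 4)) := measureReal_nonneg
      rw [hκ]
      linarith
    have h5 := mul_le_mul_of_nonneg_left h2 hc₁0.le
    linarith
  · have h1 := key (fun ξ => inner ℝ ξ u ^ 2) (‖u‖ ^ 2) (by fun_prop) (fun _ => sq_nonneg _)
      (sq_nonneg _) fun ξ => by
        have h2 : inner ℝ ξ u ^ 2 ≤ (‖ξ‖ * ‖u‖) ^ 2 := by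
          rw [← sq_abs]
          gcongr
          exact abs_real_inner_le_norm _ _
        nlinarith [sq_nonneg ‖u‖]
    have h2 := mul_le_mul_of_nonneg_left (le_setIntegral_inner_sq u) hc₁0.le
    rw [← hκ] at h2
    linarith

end Product

/-! ### Integrals over the fibres of a linear map -/

section Fibre

variable {E V : Type*} [NormedAddCommGroup E] [InnerProductSpace ℝ E]
  [NormedAddCommGroup V] [InnerProductSpace ℝ V]

theorem abs_comp_section_le {T : E →ₗ[ℝ] V} {S : V →ₗ[ℝ] E} {g : E → ℝ} {A c : ℝ}
    (hS : ∀ y, ∀ z ∈ LinearMap.ker T, ‖S y + z‖ ^ 2 = ‖S y‖ ^ 2 + ‖z‖ ^ 2)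
    (hc : 0 < c) (hgA : ∀ x, |g x| ≤ A * Real.exp (-(c * ‖x‖ ^ 2))) (y : V)
    (z : LinearMap.ker T) : |g (S y + z)| ≤ A * Real.exp (-(c * ‖z‖ ^ 2)) := by
  have hA : 0 ≤ A := by
    have h := (abs_nonneg _).trans (hgA 0)
    simpa using h
  refine (hgA _).trans (mul_le_mul_of_nonneg_left (Real.exp_le_exp.2 ?_) hA)
  rw [hS y z z.2, Submodule.coe_norm]
  nlinarith [sq_nonneg ‖S y‖]

variable [FiniteDimensional ℝ E]

/-- A surjective linear map has a linear section with values in the orthogonal complement of its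
kernel. -/
theorem exists_orthogonal_section {T : E →ₗ[ℝ] V} (hT : Function.Surjective T) :
    ∃ S : V →ₗ[ℝ] E, (∀ y, T (S y) = y) ∧
      ∀ y, ∀ z ∈ LinearMap.ker T, ‖S y + z‖ ^ 2 = ‖S y‖ ^ 2 + ‖z‖ ^ 2 := by
  obtain ⟨S₀, hS₀⟩ := T.exists_rightInverse_of_surjective (LinearMap.range_eq_top.2 hT)
  set Q := ((LinearMap.ker T)ᗮ).starProjection with hQ
  refine ⟨Q.toLinearMap ∘ₗ S₀, fun y => ?_, fun y z hz => ?_⟩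
  · have h1 : S₀ y - Q (S₀ y) ∈ LinearMap.ker T := by
      have h2 := Submodule.sub_starProjection_mem_orthogonal (K := (LinearMap.ker T)ᗮ) (S₀ y)
      rwa [Submodule.orthogonal_orthogonal] at h2
    rw [LinearMap.mem_ker, map_sub, sub_eq_zero] at h1
    have h3 : T (S₀ y) = y := congrArg (fun f => f y) hS₀
    change T (Q (S₀ y)) = y
    rw [← h1, h3]
  · have h1 : Q (S₀ y) ∈ (LinearMap.ker T)ᗮ := Submodule.starProjection_apply_mem _ _
    have h2 : inner ℝ (Q (S₀ y)) z = 0 := Submodule.inner_left_of_mem_orthogonal hz h1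
    change ‖Q (S₀ y) + z‖ ^ 2 = ‖Q (S₀ y)‖ ^ 2 + ‖z‖ ^ 2
    rw [norm_add_sq_real, h2]
    ring

/-- A linear section of `T` identifies the product of the target and the kernel with the source. -/
noncomputable def sectionEquiv [FiniteDimensional ℝ V] (T : E →ₗ[ℝ] V) (S : V →ₗ[ℝ] E)
    (hS : ∀ y, T (S y) = y) :
    (V × LinearMap.ker T) ≃L[ℝ] E :=
  LinearEquiv.toContinuousLinearEquiv
    { toFun := fun p => S p.1 + p.2
      invFun := fun x => (T x, ⟨x - S (T x), by rw [LinearMap.mem_ker, map_sub, hS, sub_self]⟩)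
      map_add' := fun p q => by simp; abel
      map_smul' := fun c p => by simp
      left_inv := fun p => by
        have hz : T p.2 = 0 := p.2.2
        ext <;> simp [hS]
      right_inv := fun x => by simp }

@[simp]
theorem sectionEquiv_apply [FiniteDimensional ℝ V] (T : E →ₗ[ℝ] V) (S : V →ₗ[ℝ] E)
    (hS : ∀ y, T (S y) = y)
    (p : V × LinearMap.ker T) : sectionEquiv T S hS p = S p.1 + p.2 := rfl

variable [MeasurableSpace E] [BorelSpace E]

/-- The integral of `g` over the translate of `ker T` through `x`, that is, over the fibre of `T`
containing `x`. -/
noncomputable def kerIntegral (T : E →ₗ[ℝ] V) (g : E → ℝ) (x : E) : ℝ :=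
  ∫ z : LinearMap.ker T, g (x + z)

theorem kerIntegral_congr {T : E →ₗ[ℝ] V} (g : E → ℝ) {x x' : E} (h : T x = T x') :
    kerIntegral T g x = kerIntegral T g x' := by
  have hk : x - x' ∈ LinearMap.ker T := by rw [LinearMap.mem_ker, map_sub, h, sub_self]
  have := integral_add_left_eq_self (μ := (volume : Measure (LinearMap.ker T)))
    (fun z : LinearMap.ker T => g (x' + z)) ⟨x - x', hk⟩
  rw [kerIntegral, kerIntegral, ← this]
  refine integral_congr_ae (ae_of_all _ fun z => ?_)
  simp only [Submodule.coe_add]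
  congr 1
  abel

/-- A linear equivalence scales integrals by a positive constant. -/
theorem exists_integral_comp_eq {E₁ E₂ : Type*} [NormedAddCommGroup E₁] [NormedSpace ℝ E₁]
    [MeasurableSpace E₁] [BorelSpace E₁] [FiniteDimensional ℝ E₁]
    [NormedAddCommGroup E₂] [NormedSpace ℝ E₂] [MeasurableSpace E₂] [BorelSpace E₂]
    [FiniteDimensional ℝ E₂] (μ₁ : Measure E₁) [μ₁.IsAddHaarMeasure] (μ₂ : Measure E₂)
    [μ₂.IsAddHaarMeasure] (L : E₁ ≃L[ℝ] E₂) :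
    ∃ c : ℝ, 0 < c ∧ ∀ {F : Type} [NormedAddCommGroup F] [NormedSpace ℝ F] (f : E₂ → F),
      (Integrable f μ₂ → Integrable (fun x => f (L x)) μ₁) ∧
      ∫ x, f (L x) ∂μ₁ = c • ∫ x, f x ∂μ₂ := by
  have hL : MeasurableEmbedding L := L.toHomeomorph.measurableEmbedding
  have hm := Measure.isAddLeftInvariant_eq_smul (μ₁.map L) μ₂
  refine ⟨Measure.addHaarScalarFactor (μ₁.map L) μ₂,
    Measure.addHaarScalarFactor_pos_of_isAddHaarMeasure _ _, fun {F} _ _ f => ⟨fun hf => ?_, ?_⟩⟩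
  · refine (hL.integrable_map_iff (g := f)).1 ?_
    rw [hm]
    exact hf.smul_measure_nnreal
  · generalize Measure.addHaarScalarFactor (μ₁.map L) μ₂ = q at hm
    rw [← hL.integral_map f, hm, integral_smul_nnreal_measure]
    rfl

section Gaussian

variable {T : E →ₗ[ℝ] V} {S : V →ₗ[ℝ] E} {g : E → ℝ} {A c : ℝ}

theorem integrable_exp_neg_mul_norm_sq (hc : 0 < c) :
    Integrable fun x : E => Real.exp (-(c * ‖x‖ ^ 2)) := by
  have h := (GaussianFourier.integrable_cexp_neg_mul_sq_norm_add (V := E) (b := (c : ℂ))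
    (by simpa using hc) 0 0).norm
  refine h.congr (ae_of_all _ fun x => ?_)
  simp [Complex.norm_exp, ← Complex.ofReal_pow, ← Complex.ofReal_mul]

theorem integrable_of_abs_le_exp (hg : Continuous g) (hc : 0 < c)
    (hgA : ∀ x, |g x| ≤ A * Real.exp (-(c * ‖x‖ ^ 2))) : Integrable g :=
  ((integrable_exp_neg_mul_norm_sq hc).const_mul A).mono' hg.aestronglyMeasurable
    (ae_of_all _ hgA)

theorem integrable_comp_section (hg : Continuous g)
    (hS : ∀ y, ∀ z ∈ LinearMap.ker T, ‖S y + z‖ ^ 2 = ‖S y‖ ^ 2 + ‖z‖ ^ 2)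
    (hc : 0 < c) (hgA : ∀ x, |g x| ≤ A * Real.exp (-(c * ‖x‖ ^ 2))) (y : V) :
    Integrable fun z : LinearMap.ker T => g (S y + z) :=
  integrable_of_abs_le_exp (by fun_prop) hc (abs_comp_section_le hS hc hgA y)

theorem continuous_kerIntegral_section [FiniteDimensional ℝ V] (hg : Continuous g)
    (hS : ∀ y, ∀ z ∈ LinearMap.ker T, ‖S y + z‖ ^ 2 = ‖S y‖ ^ 2 + ‖z‖ ^ 2)
    (hc : 0 < c) (hgA : ∀ x, |g x| ≤ A * Real.exp (-(c * ‖x‖ ^ 2))) :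
    Continuous fun y => kerIntegral T g (S y) := by
  have hSc : Continuous S := S.continuous_of_finiteDimensional
  refine continuous_of_dominated
    (bound := fun z : LinearMap.ker T => A * Real.exp (-(c * ‖z‖ ^ 2))) (fun y => ?_) (fun y => ?_)
    ((integrable_exp_neg_mul_norm_sq hc).const_mul A) (ae_of_all _ fun z => by fun_prop)
  · exact (integrable_comp_section hg hS hc hgA y).aestronglyMeasurable
  · exact ae_of_all _ fun z => abs_comp_section_le hS hc hgA y z

theorem kerIntegral_section_pos (hg : Continuous g) (hg0 : ∀ x, 0 < g x)
    (hS : ∀ y, ∀ z ∈ LinearMap.ker T, ‖S y + z‖ ^ 2 = ‖S y‖ ^ 2 + ‖z‖ ^ 2)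
    (hc : 0 < c) (hgA : ∀ x, |g x| ≤ A * Real.exp (-(c * ‖x‖ ^ 2))) (y : V) :
    0 < kerIntegral T g (S y) := by
  rw [kerIntegral, integral_pos_iff_support_of_nonneg (fun z => (hg0 _).le)
    (integrable_comp_section hg hS hc hgA y)]
  have : Function.support (fun z : LinearMap.ker T => g (S y + z)) = univ :=
    eq_univ_of_forall fun z => (hg0 _).ne'
  rw [this]
  exact Measure.measure_univ_pos.2 (NeZero.ne _)

variable [FiniteDimensional ℝ V] [MeasurableSpace V] [BorelSpace V]

/-- Fubini along a section: the function on the base obtained by integrating over the fibres is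
integrable, and its Fourier transform is that of the original function, read along the adjoint
of `T`. -/
theorem exists_fourier_kerIntegral (T : E →ₗ[ℝ] V) (S : V →ₗ[ℝ] E) (hTS : ∀ y, T (S y) = y) :
    ∃ κ : ℝ, 0 < κ ∧ ∀ g : E → ℝ, Integrable g →
      Integrable (fun y => (kerIntegral T g (S y) : ℂ)) ∧
      ∀ ξ : V, 𝓕 (fun y => (kerIntegral T g (S y) : ℂ)) ξ
        = κ * ∫ x, Complex.exp ((-2 * Real.pi * inner ℝ (T x) ξ : ℝ) * Complex.I) * (g x : ℂ) := by
  obtain ⟨κ, hκ, hL⟩ := exists_integral_comp_eq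
    ((volume : Measure V).prod (volume : Measure (LinearMap.ker T)))
    (volume : Measure E) (sectionEquiv T S hTS)
  refine ⟨κ, hκ, fun g hg => ?_⟩
  have hgC : Integrable fun x => (g x : ℂ) := hg.ofReal
  have hi := (hL fun x => (g x : ℂ)).1 hgC
  simp only [sectionEquiv_apply] at hi
  have hF : ∀ y, (kerIntegral T g (S y) : ℂ) = ∫ z : LinearMap.ker T, (g (S y + z) : ℂ) :=
    fun y => integral_ofReal.symm
  refine ⟨?_, fun ξ => ?_⟩
  · simp_rw [hF]
    exact hi.integral_prod_left
  · have hTc : Continuous T := T.continuous_of_finiteDimensional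
    have hgξ : Integrable fun x =>
        Complex.exp ((-2 * Real.pi * inner ℝ (T x) ξ : ℝ) * Complex.I) * (g x : ℂ) := by
      refine hgC.mono (((Continuous.aestronglyMeasurable (by fun_prop))).mul hgC.1)
        (ae_of_all _ fun x => ?_)
      rw [norm_mul, Complex.norm_exp_ofReal_mul_I, one_mul]
    obtain ⟨hi2, heq⟩ := hL fun x =>
      Complex.exp ((-2 * Real.pi * inner ℝ (T x) ξ : ℝ) * Complex.I) * (g x : ℂ)
    have hi2 := hi2 hgξ
    simp only [sectionEquiv_apply] at hi2 heq
    rw [← Complex.real_smul, ← heq, integral_prod _ hi2, Real.fourier_eq']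
    refine integral_congr_ae (ae_of_all _ fun y => ?_)
    dsimp only
    rw [hF, smul_eq_mul, ← integral_const_mul]
    refine integral_congr_ae (ae_of_all _ fun z => ?_)
    have hz : T z = 0 := z.2
    simp [hz, hTS]

end Gaussian

end Fibre

/-! ### The Hessian of the logarithm of an inverse Fourier transform -/

section Hessian

variable {V : Type*} [NormedAddCommGroup V]

theorem iteratedFDeriv_two_neg_log [NormedSpace ℝ V] {P : V → ℝ} (hP : ContDiff ℝ 2 P)
    (hpos : ∀ y, 0 < P y) (y v : V) :
    iteratedFDeriv ℝ 2 (fun y => -Real.log (P y)) y ![v, v]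
      = -(iteratedFDeriv ℝ 2 P y ![v, v] / P y) + (fderiv ℝ P y v / P y) ^ 2 := by
  have hd : ∀ y, HasFDerivAt P (fderiv ℝ P y) y := fun y =>
    (hP.differentiable two_ne_zero y).hasFDerivAt
  have h1 : fderiv ℝ (fun y => -Real.log (P y)) = fun y => (-(P y)⁻¹) • fderiv ℝ P y := by
    ext1 y
    rw [((hd y).log (hpos y).ne').fun_neg.fderiv, neg_smul]
  have hd2 : DifferentiableAt ℝ (fderiv ℝ P) y :=
    (hP.fderiv_right (m := 1) (by norm_num)).differentiable one_ne_zero y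
  have hinv : HasFDerivAt (fun y => -(P y)⁻¹) ((P y ^ 2)⁻¹ • fderiv ℝ P y) y := by
    have h2 := ((hasDerivAt_inv (hpos y).ne').comp_hasFDerivAt y (hd y)).neg
    convert! h2 using 1
    rw [neg_smul, neg_neg]
  rw [iteratedFDeriv_two_apply, iteratedFDeriv_two_apply, h1,
    (hinv.fun_smul hd2.hasFDerivAt).fderiv]
  simp
  field_simp

variable [InnerProductSpace ℝ V] [FiniteDimensional ℝ V] [MeasurableSpace V] [BorelSpace V]

/-- Bounds on the zeroth and second moments of `X` turn into bounds on the Hessian at the origin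
of `-log P`, where `P` is the inverse Fourier transform of `X` up to a factor. -/
theorem hessian_neg_log_fourierInv {P : V → ℝ} {X : V → ℂ} {κ m I : ℝ} (hκ : 0 < κ) (hm : 0 < m)
    (hPpos : ∀ y, 0 < P y) (hXc : Continuous X)
    (hXi : Integrable fun ξ => (1 + ‖ξ‖ ^ 2) * ‖X ξ‖)
    (hP : ∀ y, (P y : ℂ) = κ * 𝓕⁻ X y)
    (hI : ∫ ξ, (1 + ‖ξ‖ ^ 2) * ‖X ξ‖ ≤ I) (hm₀ : m ≤ ∫ ξ, (X ξ).re)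
    (hm₂ : ∀ u : V, m * ‖u‖ ^ 2 ≤ ∫ ξ, inner ℝ ξ u ^ 2 * (X ξ).re) :
    ContDiff ℝ 2 P ∧ ∀ v : V,
      4 * Real.pi ^ 2 * (m / I) * ‖v‖ ^ 2
        ≤ iteratedFDeriv ℝ 2 (fun y => -Real.log (P y)) 0 ![v, v] ∧
      iteratedFDeriv ℝ 2 (fun y => -Real.log (P y)) 0 ![v, v]
        ≤ 4 * Real.pi ^ 2 * (I / m + (I / m) ^ 2) * ‖v‖ ^ 2 := by
  set Y : V → ℂ := fun ξ => X (-ξ) with hY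
  have hYc : Continuous Y := hXc.comp continuous_neg
  have hYi : Integrable fun ξ => (1 + ‖ξ‖ ^ 2) * ‖Y ξ‖ := by
    simpa [hY] using hXi.comp_neg
  have hP' : P = fun y => (Complex.reCLM.comp (κ • ContinuousLinearMap.id ℝ ℂ)) (𝓕 Y y) := by
    ext y
    have h1 := congrArg Complex.re (hP y)
    rw [Real.fourierInv_eq_fourier_comp_neg] at h1
    simpa using h1
  have hYn : ∀ n : ℕ, n ≤ ((2 : ℕ∞)) → Integrable fun ξ => ‖ξ‖ ^ n * ‖Y ξ‖ := fun n hn => by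
    have hn' : n ≤ 2 := by exact_mod_cast hn
    refine hYi.mono' (Continuous.aestronglyMeasurable (by fun_prop)) (ae_of_all _ fun ξ => ?_)
    rw [Real.norm_eq_abs, abs_of_nonneg (by positivity)]
    gcongr
    interval_cases n
    · nlinarith [sq_nonneg ‖ξ‖]
    · nlinarith [sq_nonneg (‖ξ‖ - 1)]
    · linarith
  have hFc : ContDiff ℝ 2 (𝓕 Y) := Real.contDiff_fourier (N := 2) hYn
  have hPc : ContDiff ℝ 2 P := by
    rw [hP']
    exact ContinuousLinearMap.contDiff _ |>.comp hFc
  refine ⟨hPc, fun v => ?_⟩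
  have hF : ∀ n : ℕ, n ≤ ((2 : ℕ∞)) → ∀ w : Fin n → V, iteratedFDeriv ℝ n (𝓕 Y) 0 w
      = ∫ ξ, (-(2 * Real.pi * Complex.I)) ^ n * ((∏ i, inner ℝ ξ (w i) : ℝ) : ℂ) * Y ξ := by
    intro n hn w
    rw [Real.iteratedFDeriv_fourier hYn hYc.aestronglyMeasurable hn,
      Real.fourier_continuousMultilinearMap_apply
        (VectorFourier.integrable_fourierPowSMulRight _ (hYn n hn) hYc.aestronglyMeasurable),
      Real.fourier_eq]
    refine integral_congr_ae (ae_of_all _ fun ξ => ?_)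
    simp only [VectorFourier.fourierPowSMulRight_apply, inner_zero_right, neg_zero,
      AddChar.map_zero_eq_one, one_smul, smul_eq_mul, Complex.real_smul, mul_assoc]
    rfl
  have hPn : ∀ n : ℕ, n ≤ 2 → ∀ w : Fin n → V, iteratedFDeriv ℝ n P 0 w
      = κ * (iteratedFDeriv ℝ n (𝓕 Y) 0 w).re := by
    intro n hn w
    have h3 := ContinuousLinearMap.iteratedFDeriv_comp_left
      (Complex.reCLM.comp (κ • ContinuousLinearMap.id ℝ ℂ)) (hFc.contDiffAt (x := 0))
      (i := n) (by exact_mod_cast hn)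
    rw [hP']
    refine (congrArg (fun f => f w) h3).trans ?_
    simp
  have hneg : ∀ f : V → ℝ, ∫ ξ, f (-ξ) = ∫ ξ, f ξ := fun f => integral_neg_eq_self f volume
  have hYint : Integrable Y := (hYn 0 (by simp)).mono' hYc.aestronglyMeasurable
    (ae_of_all _ fun ξ => by simp)
  have h0 : P 0 = κ * ∫ ξ, (X ξ).re := by
    have h1 : P 0 = κ * (𝓕 Y 0).re := by rw [hP']; simp
    rw [h1, Real.fourier_eq]
    simp only [inner_zero_right, neg_zero, AddChar.map_zero_eq_one, one_smul]
    rw [← hneg fun ξ => (X ξ).re]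
    have := integral_re hYint (𝕜 := ℂ)
    simp only [RCLike.re_eq_complex_re] at this
    rw [← this]
  have h2 : iteratedFDeriv ℝ 2 P 0 ![v, v]
      = -(κ * (4 * Real.pi ^ 2 * ∫ ξ, inner ℝ ξ v ^ 2 * (X ξ).re)) := by
    have hi : Integrable fun ξ => (-(2 * Real.pi * Complex.I)) ^ 2 *
        ((∏ i, inner ℝ ξ (![v, v] i) : ℝ) : ℂ) * Y ξ := by
      refine ((hYn 2 le_rfl).const_mul (4 * Real.pi ^ 2 * ‖v‖ ^ 2)).mono'
        (Continuous.aestronglyMeasurable (by fun_prop)) (ae_of_all _ fun ξ => ?_)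
      simp only [Fin.prod_univ_two, Matrix.cons_val_zero, Matrix.cons_val_one, norm_mul, norm_pow,
        norm_neg, Complex.norm_real, Complex.norm_I, Complex.norm_ofNat, mul_one,
        Real.norm_eq_abs, abs_of_pos Real.pi_pos]
      have := abs_real_inner_le_norm ξ v
      calc _ ≤ (2 * Real.pi) ^ 2 * ((‖ξ‖ * ‖v‖) * (‖ξ‖ * ‖v‖)) * ‖Y ξ‖ := by gcongr
        _ = _ := by ring
    have h3 := integral_re hi (𝕜 := ℂ)
    simp only [RCLike.re_eq_complex_re] at h3
    rw [hPn 2 le_rfl, hF 2 le_rfl, ← h3, ← hneg fun ξ => inner ℝ ξ v ^ 2 * (X ξ).re,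
      ← integral_const_mul, ← integral_const_mul, ← integral_const_mul, ← integral_neg]
    refine integral_congr_ae (ae_of_all _ fun ξ => ?_)
    have h4 : (-(2 * Real.pi * Complex.I)) ^ 2 * ((∏ i, inner ℝ ξ (![v, v] i) : ℝ) : ℂ) * Y ξ
        = ((-(4 * Real.pi ^ 2 * inner ℝ ξ v ^ 2) : ℝ) : ℂ) * Y ξ := by
      simp only [Fin.prod_univ_two, Matrix.cons_val_zero, Matrix.cons_val_one, neg_sq, mul_pow,
        Complex.I_sq]
      push_cast
      ring
    dsimp only
    rw [h4, Complex.re_ofReal_mul, inner_neg_left]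
    ring
  have h1 : |fderiv ℝ P 0 v| ≤ κ * (2 * Real.pi * ‖v‖ * I) := by
    have h3 : fderiv ℝ P 0 v = iteratedFDeriv ℝ 1 P 0 ![v] := by
      rw [iteratedFDeriv_one_apply]; rfl
    have hle : ∀ ξ, ‖(-(2 * Real.pi * Complex.I)) ^ 1 *
        ((∏ i, inner ℝ ξ (![v] i) : ℝ) : ℂ) * Y ξ‖
          ≤ 2 * Real.pi * ‖v‖ * ((1 + ‖ξ‖ ^ 2) * ‖Y ξ‖) := fun ξ => by
      simp only [pow_one, Finset.univ_unique, Finset.prod_singleton, Matrix.cons_val_fin_one,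
        norm_mul, norm_neg, Complex.norm_real, Complex.norm_I, Complex.norm_ofNat, mul_one,
        Real.norm_eq_abs, abs_of_pos Real.pi_pos]
      have h5 := abs_real_inner_le_norm ξ v
      have h6 : ‖ξ‖ ≤ 1 + ‖ξ‖ ^ 2 := by nlinarith [sq_nonneg (‖ξ‖ - 1)]
      calc _ ≤ 2 * Real.pi * ((1 + ‖ξ‖ ^ 2) * ‖v‖) * ‖Y ξ‖ := by
            gcongr
            exact h5.trans (by gcongr)
        _ = _ := by ring
    rw [h3, hPn 1 (by norm_num), hF 1 (by norm_num), abs_mul, abs_of_pos hκ]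
    gcongr
    refine (Complex.abs_re_le_norm _).trans ((norm_integral_le_of_norm_le (hYi.const_mul _)
      (ae_of_all _ hle)).trans ?_)
    rw [integral_const_mul]
    gcongr
    rw [← hneg fun ξ => (1 + ‖ξ‖ ^ 2) * ‖X ξ‖] at hI
    simpa [hY] using hI
  set R := ∫ ξ, (X ξ).re with hR
  set S := ∫ ξ, inner ℝ ξ v ^ 2 * (X ξ).re with hS
  have hX1 : Integrable X := hXi.mono' hXc.aestronglyMeasurable (ae_of_all _ fun ξ => by
    nlinarith [mul_nonneg (sq_nonneg ‖ξ‖) (norm_nonneg (X ξ))]) |>.congr (ae_of_all _ fun _ => rfl)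
  have hRI : R ≤ I := by
    refine (integral_mono hX1.re hXi fun ξ => ?_).trans hI
    have h3 := Complex.re_le_norm (X ξ)
    have h4 := mul_nonneg (sq_nonneg ‖ξ‖) (norm_nonneg (X ξ))
    simp only [RCLike.re_eq_complex_re]
    linarith
  have hSle : ∀ ξ, ‖inner ℝ ξ v ^ 2 * (X ξ).re‖ ≤ ‖v‖ ^ 2 * ((1 + ‖ξ‖ ^ 2) * ‖X ξ‖) := fun ξ => by
    rw [norm_mul, norm_pow, Real.norm_eq_abs, Real.norm_eq_abs]
    have h3 := Complex.abs_re_le_norm (X ξ)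
    have h4 := abs_real_inner_le_norm ξ v
    calc _ ≤ (‖ξ‖ * ‖v‖) ^ 2 * ‖X ξ‖ := by gcongr
      _ = ‖v‖ ^ 2 * (‖ξ‖ ^ 2 * ‖X ξ‖) := by ring
      _ ≤ _ := by gcongr; linarith
  have hSI : S ≤ ‖v‖ ^ 2 * I := by
    refine (Real.le_norm_self _).trans ((norm_integral_le_of_norm_le (hXi.const_mul _)
      (ae_of_all _ hSle)).trans ?_)
    rw [integral_const_mul]
    gcongr
  have hmS : m * ‖v‖ ^ 2 ≤ S := hm₂ v
  have hR0 : 0 < R := hm.trans_le hm₀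
  have hI0 : 0 < I := hR0.trans_le hRI
  have hS0 : 0 ≤ S := le_trans (by positivity) hmS
  rw [iteratedFDeriv_two_neg_log hPc hPpos, h2, h0]
  have e1 : -(-(κ * (4 * Real.pi ^ 2 * S)) / (κ * R)) = 4 * Real.pi ^ 2 * (S / R) := by
    field_simp
  rw [e1]
  constructor
  · have h5 : m / I * ‖v‖ ^ 2 ≤ S / R := by
      calc m / I * ‖v‖ ^ 2 = m * ‖v‖ ^ 2 / I := by ring
        _ ≤ S / R := by gcongr
    have h6 := mul_le_mul_of_nonneg_left h5 (by positivity : 0 ≤ 4 * Real.pi ^ 2)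
    nlinarith [sq_nonneg (fderiv ℝ P 0 v / (κ * R))]
  · have h5 : S / R ≤ I / m * ‖v‖ ^ 2 := by
      calc S / R ≤ ‖v‖ ^ 2 * I / m := by gcongr
        _ = _ := by ring
    have h6 : |fderiv ℝ P 0 v / (κ * R)| ≤ 2 * Real.pi * (I / m) * ‖v‖ := by
      rw [abs_div, abs_of_pos (mul_pos hκ hR0)]
      calc _ ≤ κ * (2 * Real.pi * ‖v‖ * I) / (κ * m) := by gcongr
        _ = _ := by field_simp
    have h7 : (fderiv ℝ P 0 v / (κ * R)) ^ 2 ≤ (2 * Real.pi * (I / m) * ‖v‖) ^ 2 := by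
      rw [← sq_abs]
      gcongr
    have h8 := mul_le_mul_of_nonneg_left h5 (by positivity : 0 ≤ 4 * Real.pi ^ 2)
    linarith

end Hessian

/-! ### Strict convexity on a single block -/

section Block

theorem iteratedFDeriv_two_add_affine {V : Type*} [NormedAddCommGroup V] [NormedSpace ℝ V]
    {h : V → ℝ} (hh : ContDiff ℝ 2 h) (ℓ : V →L[ℝ] ℝ) (c : ℝ) :
    iteratedFDeriv ℝ 2 (fun y => h y + (ℓ y + c)) = iteratedFDeriv ℝ 2 h := by
  have h1 : fderiv ℝ (fun y => h y + (ℓ y + c)) = fun y => fderiv ℝ h y + ℓ := by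
    ext1 y
    exact ((hh.differentiable two_ne_zero y).hasFDerivAt.add
      (ℓ.hasFDerivAt.add_const c)).fderiv
  ext y m
  rw [iteratedFDeriv_two_apply, iteratedFDeriv_two_apply, h1, fderiv_add_const]

/-- The Gibbs weight `exp (-H)` of the microscopic Hamiltonian. -/
noncomputable def gibbsWeight (ψ : ℝ → ℝ) (N : ℕ) (x : EuclideanSpace ℝ (Fin N)) : ℝ :=
  Real.exp (-hamiltonian ψ N x)

variable {V : Type*} [NormedAddCommGroup V] [InnerProductSpace ℝ V] {K : ℕ}

/-- The linear map `x ↦ ∑ k, x k • v k`. -/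
noncomputable def blockMap (v : Fin K → V) : EuclideanSpace ℝ (Fin K) →ₗ[ℝ] V where
  toFun x := ∑ k, x k • v k
  map_add' x y := by simp [add_smul, Finset.sum_add_distrib]
  map_smul' c x := by simp [mul_smul, Finset.smul_sum]

theorem blockMap_apply (v : Fin K → V) (x : EuclideanSpace ℝ (Fin K)) :
    blockMap v x = ∑ k, x k • v k := rfl

theorem inner_blockMap (v : Fin K → V) (x : EuclideanSpace ℝ (Fin K)) (ξ : V) :
    inner ℝ (blockMap v x) ξ = ∑ k, x k * inner ℝ (v k) ξ := by
  simp [blockMap_apply, sum_inner, inner_smul_left]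

theorem IsUniformFrame.surjective_blockMap {W c₀ : ℝ} (hc₀ : 0 < c₀) {v : Fin K → V}
    (hv : IsUniformFrame W c₀ v) : Function.Surjective (blockMap v) := by
  rw [← LinearMap.range_eq_top, ← Submodule.orthogonal_eq_bot_iff, Submodule.eq_bot_iff]
  intro ξ hξ
  have h1 : ∀ k, inner ℝ (v k) ξ = 0 := fun k => by
    refine Submodule.inner_right_of_mem_orthogonal (K := LinearMap.range (blockMap v)) ?_ hξ
    exact ⟨EuclideanSpace.single k 1, by simp [blockMap_apply]⟩
  have h2 := hv.le_sum ξ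
  simp only [h1, ne_eq, OfNat.ofNat_ne_zero, not_false_eq_true, zero_pow,
    Finset.sum_const_zero] at h2
  have h3 : ‖ξ‖ ^ 2 ≤ 0 := by nlinarith
  exact norm_eq_zero.1 (pow_eq_zero_iff two_ne_zero |>.1 (le_antisymm h3 (sq_nonneg _)))

theorem IsSiteDensity.le_exp {A B b : ℝ} {ρ : ℝ → ℝ} (h : IsSiteDensity A B b ρ) (hA : 0 < A)
    (z : ℝ) : ρ z ≤ A * Real.exp (b ^ 2 / 2) * Real.exp (-(1 / 4 * z ^ 2)) := by
  refine (h.upper z).trans ?_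
  rw [mul_assoc, ← Real.exp_add]
  gcongr
  rw [gaussianPDFReal]
  have h1 : (√(2 * Real.pi * (1 : NNReal)))⁻¹ ≤ 1 := by
    refine inv_le_one_of_one_le₀ (Real.one_le_sqrt.2 ?_)
    simp only [NNReal.coe_one, mul_one]
    linarith [Real.pi_gt_three]
  refine (mul_le_of_le_one_left (Real.exp_pos _).le h1).trans (Real.exp_le_exp.2 ?_)
  simp only [NNReal.coe_one, mul_one]
  nlinarith [sq_nonneg (z / 2 - b)]

theorem abs_prod_siteDensity_le {A B : ℝ} (hA : 0 < A) {b : Fin K → ℝ} {ρ : Fin K → ℝ → ℝ}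
    (hρ : ∀ k, IsSiteDensity A B (b k) (ρ k)) (x : EuclideanSpace ℝ (Fin K)) :
    |∏ k, ρ k (x k)| ≤ (∏ k, A * Real.exp (b k ^ 2 / 2)) * Real.exp (-(1 / 4 * ‖x‖ ^ 2)) := by
  rw [abs_of_pos (Finset.prod_pos fun k _ => (hρ k).pos hA _), EuclideanSpace.real_norm_sq_eq,
    Finset.mul_sum, ← Finset.sum_neg_distrib, Real.exp_sum, ← Finset.prod_mul_distrib]
  exact Finset.prod_le_prod (fun k _ => ((hρ k).pos hA _).le) fun k _ => (hρ k).le_exp hA _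

/-- The characteristic function of the block variable under a product density factorizes. -/
theorem integral_cexp_mul_prod (v : Fin K → V) (ρ : Fin K → ℝ → ℝ) (ξ : V) :
    ∫ x : EuclideanSpace ℝ (Fin K),
      Complex.exp ((-2 * Real.pi * inner ℝ (blockMap v x) ξ : ℝ) * Complex.I) *
        ((∏ k, ρ k (x k) : ℝ) : ℂ)
      = ∏ k, 𝓕 (fun z => (ρ k z : ℂ)) (inner ℝ (v k) ξ) := by
  have h1 := (EuclideanSpace.volume_preserving_symm_measurableEquiv_toLp (Fin K)).integral_comp
    (MeasurableEquiv.measurableEmbedding _) (fun x : Fin K → ℝ =>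
      ∏ k, (Complex.exp ((-2 * Real.pi * x k * inner ℝ (v k) ξ : ℝ) * Complex.I) * (ρ k (x k) : ℂ)))
  rw [integral_fintype_prod_volume_eq_prod (fun k z =>
    Complex.exp ((-2 * Real.pi * z * inner ℝ (v k) ξ : ℝ) * Complex.I) * (ρ k z : ℂ))] at h1
  simp only [Real.fourier_real_eq_integral_exp_smul, smul_eq_mul]
  rw [← h1]
  refine integral_congr_ae (ae_of_all _ fun x => ?_)
  dsimp only
  rw [Finset.prod_mul_distrib, ← Complex.exp_sum, ← Finset.sum_mul, ← Complex.ofReal_sum,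
    ← Complex.ofReal_prod, inner_blockMap, Finset.mul_sum]
  simp only [mul_assoc]
  rfl

/-- Tilting and recentring: along the fibres, the Gibbs weight and the product of the recentred
tilted site densities differ by an exponential of a linear form in the macroscopic variable. -/
theorem kerIntegral_gibbsWeight_add {a C : ℝ} {δψ : ℝ → ℝ} (hc : Continuous δψ)
    (hb : ∀ z, |δψ z| ≤ C) (v : Fin K → V) (σ : V) (m x : EuclideanSpace ℝ (Fin K))
    (hm : ∀ k, m k = siteMean a δψ (inner ℝ (v k) σ)) :
    kerIntegral (blockMap v) (gibbsWeight (singleSite a δψ) K) (x + m)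
      = (∏ k, sitePartition a δψ (inner ℝ (v k) σ)) *
        Real.exp (-inner ℝ (blockMap v (x + m)) σ) *
        kerIntegral (blockMap v) (fun x => ∏ k, siteDensity a δψ (inner ℝ (v k) σ) (x k)) x := by
  rw [kerIntegral, kerIntegral, ← integral_const_mul]
  refine integral_congr_ae (ae_of_all _ fun z => ?_)
  have hz : blockMap v (x + m) = blockMap v (x + z + m) := by
    have : blockMap v z = 0 := z.2
    simp [this]
  have hZ : ∏ k, sitePartition a δψ (inner ℝ (v k) σ) ≠ 0 :=
    Finset.prod_ne_zero_iff.2 fun k _ => (sitePartition_pos hc hb _).ne'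
  simp only [siteDensity, siteWeight, Finset.prod_div_distrib, ← hm, ← Real.exp_sum]
  rw [mul_comm (∏ k, sitePartition a δψ (inner ℝ (v k) σ)), mul_assoc, mul_div_cancel₀ _ hZ,
    ← Real.exp_add, hz, inner_blockMap, gibbsWeight, hamiltonian, ← Finset.sum_neg_distrib,
    ← Finset.sum_neg_distrib, ← Finset.sum_add_distrib]
  congr 1
  refine Finset.sum_congr rfl fun k _ => ?_
  have h1 : (x + m + (z : EuclideanSpace ℝ (Fin K))) k = (x + z) k + m k := by
    simp only [PiLp.add_apply]; ring
  have h2 : (x + (z : EuclideanSpace ℝ (Fin K)) + m) k = (x + z) k + m k := rfl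
  rw [h1, h2]
  ring

/-- Local Cramér theorem: for long blocks, the negative logarithm of the density of the block
variable `∑ k, x k • v k` under the Gibbs weight is uniformly strictly convex with bounded
Hessian. -/
theorem exists_block_hessian_bounds (V : Type*) [NormedAddCommGroup V] [InnerProductSpace ℝ V]
    [FiniteDimensional ℝ V] [MeasurableSpace V] [BorelSpace V] {W c₀ : ℝ} (C B : ℝ)
    (hW : 0 < W) (hc₀ : 0 < c₀) :
    ∃ (K₀ : ℕ) (lam Lam : ℝ), 0 < K₀ ∧ 0 < lam ∧ 0 < Lam ∧
      ∀ (a : ℝ) (δψ : ℝ → ℝ), ContDiff ℝ 1 δψ → (∀ z, |δψ z| ≤ C) → (∀ z, |deriv δψ z| ≤ B) →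
      ∀ K : ℕ, K₀ ≤ K → ∀ v : Fin K → V, IsUniformFrame W c₀ v →
      ∃ f : V → ℝ,
        (∀ x, kerIntegral (blockMap v) (gibbsWeight (singleSite a δψ) K) x = f (blockMap v x)) ∧
        (∀ y, 0 < f y) ∧ ContDiff ℝ 2 f ∧
        ∀ u w : V, lam * ‖w‖ ^ 2 ≤ iteratedFDeriv ℝ 2 (fun y => -Real.log (f y)) u ![w, w] ∧
          iteratedFDeriv ℝ 2 (fun y => -Real.log (f y)) u ![w, w] ≤ Lam * ‖w‖ ^ 2 := by
  set A := Real.exp (2 * C) with hAdef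
  have hA : 0 < A := Real.exp_pos _
  obtain ⟨β, hβ, hdecay⟩ := IsSiteDensity.exists_norm_fourier_le A B hA
  obtain ⟨D, hD, hgauss⟩ := IsSiteDensity.exists_norm_fourier_sub_exp_le A B hA
  obtain ⟨K₀, m, I, hK₀, hm, hI, hmom⟩ := exists_moment_bounds V (D := D) hβ hW hc₀
  refine ⟨K₀, 4 * Real.pi ^ 2 * (m / I), 4 * Real.pi ^ 2 * (I / m + (I / m) ^ 2), hK₀,
    by positivity, by positivity, fun a δψ hc hb hd K hK v hv => ?_⟩
  set T := blockMap v with hT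
  obtain ⟨S, hTS, hS⟩ := exists_orthogonal_section (hv.surjective_blockMap hc₀)
  set f : V → ℝ := fun y => kerIntegral T (gibbsWeight (singleSite a δψ) K) (S y) with hf
  -- the representation of the density near an arbitrary point `u`
  have key : ∀ u : V, ∃ (P : V → ℝ) (σ : V) (Z : ℝ), 0 < Z ∧ (∀ y, 0 < P y) ∧ ContDiff ℝ 2 P ∧
      (∀ y, f y = Z * Real.exp (-inner ℝ y σ) * P (-u + y)) ∧
      ∀ w : V, 4 * Real.pi ^ 2 * (m / I) * ‖w‖ ^ 2
        ≤ iteratedFDeriv ℝ 2 (fun y => -Real.log (P y)) 0 ![w, w] ∧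
      iteratedFDeriv ℝ 2 (fun y => -Real.log (P y)) 0 ![w, w]
        ≤ 4 * Real.pi ^ 2 * (I / m + (I / m) ^ 2) * ‖w‖ ^ 2 := by
    intro u
    obtain ⟨σ, hσ⟩ := exists_sum_siteMean_smul_eq (a := a) hc.continuous hb hc₀ hv.le_sum u
    set ρ : Fin K → ℝ → ℝ := fun k => siteDensity a δψ (inner ℝ (v k) σ) with hρdef
    have hρ : ∀ k, IsSiteDensity A B
        (inner ℝ (v k) σ - a - siteMean a δψ (inner ℝ (v k) σ)) (ρ k) :=
      fun k => isSiteDensity_siteDensity hc hb hd _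
    have hχ : ∀ k, IsSiteTransform β D (𝓕 fun z => (ρ k z : ℂ)) := fun k =>
      { continuous := VectorFourier.fourierIntegral_continuous Real.continuous_fourierChar
          (by exact continuous_inner) ((hρ k).integrable hA).ofReal
        norm_le := hdecay _ _ (hρ k)
        norm_sub_le := hgauss _ _ (hρ k) }
    set g : EuclideanSpace ℝ (Fin K) → ℝ := fun x => ∏ k, ρ k (x k) with hg
    have hgc : Continuous g := continuous_finsetProd _ fun k _ =>
      (hρ k).contDiff.continuous.comp (by fun_prop)
    have hg0 : ∀ x, 0 < g x := fun x => Finset.prod_pos fun k _ => (hρ k).pos hA _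
    have hgA := abs_prod_siteDensity_le hA hρ
    have h4 : (0 : ℝ) < 1 / 4 := by norm_num
    set P : V → ℝ := fun y => kerIntegral T g (S y) with hP
    have hPpos : ∀ y, 0 < P y := kerIntegral_section_pos hgc hg0 hS h4 hgA
    have hPc : Continuous P := continuous_kerIntegral_section hgc hS h4 hgA
    obtain ⟨κ, hκ, hfour⟩ := exists_fourier_kerIntegral T S hTS
    obtain ⟨hPi, hPF⟩ := hfour g (integrable_of_abs_le_exp hgc h4 hgA)
    obtain ⟨hXi, hXI, hX0, hX2⟩ := hmom K hK v hv _ hχ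
    set X : V → ℂ := fun ξ => ∏ k, 𝓕 (fun z => (ρ k z : ℂ)) (inner ℝ (v k) ξ) with hX
    have hXc : Continuous X := continuous_finsetProd _ fun k _ =>
      (hχ k).continuous.comp (by fun_prop)
    have hFP : 𝓕 (fun y => (P y : ℂ)) = fun ξ => (κ : ℂ) • X ξ := by
      ext ξ
      rw [hPF ξ, smul_eq_mul]
      exact congrArg _ (integral_cexp_mul_prod v ρ ξ)
    have hX1 : Integrable X := hXi.mono' hXc.aestronglyMeasurable (ae_of_all _ fun ξ => by
      have := mul_nonneg (sq_nonneg ‖ξ‖) (norm_nonneg (X ξ))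
      have h5 : (1 + ‖ξ‖ ^ 2) * ‖X ξ‖ = ‖X ξ‖ + ‖ξ‖ ^ 2 * ‖X ξ‖ := by ring
      change ‖X ξ‖ ≤ (1 + ‖ξ‖ ^ 2) * ‖X ξ‖
      linarith)
    have hinv : ∀ y, (P y : ℂ) = κ * 𝓕⁻ X y := fun y => by
      have h5 := Continuous.fourierInv_fourier_eq (f := fun y => (P y : ℂ)) (by fun_prop) hPi
        (by rw [hFP]; exact hX1.const_mul _)
      rw [← congrFun h5 y, hFP, Real.fourierInv_eq, Real.fourierInv_eq, ← integral_const_mul]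
      refine integral_congr_ae (ae_of_all _ fun ξ => ?_)
      dsimp only
      rw [smul_comm, smul_eq_mul]
    obtain ⟨hP2, hPH⟩ := hessian_neg_log_fourierInv hκ hm hPpos hXc hXi hinv hXI hX0 hX2
    refine ⟨P, σ, ∏ k, sitePartition a δψ (inner ℝ (v k) σ),
      Finset.prod_pos fun k _ => sitePartition_pos hc.continuous hb _, hPpos, hP2, fun y => ?_, hPH⟩
    set μ : EuclideanSpace ℝ (Fin K) :=
      WithLp.toLp 2 fun k => siteMean a δψ (inner ℝ (v k) σ) with hμ
    have hTμ : T μ = u := hσ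
    have hTy : T (S (-u + y) + μ) = y := by rw [map_add, hTS, hTμ]; abel
    have h5 := kerIntegral_gibbsWeight_add (a := a) hc.continuous hb v σ μ (S (-u + y))
      fun k => rfl
    rw [← hT, hTy] at h5
    rw [hf, ← h5]
    exact kerIntegral_congr _ (by rw [hTS, hTy])
  refine ⟨f, fun x => kerIntegral_congr _ (by rw [hTS]), fun y => ?_, ?_, fun u w => ?_⟩
  · obtain ⟨P, σ, Z, hZ, hP, -, hfP, -⟩ := key 0
    rw [hfP]
    exact mul_pos (mul_pos hZ (Real.exp_pos _)) (hP _)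
  · obtain ⟨P, σ, Z, hZ, hP, hP2, hfP, -⟩ := key 0
    rw [funext hfP]
    have : ContDiff ℝ 2 fun y => P (-0 + y) := hP2.comp (by fun_prop)
    exact (contDiff_const.mul (contDiff_id.inner ℝ contDiff_const).neg.exp).mul this
  · obtain ⟨P, σ, Z, hZ, hP, hP2, hfP, hH⟩ := key u
    have h1 : (fun y => -Real.log (f y))
        = fun y => -Real.log (P (-u + y)) + (innerSL ℝ σ y + -Real.log Z) := by
      ext y
      rw [hfP, Real.log_mul (mul_pos hZ (Real.exp_pos _)).ne' (hP _).ne',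
        Real.log_mul hZ.ne' (Real.exp_pos _).ne', Real.log_exp, innerSL_apply_apply,
        real_inner_comm]
      ring
    have hlog : ContDiff ℝ 2 fun y => -Real.log (P y) := (hP2.log fun y => (hP y).ne').neg
    have h2 : ContDiff ℝ 2 fun y => -Real.log (P (-u + y)) := hlog.comp (by fun_prop)
    rw [h1, iteratedFDeriv_two_add_affine h2,
      iteratedFDeriv_comp_add_left (f := fun y => -Real.log (P y)), neg_add_cancel]
    exact hH w

end Block

/-! ### Factorization of the fibre integral over the blocks -/

section Factorization

/-- The Hausdorff measure of the right dimension on a fibre is the translate of Lebesgue measure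
on the kernel. -/
theorem fibreIntegral_eq_kerIntegral (ψ : ℝ → ℝ) (L M N : ℕ) [NeZero M]
    (x : EuclideanSpace ℝ (Fin N)) :
    fibreIntegral ψ L M N (coarseMap L M N x)
      = kerIntegral (coarseMap L M N) (gibbsWeight ψ N) x := by
  set T := coarseMap L M N with hT
  set ι : LinearMap.ker T → EuclideanSpace ℝ (Fin N) := fun z => x + z with hι
  have hiso : Isometry ι := (isometry_add_left x).comp isometry_subtype_coe
  have hrange : range ι = fibre L M N (T x) := by
    ext x'
    constructor
    · rintro ⟨z, rfl⟩
      have hz : T z = 0 := z.2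
      simp [fibre, hι, ← hT, hz]
    · intro hx'
      have hx'' : T x' = T x := hx'
      exact ⟨⟨x' - x, by rw [LinearMap.mem_ker, map_sub, hx'', sub_self]⟩, by simp [hι]⟩
  have hemb : MeasurableEmbedding ι := hiso.isClosedEmbedding.measurableEmbedding
  rw [fibreIntegral, ← hT, ← hrange, ← hiso.map_euclideanHausdorffMeasure,
    InnerProductSpace.euclideanHausdorffMeasure_eq_volume, hemb.integral_map]
  rfl

/-- Sites of the fine mesh, indexed by the coarse cell and the position within it. -/
def siteEquiv (K M : ℕ) : Fin M × Fin K ≃ Fin (K * M) :=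
  finProdFinEquiv.trans (finCongr (mul_comm M K))

theorem siteEquiv_val {K M : ℕ} (m : Fin M) (k : Fin K) :
    (siteEquiv K M (m, k) : ℕ) = k + K * m := rfl

/-- The restriction of a configuration to the `m`-th block. -/
noncomputable def blockRestrict (K M : ℕ) (m : Fin M) :
    EuclideanSpace ℝ (Fin (K * M)) →ₗ[ℝ] EuclideanSpace ℝ (Fin K) where
  toFun x := WithLp.toLp 2 fun k => x (siteEquiv K M (m, k))
  map_add' x y := by ext; simp
  map_smul' c x := by ext; simp

theorem blockRestrict_apply {K M : ℕ} (m : Fin M) (x : EuclideanSpace ℝ (Fin (K * M)))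
    (k : Fin K) : blockRestrict K M m x k = x (siteEquiv K M (m, k)) := rfl

/-- The configuration with prescribed blocks. -/
noncomputable def ofBlocks (K M : ℕ) (x : Fin M → EuclideanSpace ℝ (Fin K)) :
    EuclideanSpace ℝ (Fin (K * M)) :=
  WithLp.toLp 2 fun j => x ((siteEquiv K M).symm j).1 ((siteEquiv K M).symm j).2

theorem blockRestrict_ofBlocks {K M : ℕ} (x : Fin M → EuclideanSpace ℝ (Fin K)) (m : Fin M) :
    blockRestrict K M m (ofBlocks K M x) = x m := by
  ext k
  simp [blockRestrict_apply, ofBlocks]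

theorem ofBlocks_blockRestrict {K M : ℕ} (x : EuclideanSpace ℝ (Fin (K * M))) :
    ofBlocks K M (fun m => blockRestrict K M m x) = x := by
  ext j
  simp [blockRestrict_apply, ofBlocks]

theorem gibbsWeight_eq_prod (ψ : ℝ → ℝ) {K M : ℕ} (x : EuclideanSpace ℝ (Fin (K * M))) :
    gibbsWeight ψ (K * M) x = ∏ m, gibbsWeight ψ K (blockRestrict K M m x) := by
  simp only [gibbsWeight, hamiltonian]
  rw [← Real.exp_sum, ← (siteEquiv K M).sum_comp, Fintype.sum_prod_type, Finset.sum_neg_distrib]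
  rfl

variable {V V' : Type*} [NormedAddCommGroup V] [InnerProductSpace ℝ V]
  [NormedAddCommGroup V'] [InnerProductSpace ℝ V']

/-- If the kernel of `T` is the product of the kernels of `T₁` over the blocks, the fibre integral
of the Gibbs weight factorizes, up to a constant. -/
theorem exists_kerIntegral_eq_prod (ψ : ℝ → ℝ) {K M : ℕ}
    (T : EuclideanSpace ℝ (Fin (K * M)) →ₗ[ℝ] V') (T₁ : EuclideanSpace ℝ (Fin K) →ₗ[ℝ] V)
    (hT : ∀ x, T x = 0 ↔ ∀ m, T₁ (blockRestrict K M m x) = 0) :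
    ∃ κ : ℝ, 0 < κ ∧ ∀ x, kerIntegral T (gibbsWeight ψ (K * M)) x
      = κ * ∏ m, kerIntegral T₁ (gibbsWeight ψ K) (blockRestrict K M m x) := by
  let Φ : LinearMap.ker T ≃ₗ[ℝ] (Fin M → LinearMap.ker T₁) :=
    { toFun := fun z m => ⟨blockRestrict K M m z, (hT z).1 z.2 m⟩
      invFun := fun w => ⟨ofBlocks K M fun m => w m, (hT _).2 fun m => by
        rw [blockRestrict_ofBlocks]; exact (w m).2⟩
      map_add' := fun z w => by ext m; simp
      map_smul' := fun c z => by ext m; simp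
      left_inv := fun z => by ext1; exact ofBlocks_blockRestrict _
      right_inv := fun w => by
        ext1 m
        ext1
        exact blockRestrict_ofBlocks (fun m => (w m : EuclideanSpace ℝ (Fin K))) m }
  obtain ⟨κ, hκ, h⟩ := exists_integral_comp_eq (volume : Measure (LinearMap.ker T))
    (volume : Measure (Fin M → LinearMap.ker T₁)) Φ.toContinuousLinearEquiv
  refine ⟨κ, hκ, fun x => ?_⟩
  have h1 := (h fun w : Fin M → LinearMap.ker T₁ =>
    ∏ m, gibbsWeight ψ K (blockRestrict K M m x + w m)).2
  rw [integral_fintype_prod_volume_eq_prod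
    (fun m (w : LinearMap.ker T₁) => gibbsWeight ψ K (blockRestrict K M m x + w))] at h1
  refine Eq.trans ?_ h1
  refine integral_congr_ae (ae_of_all _ fun z => ?_)
  simp only [gibbsWeight_eq_prod, map_add]
  rfl

end Factorization

/-! ### Orthonormal polynomials and the frame of cell averages -/

section Polynomials

theorem intervalIntegrable_eval (p : ℝ[X]) (a b : ℝ) :
    IntervalIntegrable (fun x => p.eval x) volume a b :=
  p.continuous.intervalIntegrable _ _

theorem eq_zero_of_integral_sq_eq_zero {p : ℝ[X]} (h : ∫ x in (0 : ℝ)..1, p.eval x * p.eval x = 0) :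
    p = 0 := by
  have hc : Continuous fun x => p.eval x * p.eval x := by fun_prop
  by_contra hp
  have hroots : {x | p.IsRoot x}.Finite := finite_setOfPred_isRoot hp
  have hex : ∃ x ∈ Ioo (0 : ℝ) 1, ¬ p.IsRoot x := by
    by_contra! hall
    exact (Ioo_infinite (zero_lt_one' ℝ)) (hroots.subset fun x hx => hall x hx)
  obtain ⟨x, hx, hpx⟩ := hex
  have hpos : 0 < ∫ x in (0 : ℝ)..1, p.eval x * p.eval x := by
    refine intervalIntegral.integral_pos zero_lt_one hc.continuousOn
      (fun y _ => mul_self_nonneg _) ⟨x, Ioo_subset_Icc_self hx, ?_⟩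
    exact lt_of_le_of_ne (mul_self_nonneg _) (Ne.symm (mul_self_ne_zero.2 hpx))
  exact hpos.ne' h

/-- Polynomials orthonormal on `[0, 1]` spanning the polynomials of degree at most `L`. -/
structure IsOrthonormalPoly (L : ℕ) {d : ℕ} (p : Fin d → ℝ[X]) : Prop where
  natDegree_le : ∀ i, (p i).natDegree ≤ L
  integral_mul : ∀ i j, ∫ x in (0 : ℝ)..1, (p i).eval x * (p j).eval x = if i = j then 1 else 0
  exists_eq_sum : ∀ q : ℝ[X], q.natDegree ≤ L → ∃ α : Fin d → ℝ, q = ∑ i, α i • p i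

theorem exists_isOrthonormalPoly (L : ℕ) :
    ∃ (d : ℕ) (p : Fin d → ℝ[X]), IsOrthonormalPoly L p := by
  let U := Polynomial.degreeLT ℝ (L + 1)
  have hfin : Module.Finite ℝ U := Module.Finite.equiv (Polynomial.degreeLTEquiv ℝ (L + 1)).symm
  have hi : ∀ p q : ℝ[X], IntervalIntegrable (fun x => p.eval x * q.eval x) volume 0 1 :=
    fun p q => Continuous.intervalIntegrable (by fun_prop) _ _
  let core : InnerProductSpace.Core ℝ U :=
    { inner := fun p q => ∫ x in (0 : ℝ)..1, (p : ℝ[X]).eval x * (q : ℝ[X]).eval x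
      conj_inner_symm := fun p q => by simp [mul_comm]
      re_inner_nonneg := fun p => intervalIntegral.integral_nonneg zero_le_one fun x _ =>
        mul_self_nonneg _
      add_left := fun p q r => by
        simp only [Submodule.coe_add, eval_add, add_mul]
        exact intervalIntegral.integral_add (hi _ _) (hi _ _)
      smul_left := fun p q c => by
        simp [mul_assoc]
      definite := fun p h => by
        ext1
        exact eq_zero_of_integral_sq_eq_zero h }
  let : NormedAddCommGroup U := core.toNormedAddCommGroup
  let : InnerProductSpace ℝ U := InnerProductSpace.ofCore core.toCore
  let b := stdOrthonormalBasis ℝ U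
  refine ⟨_, fun i => (b i : ℝ[X]), fun i => ?_, fun i j => ?_, fun q hq => ?_⟩
  · have h1 := Polynomial.mem_degreeLT.1 (b i).2
    exact natDegree_le_iff_coeff_eq_zero.2 fun n hn =>
      coeff_eq_zero_of_degree_lt (h1.trans_le (by exact_mod_cast hn))
  · exact orthonormal_iff_ite.1 b.orthonormal i j
  · have hqU : q ∈ U := Polynomial.mem_degreeLT.2
      (lt_of_le_of_lt Polynomial.degree_le_natDegree (by exact_mod_cast Nat.lt_succ_iff.2 hq))
    refine ⟨fun i => b.repr ⟨q, hqU⟩ i, ?_⟩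
    have h1 := congrArg (fun p : U => (p : ℝ[X])) (b.sum_repr ⟨q, hqU⟩)
    simpa using h1.symm

variable {d : ℕ}

/-- The vector of rescaled averages of the polynomials `p i` over the `k`-th of `K` cells. -/
noncomputable def cellVector (p : Fin d → ℝ[X]) (K : ℕ) (k : Fin K) : EuclideanSpace ℝ (Fin d) :=
  WithLp.toLp 2 fun i => √K * ∫ x in ((k : ℝ) / K)..(((k : ℝ) + 1) / K), (p i).eval x

theorem inner_cellVector (p : Fin d → ℝ[X]) {K : ℕ} (k : Fin K) (ξ : EuclideanSpace ℝ (Fin d)) :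
    inner ℝ (cellVector p K k) ξ
      = √K * ∫ x in ((k : ℝ) / K)..(((k : ℝ) + 1) / K), (∑ i, ξ i • p i).eval x := by
  simp only [eval_finsetSum, eval_smul, smul_eq_mul]
  rw [intervalIntegral.integral_finsetSum fun i _ => (intervalIntegrable_eval _ _ _).const_mul _,
    Finset.mul_sum]
  simp only [intervalIntegral.integral_const_mul, PiLp.inner_apply, cellVector,
    RCLike.inner_apply, conj_trivial]
  exact Finset.sum_congr rfl fun i _ => by ring

theorem IsOrthonormalPoly.integral_sum_sq {L : ℕ} {p : Fin d → ℝ[X]} (hp : IsOrthonormalPoly L p)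
    (ξ : EuclideanSpace ℝ (Fin d)) :
    ∫ x in (0 : ℝ)..1, (∑ i, ξ i • p i).eval x ^ 2 = ‖ξ‖ ^ 2 := by
  have h1 : ∀ x, (∑ i, ξ i • p i).eval x ^ 2
      = ∑ i, ∑ j, ξ i * ξ j * ((p i).eval x * (p j).eval x) := fun x => by
    simp only [eval_finsetSum, eval_smul, smul_eq_mul, sq, Finset.sum_mul_sum]
    exact Finset.sum_congr rfl fun i _ => Finset.sum_congr rfl fun j _ => by ring
  simp_rw [h1]
  rw [intervalIntegral.integral_finsetSum fun i _ => Continuous.intervalIntegrable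
    (by fun_prop) _ _]
  have h2 : ∀ i, ∫ x in (0 : ℝ)..1, ∑ j, ξ i * ξ j * ((p i).eval x * (p j).eval x) = ξ i ^ 2 :=
    fun i => by
    rw [intervalIntegral.integral_finsetSum fun j _ => Continuous.intervalIntegrable
      (by fun_prop) _ _]
    simp only [intervalIntegral.integral_const_mul, hp.integral_mul]
    simp [sq]
  simp_rw [h2]
  rw [EuclideanSpace.real_norm_sq_eq]

/-- A common bound and Lipschitz constant on `[0, 1]` for finitely many polynomials. -/
theorem exists_bound_lipschitz (p : Fin d → ℝ[X]) : ∃ B : ℝ, 0 < B ∧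
    (∀ i, ∀ x ∈ Icc (0 : ℝ) 1, |(p i).eval x| ≤ B) ∧
    ∀ i, ∀ x ∈ Icc (0 : ℝ) 1, ∀ y ∈ Icc (0 : ℝ) 1,
      |(p i).eval x - (p i).eval y| ≤ B * |x - y| := by
  have h1 : ∀ q : ℝ[X], ∃ B : ℝ, ∀ x ∈ Icc (0 : ℝ) 1, |q.eval x| ≤ B := fun q =>
    isCompact_Icc.exists_bound_of_continuousOn q.continuous.continuousOn
  choose B₀ hB₀ using fun i => h1 (p i)
  choose B₁ hB₁ using fun i => h1 (derivative (p i))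
  set B := 1 + ∑ i, (|B₀ i| + |B₁ i|) with hB
  have hle : ∀ i, |B₀ i| + |B₁ i| ≤ B := fun i => by
    have := Finset.single_le_sum (f := fun i => |B₀ i| + |B₁ i|) (fun i _ => by positivity)
      (Finset.mem_univ i)
    rw [hB]
    linarith
  refine ⟨B, by positivity, fun i x hx => ?_, fun i x hx y hy => ?_⟩
  · have := hB₀ i x hx
    linarith [le_abs_self (B₀ i), abs_nonneg (B₁ i), hle i]
  · have := Convex.norm_image_sub_le_of_norm_deriv_le (f := fun x => (p i).eval x) (C := B)
      (s := Icc (0 : ℝ) 1) (x := y) (y := x) (fun x _ => (p i).differentiable x)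
      (fun z hz => by
        rw [Polynomial.deriv]
        have := hB₁ i z hz
        rw [Real.norm_eq_abs]
        linarith [le_abs_self (B₁ i), abs_nonneg (B₀ i), hle i]) (convex_Icc _ _) hy hx
    simpa using this

/-- For fine meshes the vectors of cell averages of orthonormal polynomials form a frame, because
a Riemann sum of cell averages approximates the `L²` norm. -/
theorem IsOrthonormalPoly.exists_isUniformFrame {L : ℕ} {p : Fin d → ℝ[X]}
    (hp : IsOrthonormalPoly L p) :
    ∃ (W : ℝ) (K₁ : ℕ), 0 < W ∧ ∀ K : ℕ, K₁ ≤ K → 0 < K →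
      IsUniformFrame W (1 / 4) (cellVector p K) := by
  obtain ⟨B, hB0, hB, hLip⟩ := exists_bound_lipschitz p
  obtain ⟨K₁, hK₁⟩ := exists_nat_gt (2 * (d * B))
  refine ⟨√(d * B ^ 2 + 1), K₁, by positivity, fun K hK hK0 => ?_⟩
  have hKr : (0 : ℝ) < K := by exact_mod_cast hK0
  have hlen : ∀ k : Fin K, ((k : ℝ) + 1) / K - (k : ℝ) / K = 1 / K := fun k => by ring
  have hlt : ∀ k : Fin K, (k : ℝ) / K ≤ ((k : ℝ) + 1) / K := fun k => by gcongr; linarith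
  have hmem : ∀ (k : Fin K), ∀ x ∈ Icc ((k : ℝ) / K) (((k : ℝ) + 1) / K), x ∈ Icc (0 : ℝ) 1 :=
    fun k x hx => by
    have hk : (k : ℝ) + 1 ≤ K := by exact_mod_cast k.isLt
    exact ⟨le_trans (by positivity) hx.1, hx.2.trans ((div_le_one hKr).2 hk)⟩
  refine ⟨fun k => ?_, fun ξ => ?_⟩
  · rw [EuclideanSpace.real_norm_sq_eq, Real.sq_sqrt (by positivity)]
    have h1 : ∀ i, (cellVector p K k i) ^ 2 ≤ B ^ 2 / K := fun i => by
      have h2 : |∫ x in ((k : ℝ) / K)..(((k : ℝ) + 1) / K), (p i).eval x| ≤ B * (1 / K) := by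
        have := intervalIntegral.norm_integral_le_of_norm_le_const (f := fun x => (p i).eval x)
          (C := B) (a := (k : ℝ) / K) (b := ((k : ℝ) + 1) / K) (fun x hx => by
            rw [uIoc_of_le (hlt k)] at hx
            exact hB i x (hmem k x ⟨hx.1.le, hx.2⟩))
        rw [hlen, abs_of_pos (by positivity)] at this
        exact this
      have h3 : cellVector p K k i
        = √K * ∫ x in ((k : ℝ) / K)..(((k : ℝ) + 1) / K), (p i).eval x := rfl
      rw [h3, mul_pow, Real.sq_sqrt hKr.le, ← sq_abs]
      calc _ ≤ (K : ℝ) * (B * (1 / K)) ^ 2 := by gcongr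
        _ = _ := by field_simp
    calc _ ≤ ∑ _i : Fin d, B ^ 2 / K := Finset.sum_le_sum fun i _ => h1 i
      _ = d * B ^ 2 / K := by simp; ring
      _ ≤ _ := by gcongr; linarith
  · set q := ∑ i, ξ i • p i with hq
    have hqc : Continuous fun x => q.eval x := q.continuous
    set Λ := d * B * ‖ξ‖ with hΛ
    have hΛ0 : 0 ≤ Λ := by positivity
    have hqLip : ∀ x ∈ Icc (0 : ℝ) 1, ∀ y ∈ Icc (0 : ℝ) 1, |q.eval x - q.eval y| ≤ Λ * |x - y| := by
      intro x hx y hy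
      simp only [hq, eval_finsetSum, eval_smul, smul_eq_mul]
      rw [← Finset.sum_sub_distrib]
      refine (Finset.abs_sum_le_sum_abs _ _).trans ?_
      calc _ ≤ ∑ _i : Fin d, ‖ξ‖ * (B * |x - y|) := by
            refine Finset.sum_le_sum fun i _ => ?_
            rw [← mul_sub, abs_mul]
            exact mul_le_mul (PiLp.norm_apply_le ξ i) (hLip i x hx y hy) (abs_nonneg _)
              (norm_nonneg _)
        _ = _ := by simp [hΛ]; ring
    -- on each cell, `q` differs from its average by at most `Λ / K`
    have hcell : ∀ k : Fin K, ∫ x in ((k : ℝ) / K)..(((k : ℝ) + 1) / K), q.eval x ^ 2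
        ≤ 2 * inner ℝ (cellVector p K k) ξ ^ 2 + 2 * (Λ / K) ^ 2 / K := fun k => by
      set J := ∫ x in ((k : ℝ) / K)..(((k : ℝ) + 1) / K), q.eval x with hJ
      have hdiff : ∀ x ∈ Icc ((k : ℝ) / K) (((k : ℝ) + 1) / K), |q.eval x - K * J| ≤ Λ / K := by
        intro x hx
        have h1 : q.eval x - K * J
            = K * ∫ y in ((k : ℝ) / K)..(((k : ℝ) + 1) / K), (q.eval x - q.eval y) := by
          rw [intervalIntegral.integral_sub (by simp) (intervalIntegrable_eval _ _ _),
            intervalIntegral.integral_const, hlen, smul_eq_mul, mul_sub, ← hJ]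
          field_simp
        have h2 := intervalIntegral.norm_integral_le_of_norm_le_const
          (f := fun y => q.eval x - q.eval y)
          (C := Λ / K) (a := (k : ℝ) / K) (b := ((k : ℝ) + 1) / K) (fun y hy => by
            rw [uIoc_of_le (hlt k)] at hy
            refine (hqLip x (hmem k x hx) y (hmem k y ⟨hy.1.le, hy.2⟩)).trans ?_
            have h3 : |x - y| ≤ 1 / K := by
              rw [← hlen k, abs_le]
              constructor <;> linarith [hx.1, hx.2, hy.1, hy.2]
            calc Λ * |x - y| ≤ Λ * (1 / K) := by gcongr
              _ = Λ / K := by ring)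
        rw [hlen, abs_of_pos (by positivity), Real.norm_eq_abs] at h2
        rw [h1, abs_mul, abs_of_pos hKr]
        calc _ ≤ (K : ℝ) * (Λ / K * (1 / K)) := by gcongr
          _ = _ := by field_simp
      have h4 : ∀ x ∈ Icc ((k : ℝ) / K) (((k : ℝ) + 1) / K),
          q.eval x ^ 2 ≤ 2 * (K * J) ^ 2 + 2 * (Λ / K) ^ 2 := fun x hx => by
        have h5 := hdiff x hx
        have h6 : (q.eval x - K * J) ^ 2 ≤ (Λ / K) ^ 2 := by
          rw [← sq_abs]
          gcongr
        nlinarith [sq_nonneg (q.eval x - 2 * (K * J))]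
      have h7 := intervalIntegral.integral_mono_on (hlt k)
        ((hqc.pow 2).intervalIntegrable (μ := volume) _ _) (by simp) h4
      rw [intervalIntegral.integral_const, hlen, smul_eq_mul] at h7
      rw [inner_cellVector, ← hq, ← hJ, mul_pow, Real.sq_sqrt hKr.le]
      refine h7.trans (le_of_eq ?_)
      field_simp
    have hsum : ∑ k : Fin K, ∫ x in ((k : ℝ) / K)..(((k : ℝ) + 1) / K), q.eval x ^ 2 = ‖ξ‖ ^ 2 := by
      rw [← hp.integral_sum_sq ξ]
      have h1 := intervalIntegral.sum_integral_adjacent_intervals (μ := volume)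
        (f := fun x => q.eval x ^ 2)
        (a := fun k : ℕ => (k : ℝ) / K) (n := K)
        (fun k _ => (hqc.pow 2).intervalIntegrable _ _)
      rw [Finset.sum_range] at h1
      simp only [Nat.cast_add, Nat.cast_one, Nat.cast_zero, zero_div, div_self hKr.ne'] at h1
      exact h1
    have htot := Finset.sum_le_sum fun k (_ : k ∈ Finset.univ) => hcell k
    rw [hsum, Finset.sum_add_distrib, ← Finset.mul_sum] at htot
    have hconst : ∑ _k : Fin K, 2 * (Λ / K) ^ 2 / K = 2 * (Λ / K) ^ 2 := by
      simp
      field_simp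
    have hsmall : (Λ / K) ^ 2 ≤ 1 / 4 * ‖ξ‖ ^ 2 := by
      have h1 : 2 * (d * B) ≤ K := hK₁.le.trans (by exact_mod_cast hK)
      have h2 : Λ / K ≤ 1 / 2 * ‖ξ‖ := by
        rw [div_le_iff₀ hKr, hΛ]
        nlinarith [norm_nonneg ξ]
      calc _ ≤ (1 / 2 * ‖ξ‖) ^ 2 := by gcongr
        _ = _ := by ring
    rw [hconst] at htot
    linarith

end Polynomials

/-! ### An orthonormal basis of the discontinuous Galerkin space -/

section Basis

theorem cell_subset {M : ℕ} (m : Fin M) : cell M m ⊆ Ico (0 : ℝ) 1 := by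
  have hM : (0 : ℝ) < M := by exact_mod_cast m.pos
  have hm : (m : ℝ) + 1 ≤ M := by exact_mod_cast m.isLt
  intro θ hθ
  exact ⟨le_trans (by positivity) hθ.1, hθ.2.trans_le ((div_le_one hM).2 hm)⟩

/-- The polynomial `p` on `[0, 1)`, transplanted to the cell `m` and rescaled so as to keep its
`L²` norm. -/
noncomputable def cellPoly (M : ℕ) (m : Fin M) (p : ℝ[X]) : ℝ → ℝ :=
  (cell M m).indicator fun θ => √M * p.eval (M * θ - m)

theorem cellPoly_of_mem {M : ℕ} {m : Fin M} (p : ℝ[X]) {θ : ℝ} (h : θ ∈ cell M m) :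
    cellPoly M m p θ = √M * p.eval (M * θ - m) := indicator_of_mem h _

theorem cellPoly_of_mem_of_ne {M : ℕ} {m m' : Fin M} (p : ℝ[X]) {θ : ℝ} (h : θ ∈ cell M m')
    (hne : m' ≠ m) : cellPoly M m p θ = 0 :=
  indicator_of_notMem (fun h' => hne (cell_eq_of_mem h h')) _

theorem memLp_cellPoly (M : ℕ) (m : Fin M) (p : ℝ[X]) :
    MemLp (cellPoly M m p) 2 (volume.restrict (Ico (0 : ℝ) 1)) := by
  have hc : Continuous fun θ : ℝ => √M * p.eval (M * θ - m) := by fun_prop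
  obtain ⟨B, hB⟩ := isCompact_Icc.exists_bound_of_continuousOn
    (hc.continuousOn (s := Icc (0 : ℝ) 1))
  refine MemLp.of_bound (hc.measurable.indicator (measurableSet_cell M m)).aestronglyMeasurable
    B ?_
  filter_upwards [ae_restrict_mem measurableSet_Ico] with θ hθ
  exact (norm_indicator_le_norm_self _ _).trans (hB θ (Ico_subset_Icc_self hθ))

/-- `cellPoly` as a linear map into `L²(𝕋)`. -/
noncomputable def cellEmbed (M : ℕ) (m : Fin M) : ℝ[X] →ₗ[ℝ] L2Torus where
  toFun p := (memLp_cellPoly M m p).toLp _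
  map_add' p q := by
    rw [← MemLp.toLp_add]
    refine MemLp.toLp_congr _ _ (ae_of_all _ fun θ => ?_)
    by_cases h : θ ∈ cell M m <;> simp [cellPoly, h, mul_add]
  map_smul' c p := by
    rw [RingHom.id_apply, ← MemLp.toLp_const_smul]
    refine MemLp.toLp_congr _ _ (ae_of_all _ fun θ => ?_)
    by_cases h : θ ∈ cell M m <;> simp [cellPoly, h, mul_left_comm]

theorem coeFn_cellEmbed {M : ℕ} (m : Fin M) (p : ℝ[X]) :
    cellEmbed M m p =ᵐ[volume.restrict (Ico (0 : ℝ) 1)] cellPoly M m p :=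
  (memLp_cellPoly M m p).coeFn_toLp

/-- Rescaling of a subinterval of a cell to a subinterval of `[0, 1]`. -/
theorem setIntegral_rescale {M : ℕ} (m : Fin M) (f : ℝ → ℝ) {c d : ℝ} (hcd : c ≤ d) :
    ∫ θ in Ico ((m + c) / M) ((m + d) / M), f (M * θ - m) = (M : ℝ)⁻¹ * ∫ s in c..d, f s := by
  have hM : (0 : ℝ) < M := by exact_mod_cast m.pos
  rw [integral_Ico_eq_integral_Ioc, ← intervalIntegral.integral_of_le (by gcongr),
    intervalIntegral.integral_comp_mul_sub f hM.ne', smul_eq_mul, mul_div_cancel₀ _ hM.ne',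
    mul_div_cancel₀ _ hM.ne', add_sub_cancel_left, add_sub_cancel_left]

theorem inner_cellEmbed {M : ℕ} (m m' : Fin M) (p q : ℝ[X]) :
    inner ℝ (cellEmbed M m p) (cellEmbed M m' q)
      = if m = m' then ∫ s in (0 : ℝ)..1, p.eval s * q.eval s else 0 := by
  have hM : (0 : ℝ) < M := by exact_mod_cast m.pos
  have h1 : inner ℝ (cellEmbed M m p) (cellEmbed M m' q)
      = ∫ θ in Ico (0 : ℝ) 1, cellPoly M m p θ * cellPoly M m' q θ := by
    rw [L2.inner_def]
    refine integral_congr_ae ?_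
    filter_upwards [coeFn_cellEmbed m p, coeFn_cellEmbed m' q] with θ h h'
    rw [h, h']
    simp [mul_comm]
  rw [h1]
  split_ifs with h
  · subst h
    have h2 : ∀ θ, cellPoly M m p θ * cellPoly M m q θ
        = (cell M m).indicator (fun θ => M * (p.eval (M * θ - m) * q.eval (M * θ - m))) θ := by
      intro θ
      by_cases hθ : θ ∈ cell M m
      · rw [cellPoly_of_mem _ hθ, cellPoly_of_mem _ hθ, indicator_of_mem hθ]
        rw [mul_mul_mul_comm, Real.mul_self_sqrt hM.le]
      · simp [cellPoly, hθ]
    simp_rw [h2]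
    rw [setIntegral_indicator (measurableSet_cell M m), inter_eq_right.2 (cell_subset m),
      integral_const_mul]
    have h3 := setIntegral_rescale m (fun s => p.eval s * q.eval s) (zero_le_one' ℝ)
    rw [add_zero] at h3
    rw [cell, h3, mul_inv_cancel_left₀ hM.ne']
  · refine (integral_congr_ae (ae_of_all _ fun θ => ?_)).trans (integral_zero _ _)
    by_cases hθ : θ ∈ cell M m
    · simp [cellPoly_of_mem_of_ne q hθ h]
    · simp [cellPoly, hθ]

theorem cellEmbed_mem_dgSpace {L M : ℕ} (m : Fin M) {p : ℝ[X]} (hp : p.natDegree ≤ L) :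
    cellEmbed M m p ∈ dgSpace L M := by
  have h := fun m' : Fin M =>
    ae_restrict_of_ae_restrict_of_subset (Ioo_mesh_subset m') (coeFn_cellEmbed m p)
  intro m'
  by_cases hm : m' = m
  · subst hm
    refine ⟨C √M * p.comp (C (M : ℝ) * X - C (m' : ℝ)), ?_, ?_⟩
    · refine (natDegree_C_mul_le _ _).trans (natDegree_comp_le.trans ?_)
      have h1 : (C (M : ℝ) * X - C (m' : ℝ)).natDegree ≤ 1 := by compute_degree
      calc _ ≤ p.natDegree * 1 := by gcongr
        _ ≤ L := by simpa
    · filter_upwards [h m', ae_restrict_mem measurableSet_Ioo] with θ h1 h2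
      rw [h1, cellPoly_of_mem _ (Ioo_subset_Ico_self h2)]
      simp
  · refine ⟨0, by simp, ?_⟩
    filter_upwards [h m', ae_restrict_mem measurableSet_Ioo] with θ h1 h2
    rw [h1, cellPoly_of_mem_of_ne _ (Ioo_subset_Ico_self h2) hm, eval_zero]

variable {L d : ℕ} {p : Fin d → ℝ[X]}

theorem IsOrthonormalPoly.dgSpace_le_span (hp : IsOrthonormalPoly L p) {M : ℕ} (hM : 0 < M) :
    dgSpace L M ≤ Submodule.span ℝ
      (range fun k : Fin M × Fin d => cellEmbed M k.1 (p k.2)) := by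
  have hMr : (0 : ℝ) < M := by exact_mod_cast hM
  refine (CoarseGraining.dgSpace_le_span L M hM).trans (Submodule.span_le.2 ?_)
  rintro _ ⟨⟨m, l⟩, rfl⟩
  -- the monomial `θ ^ l` is a polynomial in the local variable `M * θ - m`
  set q : ℝ[X] := C (√M)⁻¹ * (C (M : ℝ)⁻¹ * (X + C (m : ℝ))) ^ (l : ℕ) with hq
  have hdeg : q.natDegree ≤ L := by
    refine (natDegree_C_mul_le _ _).trans (natDegree_pow_le.trans ?_)
    have h1 : (C (M : ℝ)⁻¹ * (X + C (m : ℝ))).natDegree ≤ 1 := by compute_degree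
    calc _ ≤ (l : ℕ) * 1 := by gcongr
      _ ≤ L := by have := l.isLt; omega
  obtain ⟨α, hα⟩ := hp.exists_eq_sum q hdeg
  have h2 : (memLp_monomial_cell M m l).toLp _ = cellEmbed M m q := by
    refine MemLp.toLp_congr _ (memLp_cellPoly M m q) (ae_of_all _ fun θ => ?_)
    by_cases hθ : θ ∈ cell M m
    · rw [cellPoly_of_mem _ hθ, indicator_of_mem hθ, hq]
      simp only [eval_mul, eval_C, eval_pow, eval_add, eval_X, sub_add_cancel]
      rw [mul_inv_cancel_left₀ (by positivity), inv_mul_cancel_left₀ hMr.ne']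
    · simp [cellPoly, hθ]
  change (memLp_monomial_cell M m l).toLp _ ∈ _
  rw [h2, hα, map_sum]
  refine Submodule.sum_mem _ fun i _ => ?_
  rw [map_smul]
  exact Submodule.smul_mem _ _ (Submodule.subset_span ⟨(m, i), rfl⟩)

/-- The orthonormal basis of the discontinuous Galerkin space made of the polynomials `p i`
transplanted to the cells. -/
noncomputable def IsOrthonormalPoly.dgBasis (hp : IsOrthonormalPoly L p) (M : ℕ) [NeZero M] :
    OrthonormalBasis (Fin M × Fin d) ℝ (dgSpace L M) :=
  OrthonormalBasis.mk
    (v := fun k => ⟨cellEmbed M k.1 (p k.2), cellEmbed_mem_dgSpace k.1 (hp.natDegree_le k.2)⟩)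
    (orthonormal_iff_ite.2 fun k k' => by
      rw [Submodule.coe_inner, inner_cellEmbed, hp.integral_mul]
      simp only [Prod.ext_iff, ite_and])
    (fun y _ => by
      have h := hp.dgSpace_le_span (NeZero.pos M) y.2
      have h1 : (range fun k : Fin M × Fin d => cellEmbed M k.1 (p k.2))
          = (dgSpace L M).subtype '' range fun k : Fin M × Fin d =>
            (⟨cellEmbed M k.1 (p k.2), cellEmbed_mem_dgSpace k.1 (hp.natDegree_le k.2)⟩ :
              dgSpace L M) := by
        rw [← range_comp]
        rfl
      rw [h1, ← Submodule.map_span] at h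
      obtain ⟨z, hz, hzy⟩ := h
      rwa [← Subtype.ext hzy])

theorem IsOrthonormalPoly.coe_dgBasis (hp : IsOrthonormalPoly L p) (M : ℕ) [NeZero M]
    (k : Fin M × Fin d) : (hp.dgBasis M k : L2Torus) = cellEmbed M k.1 (p k.2) := by
  rw [dgBasis, OrthonormalBasis.coe_mk]

/-- The coordinates of `y` on the cell `m`. -/
noncomputable def IsOrthonormalPoly.cellCoord (hp : IsOrthonormalPoly L p) (M : ℕ) [NeZero M]
    (m : Fin M) : dgSpace L M →L[ℝ] EuclideanSpace ℝ (Fin d) :=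
  LinearMap.toContinuousLinearMap
    { toFun := fun y => WithLp.toLp 2 fun i => (hp.dgBasis M).repr y (m, i)
      map_add' := fun y z => by ext i; simp
      map_smul' := fun c y => by ext i; simp }

theorem IsOrthonormalPoly.cellCoord_apply (hp : IsOrthonormalPoly L p) (M : ℕ) [NeZero M]
    (m : Fin M) (y : dgSpace L M) (i : Fin d) :
    hp.cellCoord M m y i = (hp.dgBasis M).repr y (m, i) := rfl

theorem IsOrthonormalPoly.sum_norm_cellCoord_sq (hp : IsOrthonormalPoly L p) (M : ℕ) [NeZero M]
    (y : dgSpace L M) : ∑ m, ‖hp.cellCoord M m y‖ ^ 2 = ‖y‖ ^ 2 := by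
  rw [← (hp.dgBasis M).repr.norm_map y, EuclideanSpace.real_norm_sq_eq, Fintype.sum_prod_type]
  exact Finset.sum_congr rfl fun m _ => by
    rw [EuclideanSpace.real_norm_sq_eq]
    rfl

theorem cell_siteEquiv {K M : ℕ} (hK : 0 < K) (m : Fin M) (k : Fin K) :
    cell (K * M) (siteEquiv K M (m, k))
      = Ico ((m + (k : ℝ) / K) / M) ((m + ((k : ℝ) + 1) / K) / M) := by
  have hK' : (0 : ℝ) < K := by exact_mod_cast hK
  have hM' : (0 : ℝ) < M := by exact_mod_cast m.pos
  have h : ((siteEquiv K M (m, k) : ℕ) : ℝ) = k + K * m := by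
    rw [siteEquiv_val]
    push_cast
    rfl
  rw [cell, h]
  push_cast
  congr 1 <;> field_simp <;> ring

theorem cell_siteEquiv_subset {K M : ℕ} (hK : 0 < K) (m : Fin M) (k : Fin K) :
    cell (K * M) (siteEquiv K M (m, k)) ⊆ cell M m := by
  have hK' : (0 : ℝ) < K := by exact_mod_cast hK
  have hk : (k : ℝ) + 1 ≤ K := by exact_mod_cast k.isLt
  rw [cell_siteEquiv hK, cell]
  refine Ico_subset_Ico ?_ ?_ <;> gcongr
  · have : (0 : ℝ) ≤ (k : ℝ) / K := by positivity
    linarith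
  · exact (div_le_one hK').2 hk

theorem inner_indicator_cellEmbed {K M : ℕ} (hK : 0 < K) (m m' : Fin M) (k : Fin K) (i : Fin d) :
    inner ℝ (indicatorConstLp 2 (measurableSet_cell (K * M) (siteEquiv K M (m', k)))
        (measure_ne_top (volume.restrict (Ico (0 : ℝ) 1)) _) (1 : ℝ)) (cellEmbed M m (p i))
      = if m = m' then (√(K * M : ℕ))⁻¹ * cellVector p K k i else 0 := by
  have hK' : (0 : ℝ) < K := by exact_mod_cast hK
  have hM' : (0 : ℝ) < M := by exact_mod_cast m.pos
  have hsub := cell_siteEquiv_subset hK m' k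
  rw [L2.inner_indicatorConstLp_one, Measure.restrict_restrict (measurableSet_cell _ _),
    inter_eq_left.2 (hsub.trans (cell_subset m'))]
  have h1 : ∫ θ in cell (K * M) (siteEquiv K M (m', k)), cellEmbed M m (p i) θ
      = ∫ θ in cell (K * M) (siteEquiv K M (m', k)), cellPoly M m (p i) θ :=
    integral_congr_ae (ae_restrict_of_ae_restrict_of_subset (hsub.trans (cell_subset m'))
      (coeFn_cellEmbed m (p i)))
  rw [h1]
  split_ifs with h
  · subst h
    rw [setIntegral_congr_fun (measurableSet_cell _ _)
      (fun θ hθ => cellPoly_of_mem (p i) (hsub hθ)), integral_const_mul, cell_siteEquiv hK,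
      setIntegral_rescale m (fun s => (p i).eval s) (by gcongr; linarith)]
    have h2 : cellVector p K k i
      = √K * ∫ x in ((k : ℝ) / K)..(((k : ℝ) + 1) / K), (p i).eval x := rfl
    rw [h2, Nat.cast_mul, Real.sqrt_mul hK'.le]
    have h3 := Real.mul_self_sqrt hM'.le
    have h4 : (M : ℝ)⁻¹ = (√M)⁻¹ * (√M)⁻¹ := by rw [← mul_inv, h3]
    have h5 : √(M : ℝ) ≠ 0 := by positivity
    have h6 : √(K : ℝ) ≠ 0 := by positivity
    rw [h4]
    field_simp
  · rw [setIntegral_congr_fun (measurableSet_cell _ _)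
      (fun θ hθ => cellPoly_of_mem_of_ne (p i) (hsub hθ) (Ne.symm h)), integral_zero]

/-- The orthogonal projection is not seen by inner products with elements of its range. -/
theorem inner_coarseMap {N M : ℕ} [NeZero M] (x : EuclideanSpace ℝ (Fin N)) (y : dgSpace L M) :
    inner ℝ y (coarseMap L M N x) = inner ℝ (y : L2Torus) (stepEmbed N x) :=
  Submodule.inner_orthogonalProjectionOnto_eq_of_mem_left y (stepEmbed N x)

theorem stepEmbed_apply {N : ℕ} (x : EuclideanSpace ℝ (Fin N)) :
    stepEmbed N x = ∑ j : Fin N,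
      x j • indicatorConstLp 2 (measurableSet_cell N j) (measure_ne_top _ _) (1 : ℝ) := rfl

/-- On each cell, the coarse-graining is a rescaled block map of the cell averages. -/
theorem IsOrthonormalPoly.cellCoord_coarseMap (hp : IsOrthonormalPoly L p) {K M : ℕ} [NeZero M]
    (hK : 0 < K) (m : Fin M) (x : EuclideanSpace ℝ (Fin (K * M))) :
    hp.cellCoord M m (coarseMap L M (K * M) x)
      = (√(K * M : ℕ))⁻¹ • blockMap (cellVector p K) (blockRestrict K M m x) := by
  ext i
  rw [cellCoord_apply, OrthonormalBasis.repr_apply_apply, inner_coarseMap, hp.coe_dgBasis,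
    real_inner_comm, stepEmbed_apply, sum_inner, ← (siteEquiv K M).sum_comp, Fintype.sum_prod_type]
  simp only [real_inner_smul_left, inner_indicator_cellEmbed hK, mul_ite, mul_zero]
  rw [Finset.sum_eq_single m (fun m' _ hne => by simp [Ne.symm hne]) (by simp)]
  simp [blockMap_apply, blockRestrict_apply, Finset.mul_sum, mul_left_comm]

end Basis

/-! ### The Hessian of the coarse-grained Hamiltonian -/

section Main

variable {L d : ℕ} {p : Fin d → ℝ[X]}

theorem IsOrthonormalPoly.eq_of_cellCoord_eq (hp : IsOrthonormalPoly L p) {M : ℕ} [NeZero M]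
    {y z : dgSpace L M} (h : ∀ m, hp.cellCoord M m y = hp.cellCoord M m z) : y = z := by
  have h1 := hp.sum_norm_cellCoord_sq M (y - z)
  simp only [map_sub, h, sub_self, norm_zero, ne_eq, OfNat.ofNat_ne_zero, not_false_eq_true,
    zero_pow, Finset.sum_const_zero] at h1
  exact sub_eq_zero.1 (norm_eq_zero.1 (pow_eq_zero_iff two_ne_zero |>.1 h1.symm))

/-- The fibre integral over `y` is a product of one function evaluated at the rescaled coordinates
of `y` on the cells. -/
theorem IsOrthonormalPoly.exists_fibreIntegral_eq_prod (hp : IsOrthonormalPoly L p) (ψ : ℝ → ℝ)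
    {K M : ℕ} [NeZero M] (hK : 0 < K) (hsurj : Function.Surjective (blockMap (cellVector p K)))
    {f : EuclideanSpace ℝ (Fin d) → ℝ}
    (hf : ∀ x, kerIntegral (blockMap (cellVector p K)) (gibbsWeight ψ K) x
      = f (blockMap (cellVector p K) x)) :
    ∃ κ : ℝ, 0 < κ ∧ ∀ y, fibreIntegral ψ L M (K * M) y
      = κ * ∏ m, f (√(K * M : ℕ) • hp.cellCoord M m y) := by
  have hN : √((K * M : ℕ) : ℝ) ≠ 0 := by
    have : 0 < K * M := Nat.mul_pos hK (NeZero.pos M)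
    positivity
  have hc : ∀ m x, √(K * M : ℕ) • hp.cellCoord M m (coarseMap L M (K * M) x)
      = blockMap (cellVector p K) (blockRestrict K M m x) := fun m x => by
    rw [hp.cellCoord_coarseMap hK, smul_inv_smul₀ hN]
  obtain ⟨κ, hκ, h⟩ := exists_kerIntegral_eq_prod ψ (coarseMap L M (K * M))
    (blockMap (cellVector p K)) fun x => by
      constructor
      · intro hx m
        rw [← hc, hx, map_zero, smul_zero]
      · intro hx
        refine hp.eq_of_cellCoord_eq fun m => ?_
        have h1 := hc m x
        rw [hx m, smul_eq_zero] at h1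
        rw [h1.resolve_left hN, map_zero]
  refine ⟨κ, hκ, fun y => ?_⟩
  choose x hx using fun m => hsurj (√(K * M : ℕ) • hp.cellCoord M m y)
  have hy : coarseMap L M (K * M) (ofBlocks K M x) = y := by
    refine hp.eq_of_cellCoord_eq fun m => ?_
    rw [hp.cellCoord_coarseMap hK, blockRestrict_ofBlocks, hx, inv_smul_smul₀ hN]
  rw [← hy, fibreIntegral_eq_kerIntegral, h]
  simp only [hf, hc]

/-- The second derivative of a sum of functions of linear images. -/
theorem iteratedFDeriv_two_sum_comp {E F ι : Type*} [NormedAddCommGroup E] [NormedSpace ℝ E]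
    [NormedAddCommGroup F] [NormedSpace ℝ F] [Fintype ι] {h : F → ℝ} (hh : ContDiff ℝ 2 h)
    (T : ι → E →L[ℝ] F) (y v : E) :
    iteratedFDeriv ℝ 2 (fun y => ∑ m, h (T m y)) y ![v, v]
      = ∑ m, iteratedFDeriv ℝ 2 h (T m y) ![T m v, T m v] := by
  have h1 : ∀ m ∈ (Finset.univ : Finset ι), ContDiff ℝ 2 fun y => h (T m y) := fun m _ =>
    hh.comp (T m).contDiff
  rw [iteratedFDeriv_sum h1, Finset.sum_apply, sum_apply]
  refine Finset.sum_congr rfl fun m _ => ?_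
  have h2 := (T m).iteratedFDeriv_comp_right hh y (i := 2) le_rfl
  change iteratedFDeriv ℝ 2 (h ∘ T m) y ![v, v] = _
  rw [h2, ContinuousMultilinearMap.compContinuousLinearMap_apply]
  congr 1
  ext i
  fin_cases i <;> rfl

end Main

end CoarseGraining

open CoarseGraining in
theorem mainTheorem4 (L : ℕ) (a : ℝ) (δψ : ℝ → ℝ) (C : ℝ)
    (hsmooth : ContDiff ℝ 2 δψ)
    (hbound : ∀ z, |δψ z| < C)
    (hbound₂ : ∀ z, |iteratedDeriv 2 δψ z| < C)
    (hmean : (∫ z : ℝ, z * Real.exp (-singleSite a δψ z)) /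
      (∫ z : ℝ, Real.exp (-singleSite a δψ z)) = 0) :
    ∃ (lam Lam : ℝ) (Kstar : ℕ), 0 < lam ∧ 0 < Lam ∧ 0 < Kstar ∧
      ∀ (K M : ℕ) [NeZero M], Kstar ≤ K →
        (∀ y : dgSpace L M, 0 < fibreIntegral (singleSite a δψ) L M (K * M) y) ∧
        ContDiff ℝ 2 (coarseHamiltonian (singleSite a δψ) L M (K * M)) ∧
        ∀ y v : dgSpace L M,
          2 * lam * ‖v‖ ^ 2 ≤
            iteratedFDeriv ℝ 2 (coarseHamiltonian (singleSite a δψ) L M (K * M)) y ![v, v] ∧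
          iteratedFDeriv ℝ 2 (coarseHamiltonian (singleSite a δψ) L M (K * M)) y ![v, v] ≤
            2 * Lam * ‖v‖ ^ 2 := by
  obtain ⟨d, p, hp⟩ := exists_isOrthonormalPoly L
  obtain ⟨W, K₁, hW, hframe⟩ := hp.exists_isUniformFrame
  obtain ⟨K₀, lam, Lam, hK₀, hlam, hLam, hblock⟩ := exists_block_hessian_bounds
    (EuclideanSpace ℝ (Fin d)) C (3 * C) hW (by norm_num : (0 : ℝ) < 1 / 4)
  refine ⟨lam / 2, Lam / 2, max K₀ K₁, by positivity, by positivity, by positivity,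
    fun K M _ hK => ?_⟩
  have hK0 : 0 < K := hK₀.trans_le ((le_max_left _ _).trans hK)
  have hv := hframe K ((le_max_right _ _).trans hK) hK0
  obtain ⟨f, hf, hpos, hsm, hhess⟩ := hblock a δψ (hsmooth.of_le one_le_two)
    (fun z => (hbound z).le)
    (abs_deriv_le_of_abs_le_of_abs_iteratedDeriv_two_le hsmooth (fun z => (hbound z).le)
      fun z => (hbound₂ z).le) K ((le_max_left _ _).trans hK) _ hv
  obtain ⟨κ, hκ, hfib⟩ := hp.exists_fibreIntegral_eq_prod (M := M) (singleSite a δψ) hK0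
    (hv.surjective_blockMap (by norm_num)) hf
  have hN : (0 : ℝ) < (K * M : ℕ) := by exact_mod_cast Nat.mul_pos hK0 (NeZero.pos M)
  set N : ℝ := ((K * M : ℕ) : ℝ) with hNdef
  set h : EuclideanSpace ℝ (Fin d) → ℝ := fun ξ => N⁻¹ • -Real.log (f ξ) with hh
  have hlog : ContDiff ℝ 2 fun ξ => -Real.log (f ξ) := (hsm.log fun ξ => (hpos ξ).ne').neg
  have hhc : ContDiff ℝ 2 h := hlog.const_smul _
  -- the factor `√N` in the coordinates makes up for the factor `1 / N` of the Hamiltonian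
  set T : Fin M → dgSpace L M →L[ℝ] EuclideanSpace ℝ (Fin d) := fun m =>
    √N • hp.cellCoord M m with hT
  have hsumc : ContDiff ℝ 2 fun y => ∑ m, h (T m y) :=
    ContDiff.sum fun m _ => hhc.comp (T m).contDiff
  have heq : coarseHamiltonian (singleSite a δψ) L M (K * M)
      = fun y => ∑ m, h (T m y) + ((0 : dgSpace L M →L[ℝ] ℝ) y + -(1 / N * Real.log κ)) := by
    funext y
    rw [coarseHamiltonian, hfib, Real.log_mul hκ.ne' (Finset.prod_ne_zero_iff.2 fun m _ =>
      (hpos _).ne'), Real.log_prod fun m _ => (hpos _).ne']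
    simp only [hh, hT, smul_eq_mul, ← Finset.mul_sum, Finset.sum_neg_distrib,
      smul_apply, zero_apply, ← hNdef]
    ring
  have hnorm : ∀ v : dgSpace L M, ∑ m, ‖T m v‖ ^ 2 = N * ‖v‖ ^ 2 := fun v => by
    rw [← hp.sum_norm_cellCoord_sq M v, Finset.mul_sum]
    exact Finset.sum_congr rfl fun m _ => by
      rw [hT, smul_apply, norm_smul, mul_pow, Real.norm_eq_abs, sq_abs,
        Real.sq_sqrt hN.le]
  refine ⟨fun y => ?_, ?_, fun y v => ?_⟩
  · rw [hfib]
    exact mul_pos hκ (Finset.prod_pos fun m _ => hpos _)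
  · rw [heq]
    exact hsumc.add (by fun_prop)
  · have hval : iteratedFDeriv ℝ 2 (coarseHamiltonian (singleSite a δψ) L M (K * M)) y ![v, v]
        = N⁻¹ * ∑ m, iteratedFDeriv ℝ 2 (fun ξ => -Real.log (f ξ)) (T m y) ![T m v, T m v] := by
      rw [heq, iteratedFDeriv_two_add_affine hsumc, iteratedFDeriv_two_sum_comp hhc,
        Finset.mul_sum]
      refine Finset.sum_congr rfl fun m _ => ?_
      rw [hh, iteratedFDeriv_const_smul_apply' hlog.contDiffAt]
      rfl
    have hmul : ∀ c : ℝ, 2 * (c / 2) * ‖v‖ ^ 2 = N⁻¹ * ∑ m, c * ‖T m v‖ ^ 2 := fun c => by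
      rw [← Finset.mul_sum, hnorm]
      field_simp
    rw [hval, hmul, hmul]
    constructor
    · gcongr with m
      exact (hhess _ _).1
    · gcongr with m
      exact (hhess _ _).2
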